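/- **Setting.** Let $n\ge 1$, $m=(m_1,\dots,m_n)$ with integers $m_i\ge 1$, $N=m_1+\cdots+m_n$, $a=(a_1,\dots,a_n)\in[1,\infty)^n$, $a\cdot m=\sum_i a_im_i$. For $x=(x_1,\dots,x_n)\in\mathbb R^N$, $x_i\in\mathbb R^{m_i}$, put $|x|_a=\sum_{i=1}^n|x_i|^{1/a_i}$ and $2^{ta}x=(2^{ta_1}x_1,\dots,2^{ta_n}x_n)$. Fix a symmetric nonnegative $\phi_{-1}\in C^\infty(\mathbb R^N)$ with $\phi_{-1}(\xi)=1$ if $|\xi|_a\le 1/2$ and $\phi_{-1}(\xi)=0$ if $|\xi|_a>2/3$; for $j\ge0$ let $\phi_j(\xi)=\phi_{-1}(2^{-a(j+1)}\xi)-\phi_{-1}(2^{-aj}\xi)$, and for $f\in\mathscr S'(\mathbb R^N)$ let $\mathcal R_jf=(\phi_j\hat f)\check{\ }$, with $\hat f(\xi)=(2\pi)^{-N/2}\int e^{-i\xi\cdot x}f(x)\,dx$. An *admissible weight* is a $C^\infty$ function $\rho:\mathbb R^N\to(0,\infty)$ such that for every $j\ge1$ there is $C_j>0$ with $|\nabla^j\rho|\le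 C_j\rho$, and for some $C,\kappa>0$, $\rho(x)\le C\rho(y)(1+|x-y|_a^\kappa)$ for all $x,y$. Write $\|f\|_{L^p(\rho)}=\|\rho f\|_{L^p}$, $$\|f\|_{B^{s,a}_{p,q}(\rho)}=\Big(\sum_{j\ge-1}2^{sjq}\|\mathcal R_jf\|_{L^p(\rho)}^q\Big)^{1/q},\qquad B^{s,a}_{p,q}(\rho)=\{f\in\mathscr S'(\mathbb R^N):\|f\|_{B^{s,a}_{p,q}(\rho)}<\infty\},$$ and, for $s>0$ and a function $f$, with $\delta_hf(x)=f(x+h)-f(x)$, $\delta_h^{(M)}=\delta_h\delta_h^{(M-1)}$ and $[s]$ the integer part of $s$, $$\|f\|_{\widetilde B^{s,a}_{p,q}(\rho)}=\Big(\int_{|h|_a\le1}\Big(\frac{\|\delta_h^{([s]+1)}f\|_{L^p(\rho)}}{|h|_a^s}\Big)^q\frac{dh}{|h|_a^{a\cdot m}}\Big)^{1/q}+\|f\|_{L^p(\rho)},$$ with a supremum over $j$, respectively an essential supremum over $h$, when $q=\infty$. The weight is omitted when $\rho\equiv1$. $A\asymp_CB$ means $C^{-1}B\le A\le CB$. **Theorem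 2.5.** Let $\rho$ be an admissible weight and $p,q\in[1,\infty]$. 1. For every $s>0$ there is a constant $C\ge1$, depending only on $\rho,a,m,p,q,s$ (and the fixed $\phi_{-1}$), such that every $f\in B^{s,a}_{p,q}(\rho)$ is a function and $$\|f\|_{B^{s,a}_{p,q}(\rho)}\asymp_C\|f\|_{\widetilde B^{s,a}_{p,q}(\rho)}\asymp_C\|\rho f\|_{\widetilde B^{s,a}_{p,q}}.$$ 2. For every $s\in\mathbb R$ there is a constant $C\ge1$, depending only on the same data, such that for all $f\in\mathscr S'(\mathbb R^N)$, as elements of $[0,\infty]$, $$\|f\|_{B^{s,a}_{p,q}(\rho)}\asymp_C\|\rho f\|_{B^{s,a}_{p,q}}.$$ -/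

import Mathlib

open MeasureTheory SchwartzMap
open scoped ENNReal NNReal ContDiff FourierTransform

noncomputable section

namespace AnisoBesov

/-- The space `ℝ^N = ℝ^{m_1} × ⋯ × ℝ^{m_n}`, `N = m_1 + ⋯ + m_n`, with its Euclidean structure and
Lebesgue measure; `x i` is the block `x_i ∈ ℝ^{m_i}` of `x`. -/
abbrev Space {n : ℕ} (m : Fin n → ℕ) : Type :=
  PiLp 2 (fun i : Fin n => EuclideanSpace ℝ (Fin (m i)))

variable {n : ℕ} {m : Fin n → ℕ}

/-- The anisotropic modulus `|x|_a = ∑ i, |x_i| ^ (1 / a_i)`. -/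
def anorm (a : Fin n → ℝ) (x : Space m) : ℝ := ∑ i, ‖x i‖ ^ (1 / a i)

/-- The homogeneous dimension `a · m = a_1 m_1 + ⋯ + a_n m_n`. -/
def homDim (a : Fin n → ℝ) (m : Fin n → ℕ) : ℝ := ∑ i, a i * (m i : ℝ)

/-- The anisotropic dilation `2^{t a} x = (2^{t a_1} x_1, …, 2^{t a_n} x_n)`. -/
def dilate (a : Fin n → ℝ) (t : ℝ) (x : Space m) : Space m :=
  WithLp.toLp 2 (fun i => ((2 : ℝ) ^ (t * a i)) • x i)

/-- `φ` is an admissible choice of the low-frequency cut-off `φ^a_{-1}`: a symmetric nonnegative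
smooth function equal to `1` on `{|ξ|_a ≤ 1/2}` and to `0` off `{|ξ|_a ≤ 2/3}`. -/
structure IsCutoff (a : Fin n → ℝ) (φ : Space m → ℝ) : Prop where
  smooth : ContDiff ℝ ∞ φ
  symmetric : ∀ ξ, φ (-ξ) = φ ξ
  nonneg : ∀ ξ, 0 ≤ φ ξ
  eq_one : ∀ ξ, anorm a ξ ≤ 1 / 2 → φ ξ = 1
  eq_zero : ∀ ξ, 2 / 3 < anorm a ξ → φ ξ = 0

/-- The dyadic decomposition of the frequency space. The natural number `k` stands for the index
`j = k - 1 ≥ -1`: the value at `0` is `φ^a_{-1} = φ`, and the value at `j + 1` is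
`φ^a_j(ξ) = φ(2^{-a(j+1)} ξ) - φ(2^{-aj} ξ)`. -/
def dyadic (a : Fin n → ℝ) (φ : Space m → ℝ) : ℕ → Space m → ℝ
  | 0 => φ
  | j + 1 => fun ξ => φ (dilate a (-((j : ℝ) + 1)) ξ) - φ (dilate a (-(j : ℝ)) ξ)

/-- The block operator `R^a_j f = (φ^a_j f̂)ˇ` on tempered distributions, `j = k - 1`.
Mathlib's Fourier transform has the kernel `exp (-2πi x·ξ)`, so the multiplier with symbol `σ(ξ)` for
the kernel `exp (-i x·ξ)` is Mathlib's multiplier with symbol `σ(2πξ)`. -/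
def block (a : Fin n → ℝ) (φ : Space m → ℝ) (k : ℕ) (f : 𝓢'(Space m, ℂ)) : 𝓢'(Space m, ℂ) :=
  TemperedDistribution.fourierMultiplierCLM ℂ
    (fun ξ : Space m => ((dyadic a φ k ((2 * Real.pi) • ξ) : ℝ) : ℂ)) f

/-- The set `𝒲` of admissible weights. -/
structure IsAdmissibleWeight (a : Fin n → ℝ) (ρ : Space m → ℝ) : Prop where
  smooth : ContDiff ℝ ∞ ρ
  pos : ∀ x, 0 < ρ x
  deriv_bound : ∀ j : ℕ, 1 ≤ j → ∃ C : ℝ, 0 < C ∧ ∀ x, ‖iteratedFDeriv ℝ j ρ x‖ ≤ C * ρ x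
  growth : ∃ C κ : ℝ, 0 < C ∧ 0 < κ ∧ ∀ x y, ρ x ≤ C * ρ y * (1 + anorm a (x - y) ^ κ)

/-- The function `g` is (a version of) the tempered distribution `u`: `⟨u, ψ⟩ = ∫ ψ g` for every
Schwartz function `ψ`. Such a `g` is unique up to null sets. -/
def Represents (g : Space m → ℂ) (u : 𝓢'(Space m, ℂ)) : Prop :=
  AEStronglyMeasurable g volume ∧
    ∀ ψ : 𝓢(Space m, ℂ), Integrable (fun x => ψ x * g x) volume ∧ u ψ = ∫ x, ψ x * g x

/-- `‖g‖_{L^p(ρ)} = ‖ρ g‖_p` for a function `g`. -/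
def wLpNorm (ρ : Space m → ℝ) (p : ℝ≥0∞) (g : Space m → ℂ) : ℝ≥0∞ :=
  eLpNorm (fun x => (ρ x : ℂ) * g x) p volume

/-- `‖u‖_{L^p(ρ)}` for a tempered distribution `u`: the norm of the function that represents `u`
(any two such functions agree almost everywhere), and `∞` if `u` is not a function. -/
def distWLpNorm (ρ : Space m → ℝ) (p : ℝ≥0∞) (u : 𝓢'(Space m, ℂ)) : ℝ≥0∞ :=
  ⨅ (g : Space m → ℂ) (_ : Represents g u), wLpNorm ρ p g

/-- The weighted anisotropic Besov norm
`‖f‖_{B^{s,a}_{p,q}(ρ)} = (∑_{j ≥ -1} 2^{sjq} ‖R^a_j f‖_{L^p(ρ)}^q)^{1/q}` (a supremum if `q = ∞`),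
with `j = k - 1`; the unweighted norm is the case `ρ = 1`. -/
def besovNorm (a : Fin n → ℝ) (φ : Space m → ℝ) (s : ℝ) (p q : ℝ≥0∞) (ρ : Space m → ℝ)
    (f : 𝓢'(Space m, ℂ)) : ℝ≥0∞ :=
  eLpNorm (fun k : ℕ =>
    ENNReal.ofReal ((2 : ℝ) ^ (s * ((k : ℝ) - 1))) * distWLpNorm ρ p (block a φ k f))
    q Measure.count

/-- The weighted anisotropic Besov space `B^{s,a}_{p,q}(ρ)`. -/
def besovSpace (a : Fin n → ℝ) (φ : Space m → ℝ) (s : ℝ) (p q : ℝ≥0∞) (ρ : Space m → ℝ) :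
    Set 𝓢'(Space m, ℂ) :=
  {f | besovNorm a φ s p q ρ f < ⊤}

/-- The measure `dh / |h|_a^{a·m}` on `{|h|_a ≤ 1}`. -/
def incrementMeasure (a : Fin n → ℝ) (m : Fin n → ℕ) : Measure (Space m) :=
  (volume.restrict {h : Space m | anorm a h ≤ 1}).withDensity
    (fun h => ENNReal.ofReal (anorm a h ^ (-(homDim a m))))

/-- The finite-difference norm of a function `g`, with differences of order `M = [s] + 1`:
`(∫_{|h|_a ≤ 1} (‖δ_h^{(M)} g‖_{L^p(ρ)} / |h|_a^s)^q dh / |h|_a^{a·m})^{1/q} + ‖g‖_{L^p(ρ)}`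
(an essential supremum over `h` if `q = ∞`). -/
def diffNorm (a : Fin n → ℝ) (s : ℝ) (p q : ℝ≥0∞) (ρ : Space m → ℝ) (g : Space m → ℂ) : ℝ≥0∞ :=
  eLpNorm (fun h : Space m =>
      wLpNorm ρ p ((fwdDiff h)^[⌊s⌋₊ + 1] g) / ENNReal.ofReal (anorm a h ^ s))
    q (incrementMeasure a m) + wLpNorm ρ p g

/-- The product `ρ f` of a tempered distribution with a smooth weight: `⟨ρ f, ψ⟩ = ⟨f, ρ ψ⟩`. -/
def weightMul (ρ : Space m → ℝ) (f : 𝓢'(Space m, ℂ)) : 𝓢'(Space m, ℂ) :=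
  TemperedDistribution.smulLeftCLM ℂ (fun x => (ρ x : ℂ)) f

/-- `A ≍_C B`, that is `C⁻¹ B ≤ A ≤ C B`, in `[0, ∞]`. -/
def Comparable (C : ℝ≥0) (A B : ℝ≥0∞) : Prop := (C : ℝ≥0∞)⁻¹ * B ≤ A ∧ A ≤ C * B

end AnisoBesov

end

/-! The theorem is almost orthogonality between frequency scales, followed by Schur tests, first in
space and then in the scale index. Write `R_k` for the block of index `k`; the block `k = 0` is the
low-pass one, and the symbols of the others vanish near the origin.

Weights. Expand `u f` as the sum of `u R_k f` and apply `R_j`. Since `R_k` is reproduced by a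
slightly fatter multiplier, `R_j (u R_k f)` is an integral operator acting on `R_k f`, with kernel
`sandwich`. Rescale to the coarser of the two scales. The weight becomes slowly varying, so the
weight times the coarse kernel is a Schwartz function whose norms are bounded by the weight at the
base point. The finer multiplier only sees frequencies of size at least `2^{|j-k|}`, where a
Schwartz function is small, so the kernel carries a factor `2^{-M|j-k|}` for any prescribed `M`
(`exists_weighted_sandwich_le`). Taking `M > |s|` and summing gives one inequality of the second
claim (`exists_besovNorm_weightMul_le`). The reciprocal of a weight is again a weight
(`IsWeight.inv`), which gives the other.

Differences bounded by blocks. Let `M = [s] + 1`. For `|h|_a` of size `2^{-j}`, the `M`-th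
difference of `R_k f` has norm at most a constant times `min(1, 2^{-M(j-k)}) ‖R_k f‖`. The gain
arises by letting the differences fall on the reproducing kernel, whose scale is `2^{-k}`. As `0 < s
< M`, the weighted double sum is geometric in `|j - k|`. Positivity of `s` also makes the series of
the blocks converge in `L^p(ρ)`, so that `f` is a function (`exists_diffNorm_le`).

Blocks bounded by differences. Centred differences of order `2M`, averaged over an anisotropic
annulus of steps `h`, form a multiplier whose symbol is the integral of `(2 cos(2π h·ξ) - 2)^M`. The
integrand has a constant sign, so the symbol vanishes only at the origin, and the annular block
symbol is a Schwartz multiple of it (`IsLowPass.exists_mul_diffSymbol_eq`). Hence each block of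
positive index is an average of differences of a smoothed `f`. Half of the `2M` differences are
discarded by boundedness and the rest give the difference norm (`exists_besovNorm_le`).

The comparison with `ρ f` follows by applying both bounds with weight `ρ` to `f` and with weight `1`
to `ρ f`, joined by the second claim. -/

noncomputable section

namespace AnisoBesov

/-! ### Integral inequalities in `L^p` for functions with values in `[0, ∞]`. -/

section LpInequalities

variable {X Y : Type*} [MeasurableSpace X] [MeasurableSpace Y] {μ : Measure X} {ν : Measure Y}

/-- Jensen's inequality for a weighted integral. -/
theorem lintegral_mul_rpow_le {k f : Y → ℝ≥0∞} (hk : Measurable k) (hf : Measurable f)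
    {r : ℝ} (hr : 1 ≤ r) :
    (∫⁻ y, k y * f y ∂ν) ^ r ≤ (∫⁻ y, k y ∂ν) ^ (r - 1) * ∫⁻ y, k y * f y ^ r ∂ν := by
  have h := eLpNorm_le_eLpNorm_mul_rpow_measure_univ (p := 1) (q := ENNReal.ofReal r)
    (μ := ν.withDensity k) (f := f) (by simpa using ENNReal.ofReal_le_ofReal hr)
    hf.aestronglyMeasurable
  have hr0 : 0 < r := by linarith
  rw [eLpNorm_one_eq_lintegral_enorm, eLpNorm_eq_lintegral_rpow_enorm_toReal
    (by simpa using hr0) (by simp), ENNReal.toReal_ofReal hr0.le] at h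
  simp only [enorm_eq_self] at h
  rw [lintegral_withDensity_eq_lintegral_mul _ hk hf,
    lintegral_withDensity_eq_lintegral_mul _ hk (hf.pow_const r),
    withDensity_apply _ MeasurableSet.univ, Measure.restrict_univ] at h
  have h2 := ENNReal.rpow_le_rpow h hr0.le
  rw [ENNReal.mul_rpow_of_nonneg _ _ hr0.le, ← ENNReal.rpow_mul, ← ENNReal.rpow_mul] at h2
  have e1 : 1 / r * r = 1 := by field_simp
  have e2 : (1 / (1 : ℝ≥0∞).toReal - 1 / r) * r = r - 1 := by
    simp; field_simp
  rw [e1, e2, ENNReal.rpow_one] at h2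
  rw [mul_comm]
  exact h2

theorem eLpNorm_rpow_eq_lintegral {f : X → ℝ≥0∞} {p : ℝ≥0∞} (h0 : p ≠ 0) (h1 : p ≠ ⊤) :
    eLpNorm f p μ = (∫⁻ x, f x ^ p.toReal ∂μ) ^ (1 / p.toReal) := by
  simpa using eLpNorm_eq_lintegral_rpow_enorm_toReal h0 h1 (f := f) (μ := μ)

theorem eLpNorm_const_mul_ennreal (c : ℝ≥0) (f : X → ℝ≥0∞) (p : ℝ≥0∞) :
    eLpNorm (fun x => (c : ℝ≥0∞) * f x) p μ ≤ c * eLpNorm f p μ :=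
  eLpNorm_le_nnreal_smul_eLpNorm_of_ae_le_mul' (c := c) (Filter.Eventually.of_forall fun x => by simp) p

/-- The Schur test on `L^p`, for nonnegative kernels. -/
theorem eLpNorm_lintegral_kernel_le [SFinite μ] [SFinite ν] {k : X → Y → ℝ≥0∞}
    (hk : Measurable (Function.uncurry k)) {Γ : ℝ≥0} (h1 : ∀ x, ∫⁻ y, k x y ∂ν ≤ Γ)
    (h2 : ∀ y, ∫⁻ x, k x y ∂μ ≤ Γ) {f : Y → ℝ≥0∞} (hf : Measurable f) {p : ℝ≥0∞} (hp : 1 ≤ p) :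
    eLpNorm (fun x => ∫⁻ y, k x y * f y ∂ν) p μ ≤ Γ * eLpNorm f p ν := by
  have hk1 : ∀ x, Measurable (k x) := fun x => hk.comp measurable_prodMk_left
  have hk2 : ∀ y, Measurable fun x => k x y := fun y => hk.comp measurable_prodMk_right
  rcases eq_or_ne p ∞ with rfl | hpt
  · rw [eLpNorm_exponent_top, eLpNorm_exponent_top]
    refine essSup_le_of_ae_le _ (Filter.Eventually.of_forall fun x => ?_)
    simp only [enorm_eq_self]
    calc ∫⁻ y, k x y * f y ∂ν ≤ ∫⁻ y, k x y * eLpNormEssSup f ν ∂ν := by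
          refine lintegral_mono_ae ?_
          filter_upwards [enorm_ae_le_eLpNormEssSup f ν] with y hy
          simp only [enorm_eq_self] at hy
          gcongr
      _ = (∫⁻ y, k x y ∂ν) * eLpNormEssSup f ν :=
          lintegral_mul_const _ (hk1 x)
      _ ≤ _ := by gcongr; exact h1 x
  · have hp0 : p ≠ 0 := by rintro rfl; simp at hp
    have hr : 1 ≤ p.toReal := by
      rw [← ENNReal.toReal_one]; exact ENNReal.toReal_mono hpt hp
    set r := p.toReal
    rw [eLpNorm_rpow_eq_lintegral hp0 hpt, eLpNorm_rpow_eq_lintegral hp0 hpt]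
    -- Jensen in `y` uses the row bound `r - 1` times; after Tonelli the column bound is used once.
    have key : ∫⁻ x, (∫⁻ y, k x y * f y ∂ν) ^ r ∂μ ≤ (Γ : ℝ≥0∞) ^ r * ∫⁻ y, f y ^ r ∂ν := by
      calc ∫⁻ x, (∫⁻ y, k x y * f y ∂ν) ^ r ∂μ
          ≤ ∫⁻ x, (Γ : ℝ≥0∞) ^ (r - 1) * ∫⁻ y, k x y * f y ^ r ∂ν ∂μ := by
            refine lintegral_mono fun x => ?_
            refine (lintegral_mul_rpow_le (hk1 x) hf hr).trans ?_
            exact mul_le_mul_left (ENNReal.rpow_le_rpow (h1 x) (by linarith)) _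
        _ = (Γ : ℝ≥0∞) ^ (r - 1) * ∫⁻ x, ∫⁻ y, k x y * f y ^ r ∂ν ∂μ := by
            refine lintegral_const_mul _ ?_
            exact Measurable.lintegral_prod_right'
              (f := fun z : X × Y => k z.1 z.2 * f z.2 ^ r)
              (hk.mul ((hf.comp measurable_snd).pow_const r))
        _ = (Γ : ℝ≥0∞) ^ (r - 1) * ∫⁻ y, ∫⁻ x, k x y * f y ^ r ∂μ ∂ν := by
            rw [lintegral_lintegral_swap]
            exact (hk.mul ((hf.comp measurable_snd).pow_const r)).aemeasurable
        _ ≤ (Γ : ℝ≥0∞) ^ (r - 1) * ∫⁻ y, Γ * f y ^ r ∂ν := by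
            gcongr with y
            rw [lintegral_mul_const _ (hk2 y)]
            gcongr
            exact h2 y
        _ = _ := by
            rw [lintegral_const_mul _ (hf.pow_const r), ← mul_assoc]
            congr 1
            rcases eq_or_ne Γ 0 with rfl | hΓ
            · simp [ENNReal.zero_rpow_of_pos (show 0 < r by linarith)]
            · nth_rewrite 2 [← ENNReal.rpow_one (Γ : ℝ≥0∞)]
              rw [← ENNReal.rpow_add _ _ (by simpa using hΓ) (by simp)]
              congr 1; ring
    refine (ENNReal.rpow_le_rpow key (by positivity)).trans ?_
    rw [ENNReal.mul_rpow_of_nonneg _ _ (by positivity), ← ENNReal.rpow_mul,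
      mul_one_div_cancel (by linarith), ENNReal.rpow_one]

/-- Measurability of `y ↦ ‖F(·, y)‖_p`. -/
theorem measurable_eLpNorm_section [SFinite μ] {F : X → Y → ℝ≥0∞}
    (hF : Measurable (Function.uncurry F)) {p : ℝ≥0∞} (hp : 1 ≤ p) :
    Measurable fun y => eLpNorm (fun x => F x y) p μ := by
  rcases eq_or_ne p ∞ with rfl | hpt
  · refine measurable_of_Ioi fun t => ?_
    -- For `p = ∞` the superlevel sets are read off from the measures of the sections `{t < F(·,
    -- y)}`, which depend measurably on `y`.
    have : (fun y => eLpNorm (fun x => F x y) ∞ μ) ⁻¹' Set.Ioi t =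
        {y | μ {x | t < F x y} ≠ 0} := by
      ext y
      simp only [Set.mem_preimage, Set.mem_Ioi, eLpNorm_exponent_top, Set.mem_ofPred_eq]
      rw [← not_iff_not, not_lt, not_not]
      constructor
      · intro h
        have := enorm_ae_le_eLpNormEssSup (fun x => F x y) μ
        rw [ae_iff] at this
        refine measure_mono_null ?_ this
        intro x hx
        simp only [enorm_eq_self, Set.mem_ofPred_eq, not_le] at hx ⊢
        exact h.trans_lt hx
      · intro h
        refine essSup_le_of_ae_le _ ?_
        rw [Filter.EventuallyLE, ae_iff]
        simpa using h
    rw [this]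
    have hs : MeasurableSet {z : X × Y | t < F z.1 z.2} := measurableSet_lt measurable_const hF
    exact (measurable_measure_prodMk_right (μ := μ) hs) (measurableSet_singleton (0 : ℝ≥0∞)).compl
  · have hp0 : p ≠ 0 := by rintro rfl; simp at hp
    have : (fun y => eLpNorm (fun x => F x y) p μ) =
        fun y => (∫⁻ x, F x y ^ p.toReal ∂μ) ^ (1 / p.toReal) :=
      funext fun y => eLpNorm_rpow_eq_lintegral hp0 hpt
    rw [this]
    exact (Measurable.lintegral_prod_left' (f := fun z : X × Y => F z.1 z.2 ^ p.toReal)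
      (hF.pow_const _)).pow_const _

/-- Minkowski's integral inequality. -/
theorem eLpNorm_lintegral_le [SFinite μ] [SFinite ν] {F : X → Y → ℝ≥0∞}
    (hF : Measurable (Function.uncurry F)) {p : ℝ≥0∞} (hp : 1 ≤ p) :
    eLpNorm (fun x => ∫⁻ y, F x y ∂ν) p μ ≤ ∫⁻ y, eLpNorm (fun x => F x y) p μ ∂ν := by
  have hc := measurable_eLpNorm_section (μ := μ) hF hp
  have hF2 : ∀ y, Measurable fun x => F x y := fun y => hF.comp measurable_prodMk_right
  set c : Y → ℝ≥0∞ := fun y => eLpNorm (fun x => F x y) p μ with hcdef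
  rcases eq_or_ne p ∞ with rfl | hpt
  · rw [eLpNorm_exponent_top]
    have h1 : ∀ᵐ y ∂ν, ∀ᵐ x ∂μ, F x y ≤ c y := Filter.Eventually.of_forall fun y => by
      have := enorm_ae_le_eLpNormEssSup (fun x => F x y) μ
      simpa [hcdef] using this
    have hs : MeasurableSet {z : Y × X | F z.2 z.1 ≤ c z.1} :=
      measurableSet_le (hF.comp measurable_swap) (hc.comp measurable_fst)
    have h2 : ∀ᵐ x ∂μ, ∀ᵐ y ∂ν, F x y ≤ c y := (Measure.ae_ae_comm hs).1 h1
    refine essSup_le_of_ae_le _ ?_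
    filter_upwards [h2] with x hx
    simpa using lintegral_mono_ae hx
  · have hp0 : p ≠ 0 := by rintro rfl; simp at hp
    have hr : 1 ≤ p.toReal := by
      rw [← ENNReal.toReal_one]; exact ENNReal.toReal_mono hpt hp
    rcases eq_or_ne (∫⁻ y, c y ∂ν) ∞ with hI | hI
    · rw [hI]; exact le_top
    rw [eLpNorm_rpow_eq_lintegral hp0 hpt]
    have hcr : ∀ y, c y ^ p.toReal = ∫⁻ x, F x y ^ p.toReal ∂μ := fun y => by
      rw [hcdef]; simp only
      rw [eLpNorm_rpow_eq_lintegral hp0 hpt, ← ENNReal.rpow_mul,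
        one_div_mul_cancel (by linarith), ENNReal.rpow_one]
    set r := p.toReal
    have hr0 : 0 < r := by linarith
    have hct : ∀ᵐ y ∂ν, c y < ⊤ := ae_lt_top hc hI
    -- Factor out the section norms `c` and use Jensen with weight `c`; this replaces duality. Where
    -- `c y = 0` the section vanishes a.e., and `c y = ∞` is excluded a.e. because `c` has finite
    -- integral.
    have h1 : ∀ᵐ y ∂ν, ∀ᵐ x ∂μ, F x y = c y * (F x y / c y) := by
      filter_upwards [hct] with y hy
      rcases eq_or_ne (c y) 0 with h0 | h0
      · have hz : ∫⁻ x, F x y ^ r ∂μ = 0 := by rw [← hcr, h0, ENNReal.zero_rpow_of_pos hr0]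
        rw [lintegral_eq_zero_iff ((hF2 _).pow_const r)] at hz
        filter_upwards [hz] with x hx
        have : F x y = 0 := by
          simpa [ENNReal.rpow_eq_zero_iff, hr0, hr0.not_gt] using hx
        simp [this]
      · exact Filter.Eventually.of_forall fun x => (ENNReal.mul_div_cancel h0 hy.ne).symm
    have hFc : Measurable fun z : X × Y => F z.1 z.2 / c z.2 := hF.div (hc.comp measurable_snd)
    have hs : MeasurableSet {z : Y × X | F z.2 z.1 = c z.1 * (F z.2 z.1 / c z.1)} :=
      measurableSet_eq_fun (hF.comp measurable_swap)
        ((hc.comp measurable_fst).mul (hFc.comp measurable_swap))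
    have h2 : ∀ᵐ x ∂μ, ∀ᵐ y ∂ν, F x y = c y * (F x y / c y) := (Measure.ae_ae_comm hs).1 h1
    have key : ∫⁻ x, (∫⁻ y, F x y ∂ν) ^ r ∂μ ≤ (∫⁻ y, c y ∂ν) ^ r := by
      calc ∫⁻ x, (∫⁻ y, F x y ∂ν) ^ r ∂μ
          = ∫⁻ x, (∫⁻ y, c y * (F x y / c y) ∂ν) ^ r ∂μ := by
            refine lintegral_congr_ae ?_
            filter_upwards [h2] with x hx
            rw [lintegral_congr_ae hx]
        _ ≤ ∫⁻ x, (∫⁻ y, c y ∂ν) ^ (r - 1) * ∫⁻ y, c y * (F x y / c y) ^ r ∂ν ∂μ :=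
            lintegral_mono fun x => lintegral_mul_rpow_le hc (hFc.comp (measurable_prodMk_left (x := x))) hr
        _ = (∫⁻ y, c y ∂ν) ^ (r - 1) * ∫⁻ y, ∫⁻ x, c y * (F x y / c y) ^ r ∂μ ∂ν := by
            have hm : Measurable fun z : X × Y => c z.2 * (F z.1 z.2 / c z.2) ^ r :=
              (hc.comp measurable_snd).mul (hFc.pow_const r)
            rw [lintegral_const_mul _ hm.lintegral_prod_right', lintegral_lintegral_swap]
            exact hm.aemeasurable
        _ ≤ (∫⁻ y, c y ∂ν) ^ (r - 1) * ∫⁻ y, c y ∂ν := by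
            gcongr (∫⁻ y, c y ∂ν) ^ (r - 1) * ?_
            refine lintegral_mono_ae ?_
            filter_upwards [hct] with y hy
            have hFy : Measurable fun x => F x y / c y := (hF2 y).div_const _
            rw [lintegral_const_mul _ (hFy.pow_const r)]
            rcases eq_or_ne (c y) 0 with h0 | h0
            · simp [h0]
            · have : ∀ x, (F x y / c y) ^ r = (c y ^ r)⁻¹ * F x y ^ r := fun x => by
                rw [ENNReal.div_rpow_of_nonneg _ _ hr0.le, ENNReal.div_eq_inv_mul]
              simp_rw [this]
              rw [lintegral_const_mul _ ((hF2 _).pow_const r), ← hcr,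
                ENNReal.inv_mul_cancel, mul_one]
              · simp [ENNReal.rpow_eq_zero_iff, h0, hr0.not_gt]
              · simp [ENNReal.rpow_eq_top_iff, hy.ne, hr0.not_gt]
        _ ≤ (∫⁻ y, c y ∂ν) ^ r := by
            rcases eq_or_ne (∫⁻ y, c y ∂ν) 0 with h0 | h0
            · simp [h0]
            · nth_rewrite 2 [← ENNReal.rpow_one (∫⁻ y, c y ∂ν)]
              rw [← ENNReal.rpow_add _ _ h0 hI]
              simp
    refine (ENNReal.rpow_le_rpow key (by positivity)).trans ?_
    rw [← ENNReal.rpow_mul, mul_one_div_cancel hr0.ne', ENNReal.rpow_one]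

end LpInequalities

/-! ### Schur test over the scale index. -/

section Discrete

/-- The map `k ↦ j - k` embeds the sum in the two-sided geometric series over `ℤ`, so the bound is
uniform in `j`. -/
theorem tsum_geometric_abs_le {ε : ℝ} (hε : 0 < ε) :
    ∃ Γ : ℝ≥0, ∀ j : ℕ, ∑' k : ℕ, ENNReal.ofReal ((2 : ℝ) ^ (-ε * |(j : ℝ) - k|)) ≤ Γ := by
  set x : ℝ := (2 : ℝ) ^ (-ε) with hx
  have hx0 : 0 < x := by positivity
  have hx1 : x < 1 := Real.rpow_lt_one_of_one_lt_of_neg (by norm_num) (by linarith)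
  have hgeo : ∑' i : ℤ, ENNReal.ofReal (x ^ i.natAbs) ≠ ⊤ := by
    rw [tsum_of_nat_of_neg_add_one ENNReal.summable ENNReal.summable]
    have hs := (summable_geometric_of_lt_one hx0.le hx1)
    refine ENNReal.add_ne_top.2 ⟨?_, ?_⟩
    · simpa using hs.tsum_ofReal_ne_top
    · have h1 : ∀ n : ℕ, (-((n : ℤ) + 1)).natAbs = n + 1 := fun n => by omega
      simp_rw [h1]
      exact ((summable_nat_add_iff 1).2 hs).tsum_ofReal_ne_top
  refine ⟨(∑' i : ℤ, ENNReal.ofReal (x ^ i.natAbs)).toNNReal, fun j => ?_⟩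
  rw [ENNReal.coe_toNNReal hgeo]
  have h2 : ∀ k : ℕ, ENNReal.ofReal ((2 : ℝ) ^ (-ε * |(j : ℝ) - k|)) =
      (fun i : ℤ => ENNReal.ofReal (x ^ i.natAbs)) ((j : ℤ) - k) := fun k => by
    simp only [hx]
    rw [Real.rpow_mul (by norm_num), ← Real.rpow_natCast]
    congr 2
    rw [Nat.cast_natAbs]
    push_cast
    rfl
  simp_rw [h2]
  exact ENNReal.tsum_comp_le_tsum_of_injective (fun k l hkl => by simpa using hkl) _

/-- The discrete Schur test for kernels decaying exponentially off the diagonal. -/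
theorem exists_eLpNorm_tsum_geometric_le {ε : ℝ} (hε : 0 < ε) :
    ∃ Γ : ℝ≥0, ∀ (q : ℝ≥0∞), 1 ≤ q → ∀ b : ℕ → ℝ≥0∞,
      eLpNorm (fun j : ℕ => ∑' k : ℕ, ENNReal.ofReal ((2 : ℝ) ^ (-ε * |(j : ℝ) - k|)) * b k) q
        Measure.count ≤ Γ * eLpNorm b q Measure.count := by
  obtain ⟨Γ, hΓ⟩ := tsum_geometric_abs_le hε
  refine ⟨Γ, fun q hq b => ?_⟩
  have := eLpNorm_lintegral_kernel_le (μ := (Measure.count : Measure ℕ))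
    (ν := (Measure.count : Measure ℕ))
    (k := fun j k : ℕ => ENNReal.ofReal ((2 : ℝ) ^ (-ε * |(j : ℝ) - k|))) (Γ := Γ)
    (measurable_of_countable _) (fun j => by simpa [lintegral_count] using hΓ j)
    (fun k => by simpa [lintegral_count, abs_sub_comm] using hΓ k) (measurable_of_countable b) hq
  simpa only [lintegral_count] using this

end Discrete

/-! ### Quantitative Schwartz seminorms. -/

section SchwartzNorm

variable {E : Type*} [NormedAddCommGroup E] [NormedSpace ℝ E]

/-- The maximum of the Schwartz seminorms of order at most `r` in both indices. -/
def schwartzNorm (r : ℕ) : Seminorm ℂ 𝓢(E, ℂ) :=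
  (Finset.Iic (r, r)).sup (schwartzSeminormFamily ℂ E ℂ)

theorem schwartzNorm_decay {r k n : ℕ} (hk : k ≤ r) (hn : n ≤ r) (f : 𝓢(E, ℂ)) (x : E) :
    (1 + ‖x‖) ^ k * ‖iteratedFDeriv ℝ n f x‖ ≤ 2 ^ r * schwartzNorm r f :=
  one_add_le_sup_seminorm_apply (m := (r, r)) hk hn f x

theorem schwartzNorm_le_of_bound {r : ℕ} {f : 𝓢(E, ℂ)} {A : ℝ} (hA : 0 ≤ A)
    (h : ∀ n ≤ r, ∀ x, (1 + ‖x‖) ^ r * ‖iteratedFDeriv ℝ n f x‖ ≤ A) : schwartzNorm r f ≤ A := by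
  refine Seminorm.finset_sup_apply_le hA fun i hi => ?_
  rw [Finset.mem_Iic] at hi
  refine SchwartzMap.seminorm_le_bound ℂ _ _ f hA fun x => (le_trans ?_ (h i.2 hi.2 x))
  gcongr
  calc ‖x‖ ^ i.1 ≤ (1 + ‖x‖) ^ i.1 := by gcongr; linarith
    _ ≤ (1 + ‖x‖) ^ r := pow_le_pow_right₀ (by linarith [norm_nonneg x]) hi.1

/-- Turns continuity into an estimate that loses finitely many orders. It is used for the Fourier
transform and its inverse, whose seminorm bounds are then never computed by hand. -/
theorem exists_schwartzNorm_map_le (T : 𝓢(E, ℂ) →L[ℂ] 𝓢(E, ℂ)) (r : ℕ) :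
    ∃ (C : ℝ) (r' : ℕ), 0 ≤ C ∧ ∀ f, schwartzNorm r (T f) ≤ C * schwartzNorm r' f := by
  have hc : Continuous ((schwartzNorm r).comp T.toLinearMap : Seminorm ℂ 𝓢(E, ℂ)) := by
    have : Continuous (schwartzNorm r : Seminorm ℂ 𝓢(E, ℂ)) := by
      refine Finset.sup_induction (p := fun q : Seminorm ℂ 𝓢(E, ℂ) => Continuous q) ?_ ?_ ?_
      · exact continuous_const
      · intro p hp q hq
        exact hp.sup hq
      · exact fun i _ => (schwartz_withSeminorms ℂ E ℂ).continuous_seminorm i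
    exact this.comp T.continuous
  obtain ⟨s, C, -, hC⟩ := Seminorm.bound_of_continuous (schwartz_withSeminorms ℂ E ℂ) _ hc
  refine ⟨C, s.sup fun i => max i.1 i.2, C.2, fun f => ?_⟩
  have h1 := hC f
  refine h1.trans ?_
  change (C : ℝ) * _ ≤ _
  gcongr
  refine Seminorm.le_def.1 (Finset.sup_mono fun i hi => ?_) f
  rw [Finset.mem_Iic]
  have := Finset.le_sup (f := fun i : ℕ × ℕ => max i.1 i.2) hi
  exact ⟨(le_max_left _ _).trans this, (le_max_right _ _).trans this⟩

/-- Multiplication by a function whose derivatives are bounded by `A (1 + ‖x‖) ^ N`. -/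
theorem schwartzNorm_smulLeftCLM_le (N r : ℕ) {g : E → ℂ} (hg : g.HasTemperateGrowth) {A : ℝ}
    (hA : 0 ≤ A) (h : ∀ n ≤ r, ∀ x, ‖iteratedFDeriv ℝ n g x‖ ≤ A * (1 + ‖x‖) ^ N) (K : 𝓢(E, ℂ)) :
    schwartzNorm r (smulLeftCLM ℂ g K) ≤ A * 2 ^ (r + (r + N)) * schwartzNorm (r + N) K := by
  refine schwartzNorm_le_of_bound (by positivity) fun n hn x => ?_
  have e : (smulLeftCLM ℂ g K : E → ℂ) = fun y => g y * K y := by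
    ext y; simp [smulLeftCLM_apply_apply hg]
  rw [e]
  have h1 := norm_iteratedFDeriv_mul_le (𝕜 := ℝ) (hg.1) (K.smooth ⊤) x (n := n)
    (by exact_mod_cast le_top)
  calc (1 + ‖x‖) ^ r * ‖iteratedFDeriv ℝ n (fun y => g y * K y) x‖
      ≤ (1 + ‖x‖) ^ r * ∑ i ∈ Finset.range (n + 1), (n.choose i : ℝ) *
          (A * (1 + ‖x‖) ^ N) * ‖iteratedFDeriv ℝ (n - i) K x‖ := by
        gcongr
        refine h1.trans (Finset.sum_le_sum fun i hi => ?_)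
        have hi' := Finset.mem_range.1 hi
        gcongr
        exact h i (by omega) x
    _ = A * ∑ i ∈ Finset.range (n + 1), (n.choose i : ℝ) *
          ((1 + ‖x‖) ^ (r + N) * ‖iteratedFDeriv ℝ (n - i) K x‖) := by
        rw [Finset.mul_sum, Finset.mul_sum]
        refine Finset.sum_congr rfl fun i _ => ?_
        rw [pow_add]; ring
    _ ≤ A * ∑ i ∈ Finset.range (n + 1), (n.choose i : ℝ) *
          (2 ^ (r + N) * schwartzNorm (r + N) K) := by
        refine mul_le_mul_of_nonneg_left (Finset.sum_le_sum fun i hi =>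
          mul_le_mul_of_nonneg_left ?_ (by positivity)) hA
        exact schwartzNorm_decay le_rfl (by omega) K x
    _ = A * 2 ^ (n + (r + N)) * schwartzNorm (r + N) K := by
        rw [← Finset.sum_mul, ← Nat.cast_sum, Nat.sum_range_choose]
        push_cast
        rw [pow_add]; ring
    _ ≤ _ := by gcongr; norm_num

theorem norm_apply_le_schwartzNorm (r : ℕ) (f : 𝓢(E, ℂ)) (x : E) :
    ‖f x‖ ≤ 2 ^ r * schwartzNorm r f * ((1 + ‖x‖) ^ r)⁻¹ := by
  have := schwartzNorm_decay le_rfl (Nat.zero_le r) f x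
  rw [norm_iteratedFDeriv_zero] at this
  rw [← div_eq_mul_inv, le_div_iff₀ (by positivity)]
  linarith

end SchwartzNorm

/-! ### Admissible weights measured by the Euclidean norm. -/

section Weights

variable {E : Type*} [NormedAddCommGroup E] [NormedSpace ℝ E]

/-- Admissible weights on a normed space, with the growth measured by the norm. -/
structure IsWeight (ρ : E → ℝ) : Prop where
  smooth : ContDiff ℝ ∞ ρ
  pos : ∀ x, 0 < ρ x
  deriv_bound : ∀ j : ℕ, ∃ C : ℝ, 0 ≤ C ∧ ∀ x, ‖iteratedFDeriv ℝ j ρ x‖ ≤ C * ρ x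
  growth : ∃ (C : ℝ) (N : ℕ), 0 < C ∧ ∀ x y, ρ x ≤ C * ρ y * (1 + ‖x - y‖) ^ N

theorem IsWeight.one : IsWeight (fun _ : E => (1 : ℝ)) where
  smooth := contDiff_const
  pos _ := one_pos
  deriv_bound j := by
    rcases Nat.eq_zero_or_pos j with rfl | hj
    · exact ⟨1, zero_le_one, fun x => by simp⟩
    · exact ⟨0, le_rfl, fun x => by simp [iteratedFDeriv_const_of_ne hj.ne']⟩
  growth := ⟨1, 0, one_pos, fun x y => by simp⟩

/-- Allows `f` to be recovered from `ρ f`, which makes the comparison two-sided. The growth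
condition is symmetric in its two points. The derivative bounds follow by strong induction from
`∇(1/ρ) = -ρ⁻² ∇ρ` and the Leibniz rule, because `ρ⁻² ρ = ρ⁻¹`. -/
theorem IsWeight.inv {ρ : E → ℝ} (h : IsWeight ρ) : IsWeight (fun x => (ρ x)⁻¹) where
  smooth := h.smooth.inv fun x => (h.pos x).ne'
  pos x := inv_pos.2 (h.pos x)
  growth := by
    obtain ⟨C, N, hC, hg⟩ := h.growth
    refine ⟨C, N, hC, fun x y => ?_⟩
    have := hg y x
    have hx := h.pos x
    have hy := h.pos y
    rw [norm_sub_rev] at this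
    rw [inv_le_iff_one_le_mul₀ hx]
    calc (1 : ℝ) = ρ y * (ρ y)⁻¹ := by field_simp
      _ ≤ C * ρ x * (1 + ‖x - y‖) ^ N * (ρ y)⁻¹ := by gcongr
      _ = _ := by ring
  deriv_bound := by
    have hs : ContDiff ℝ ∞ fun x => (ρ x)⁻¹ := h.smooth.inv fun x => (h.pos x).ne'
    choose C hC0 hC using h.deriv_bound
    intro j
    induction j using Nat.strong_induction_on with
    | _ j ih =>
    rcases j with _ | j
    · exact ⟨1, zero_le_one, fun x => by
        rw [norm_iteratedFDeriv_zero, one_mul, Real.norm_of_nonneg (inv_pos.2 (h.pos x)).le]⟩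
    · choose! B hB0 hB using ih
      set B' : ℝ := ∑ i ∈ Finset.range (j + 1), B i
      have hB'0 : 0 ≤ B' := Finset.sum_nonneg fun i hi => hB0 i (Finset.mem_range.1 hi)
      have hB' : ∀ i ≤ j, ∀ x, ‖iteratedFDeriv ℝ i (fun x => (ρ x)⁻¹) x‖ ≤ B' * (ρ x)⁻¹ := by
        intro i hi x
        refine (hB i (by omega) x).trans ?_
        have := (inv_pos.2 (h.pos x)).le
        gcongr
        exact Finset.single_le_sum (f := B) (fun i hi => hB0 i (Finset.mem_range.1 hi))
          (Finset.mem_range.2 (by omega))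
      set C' : ℝ := ∑ i ∈ Finset.range (j + 2), C i
      have hC'0 : 0 ≤ C' := Finset.sum_nonneg fun i _ => hC0 i
      have hC' : ∀ i ≤ j + 1, ∀ x, ‖iteratedFDeriv ℝ i ρ x‖ ≤ C' * ρ x := by
        intro i hi x
        refine (hC i x).trans ?_
        have := (h.pos x).le
        gcongr
        exact Finset.single_le_sum (f := C) (fun i _ => hC0 i) (Finset.mem_range.2 (by omega))
      have hd : fderiv ℝ (fun x => (ρ x)⁻¹) =
          fun x => ((ρ x)⁻¹ * (ρ x)⁻¹) • (-fderiv ℝ ρ x) := by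
        ext1 x
        have h1 : HasFDerivAt ρ (fderiv ℝ ρ x) x :=
          (h.smooth.differentiable (by simp) x).hasFDerivAt
        have h2 := ((hasDerivAt_inv (h.pos x).ne').comp_hasFDerivAt x h1).fderiv
        rw [show (fun x => (ρ x)⁻¹) = Inv.inv ∘ ρ from rfl, h2]
        ext v
        simp [sq]
      refine ⟨2 ^ j * (2 ^ j * B' * B') * C', by positivity, fun x => ?_⟩
      have hρ := h.pos x
      rw [← norm_iteratedFDeriv_fderiv, hd]
      have hsf : ContDiff ℝ ∞ fun x => -fderiv ℝ ρ x :=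
        (h.smooth.fderiv_right (m := ∞) (by simp)).neg
      refine (norm_iteratedFDeriv_smul_le (hs.mul hs) hsf x (n := j)
        (by exact_mod_cast le_top)).trans ?_
      have hprod : ∀ i ≤ j, ‖iteratedFDeriv ℝ i (fun x => (ρ x)⁻¹ * (ρ x)⁻¹) x‖ ≤
          2 ^ j * B' * B' * ((ρ x)⁻¹ * (ρ x)⁻¹) := by
        intro i hi
        refine (norm_iteratedFDeriv_mul_le hs hs x (n := i) (by exact_mod_cast le_top)).trans ?_
        calc _ ≤ ∑ l ∈ Finset.range (i + 1), (i.choose l : ℝ) * (B' * (ρ x)⁻¹) *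
              (B' * (ρ x)⁻¹) := by
              refine Finset.sum_le_sum fun l hl => ?_
              have := Finset.mem_range.1 hl
              gcongr
              · exact hB' l (by omega) x
              · exact hB' (i - l) (by omega) x
          _ = 2 ^ i * (B' * B' * ((ρ x)⁻¹ * (ρ x)⁻¹)) := by
              rw [← Finset.sum_mul, ← Finset.sum_mul, ← Nat.cast_sum, Nat.sum_range_choose]
              push_cast; ring
          _ ≤ 2 ^ j * (B' * B' * ((ρ x)⁻¹ * (ρ x)⁻¹)) := by gcongr; norm_num
          _ = _ := by ring
      have hfd : ∀ i ≤ j, ‖iteratedFDeriv ℝ i (fun x => -fderiv ℝ ρ x) x‖ ≤ C' * ρ x := by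
        intro i hi
        rw [show (fun x => -fderiv ℝ ρ x) = -fderiv ℝ ρ from rfl, iteratedFDeriv_neg_apply, norm_neg,
          norm_iteratedFDeriv_fderiv]
        exact hC' (i + 1) (by omega) x
      calc _ ≤ ∑ l ∈ Finset.range (j + 1), (j.choose l : ℝ) *
              (2 ^ j * B' * B' * ((ρ x)⁻¹ * (ρ x)⁻¹)) * (C' * ρ x) := by
              refine Finset.sum_le_sum fun l hl => ?_
              have := Finset.mem_range.1 hl
              gcongr
              · exact hprod l (by omega)
              · exact hfd (j - l) (by omega)
        _ = _ := by
              rw [← Finset.sum_mul, ← Finset.sum_mul, ← Nat.cast_sum, Nat.sum_range_choose]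
              push_cast
              field_simp

theorem IsWeight.hasTemperateGrowth {ρ : E → ℝ} (h : IsWeight ρ) :
    (fun x => (ρ x : ℂ)).HasTemperateGrowth := by
  have : ρ.HasTemperateGrowth := by
    refine ⟨h.smooth, fun n => ?_⟩
    obtain ⟨C, hC, hd⟩ := h.deriv_bound n
    obtain ⟨B, N, hB, hg⟩ := h.growth
    refine ⟨N, C * (B * ρ 0), fun x => (hd x).trans ?_⟩
    have := hg x 0
    rw [sub_zero] at this
    calc C * ρ x ≤ C * (B * ρ 0 * (1 + ‖x‖) ^ N) := by gcongr
      _ = _ := by ring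
  have h2 : Complex.ofReal.HasTemperateGrowth := by fun_prop
  exact h2.comp this

end Weights

/-! ### Fourier multipliers on Schwartz functions. -/

section Op

variable {E : Type*} [NormedAddCommGroup E] [InnerProductSpace ℝ E] [FiniteDimensional ℝ E]
  [MeasurableSpace E] [BorelSpace E]

/-- The operator `ψ ↦ 𝓕 (σ 𝓕⁻¹ ψ)` with a Schwartz symbol `σ`, that is convolution with `𝓕 σ`. -/
def op (σ : 𝓢(E, ℂ)) : 𝓢(E, ℂ) →L[ℂ] 𝓢(E, ℂ) :=
  FourierTransform.fourierCLM ℂ 𝓢(E, ℂ) ∘L smulLeftCLM ℂ σ ∘L FourierTransform.fourierInvCLM ℂ 𝓢(E, ℂ)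

theorem op_def (σ ψ : 𝓢(E, ℂ)) : op σ ψ = 𝓕 (smulLeftCLM ℂ σ (𝓕⁻ ψ)) := rfl

theorem op_op {σ τ υ : 𝓢(E, ℂ)} (h : ∀ ξ, σ ξ * τ ξ = υ ξ) (ψ : 𝓢(E, ℂ)) :
    op σ (op τ ψ) = op υ ψ := by
  simp only [op_def, FourierTransform.fourierInv_fourier_eq]
  congr 1
  ext ξ
  rw [smulLeftCLM_apply_apply σ.hasTemperateGrowth, smulLeftCLM_apply_apply τ.hasTemperateGrowth,
    smulLeftCLM_apply_apply υ.hasTemperateGrowth, ← h]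
  simp [mul_assoc]

theorem op_sum {ι : Type*} (s : Finset ι) {σ : ι → 𝓢(E, ℂ)} {υ : 𝓢(E, ℂ)}
    (h : ∀ ξ, ∑ i ∈ s, σ i ξ = υ ξ) (ψ : 𝓢(E, ℂ)) : ∑ i ∈ s, op (σ i) ψ = op υ ψ := by
  simp only [op_def]
  have : smulLeftCLM ℂ υ (𝓕⁻ ψ) = ∑ i ∈ s, smulLeftCLM ℂ (σ i) (𝓕⁻ ψ) := by
    ext ξ
    simp [smulLeftCLM_apply_apply, SchwartzMap.hasTemperateGrowth, ← h, Finset.sum_mul]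
  rw [this]
  exact (map_sum (FourierTransform.fourierCLM ℂ 𝓢(E, ℂ)) _ _).symm

theorem schwartz_fourier_neg (f : 𝓢(E, ℂ)) (x : E) : 𝓕 f (-x) = 𝓕⁻ f x := by
  rw [SchwartzMap.fourierInv_apply_eq]; rfl

theorem op_apply (σ ψ : 𝓢(E, ℂ)) (x : E) : op σ ψ x = ∫ z, 𝓕 σ (x - z) * ψ z := by
  set η := 𝓕⁻ ψ with hη
  have hψ : ψ = 𝓕 η := by rw [hη, FourierTransform.fourier_fourierInv_eq]
  -- The convolution theorem is used for the inverse transforms of `σ` and `η`; since `𝓕` and `𝓕⁻`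
  -- differ by a reflection, the convolution is evaluated at `-x`.
  have h1 : op σ ψ x = SchwartzMap.convolution (ContinuousLinearMap.mul ℂ ℂ) (𝓕⁻ σ) (𝓕⁻ η) (-x) := by
    have : 𝓕⁻ (SchwartzMap.pairing (ContinuousLinearMap.mul ℂ ℂ) σ η) =
        SchwartzMap.convolution (ContinuousLinearMap.mul ℂ ℂ) (𝓕⁻ σ) (𝓕⁻ η) := by
      rw [← FourierTransform.fourierInv_fourier_eq (F := 𝓢(E, ℂ))
        (SchwartzMap.convolution (ContinuousLinearMap.mul ℂ ℂ) (𝓕⁻ σ) (𝓕⁻ η)),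
        SchwartzMap.fourier_convolution, FourierTransform.fourier_fourierInv_eq,
        FourierTransform.fourier_fourierInv_eq]
    rw [← this, ← schwartz_fourier_neg, neg_neg, op_def, ← hη]
    congr 2
    ext ξ
    simp [smulLeftCLM_apply_apply, SchwartzMap.hasTemperateGrowth]
  rw [h1, SchwartzMap.convolution_apply, hψ]
  simp only [MeasureTheory.convolution, ContinuousLinearMap.mul_apply', ← schwartz_fourier_neg]
  rw [← integral_add_left_eq_self _ (-x)]
  refine integral_congr_ae (Filter.Eventually.of_forall fun z => ?_)
  simp only
  congr 2 <;> abel_nf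

/-- Even symbols have even kernels, so `op σ` is its own transpose and the multiplier defined by
duality on distributions is convolution with the same kernel. -/
theorem fourier_even {σ : 𝓢(E, ℂ)} (h : ∀ ξ, σ (-ξ) = σ ξ) (x : E) : 𝓕 σ (-x) = 𝓕 σ x := by
  rw [SchwartzMap.fourier_coe, Real.fourier_eq, Real.fourier_eq, ← integral_neg_eq_self]
  refine integral_congr_ae (Filter.Eventually.of_forall fun z => ?_)
  simp [h]

end Op

/-! ### Anisotropic dilations and the anisotropic modulus. -/

section Dilation

variable {n : ℕ} {m : Fin n → ℕ}

/-- The anisotropic dilation as a continuous linear equivalence. -/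
def dil (a : Fin n → ℝ) (t : ℝ) : Space m ≃L[ℝ] Space m :=
  LinearEquiv.toContinuousLinearEquiv
    { toFun := dilate a t
      invFun := dilate a (-t)
      map_add' := fun x y => by ext i; simp [dilate, smul_add]
      map_smul' := fun c x => by ext i; simp [dilate]; ring
      left_inv := fun x => by
        ext i
        simp only [dilate, PiLp.toLp_apply, smul_smul, ← Real.rpow_add (by norm_num : (0 : ℝ) < 2)]
        simp
      right_inv := fun x => by
        ext i
        simp only [dilate, PiLp.toLp_apply, smul_smul, ← Real.rpow_add (by norm_num : (0 : ℝ) < 2)]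
        simp }

theorem coe_dil (a : Fin n → ℝ) (t : ℝ) : (dil a t : Space m → Space m) = dilate a t := rfl

theorem dil_apply (a : Fin n → ℝ) (t : ℝ) (x : Space m) (i : Fin n) :
    dil a t x i = (2 : ℝ) ^ (t * a i) • x i := rfl

theorem dil_dil (a : Fin n → ℝ) (s t : ℝ) (x : Space m) : dil a s (dil a t x) = dil a (s + t) x := by
  ext i
  simp only [dil_apply, smul_smul, ← Real.rpow_add (by norm_num : (0 : ℝ) < 2), add_mul]

theorem dil_zero (a : Fin n → ℝ) (x : Space m) : dil a 0 x = x := by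
  ext i; simp [dil_apply]

theorem norm_dil_le {a : Fin n → ℝ} (ha : ∀ i, 0 ≤ a i) {t : ℝ} (ht : t ≤ 0) (x : Space m) :
    ‖dil a t x‖ ≤ ‖x‖ := by
  rw [PiLp.norm_eq_of_L2, PiLp.norm_eq_of_L2]
  refine Real.sqrt_le_sqrt (Finset.sum_le_sum fun i _ => ?_)
  rw [dil_apply, norm_smul, Real.norm_of_nonneg (by positivity)]
  have h1 : (2 : ℝ) ^ (t * a i) ≤ 1 :=
    Real.rpow_le_one_of_one_le_of_nonpos (by norm_num) (mul_nonpos_of_nonpos_of_nonneg ht (ha i))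
  have : (2 : ℝ) ^ (t * a i) * ‖x i‖ ≤ 1 * ‖x i‖ := by gcongr
  rw [one_mul] at this
  gcongr

theorem norm_le_norm_dil {a : Fin n → ℝ} (ha : ∀ i, 0 ≤ a i) {t : ℝ} (ht : 0 ≤ t) (x : Space m) :
    ‖x‖ ≤ ‖dil a t x‖ := by
  have := norm_dil_le ha (neg_nonpos.2 ht) (dil a t x)
  rwa [dil_dil, neg_add_cancel, dil_zero] at this

theorem opNorm_dil_le {a : Fin n → ℝ} (ha : ∀ i, 0 ≤ a i) {t : ℝ} (ht : t ≤ 0) :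
    ‖((dil a t : Space m ≃L[ℝ] Space m) : Space m →L[ℝ] Space m)‖ ≤ 1 :=
  ContinuousLinearMap.opNorm_le_bound _ zero_le_one fun x => by
    rw [one_mul]; exact norm_dil_le ha ht x

theorem inner_dil (a : Fin n → ℝ) (t : ℝ) (x y : Space m) :
    inner ℝ (dil a t x) y = inner ℝ x (dil a t y) := by
  simp only [PiLp.inner_apply, dil_apply, inner_smul_left, inner_smul_right]
  simp

theorem anorm_nonneg (a : Fin n → ℝ) (x : Space m) : 0 ≤ anorm a x :=
  Finset.sum_nonneg fun _ _ => by positivity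

theorem anorm_dil {a : Fin n → ℝ} (ha : ∀ i, 0 < a i) (t : ℝ) (x : Space m) :
    anorm a (dil a t x) = 2 ^ t * anorm a x := by
  simp only [anorm, Finset.mul_sum]
  refine Finset.sum_congr rfl fun i _ => ?_
  rw [dil_apply, norm_smul, Real.norm_of_nonneg (by positivity),
    Real.mul_rpow (by positivity) (by positivity), ← Real.rpow_mul (by norm_num)]
  congr 2
  have := (ha i).ne'
  field_simp

theorem continuous_anorm {a : Fin n → ℝ} (ha : ∀ i, 0 < a i) :
    Continuous (anorm a : Space m → ℝ) := by
  refine continuous_finsetSum _ fun i _ => ?_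
  refine Continuous.rpow_const (by fun_prop) fun x => Or.inr ?_
  have := ha i
  positivity

theorem norm_apply_le_anorm_rpow {a : Fin n → ℝ} (ha : ∀ i, 0 < a i) (x : Space m) (i : Fin n) :
    ‖x i‖ ≤ anorm a x ^ a i := by
  have h1 : ‖x i‖ ^ (1 / a i) ≤ anorm a x :=
    Finset.single_le_sum (f := fun i => ‖x i‖ ^ (1 / a i)) (fun i _ => by positivity)
      (Finset.mem_univ i)
  have h2 := Real.rpow_le_rpow (by positivity) h1 (ha i).le
  rwa [← Real.rpow_mul (by positivity), one_div_mul_cancel (ha i).ne', Real.rpow_one] at h2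

theorem norm_le_sum_norm_apply (x : Space m) : ‖x‖ ≤ ∑ i, ‖x i‖ := by
  rw [PiLp.norm_eq_of_L2]
  refine Real.sqrt_le_iff.2 ⟨Finset.sum_nonneg fun _ _ => norm_nonneg _, ?_⟩
  exact Finset.sum_sq_le_sq_sum_of_nonneg fun _ _ => norm_nonneg _

theorem norm_le_sum_anorm_rpow {a : Fin n → ℝ} (ha : ∀ i, 0 < a i) (x : Space m) :
    ‖x‖ ≤ ∑ i, anorm a x ^ a i :=
  (norm_le_sum_norm_apply x).trans (Finset.sum_le_sum fun i _ => norm_apply_le_anorm_rpow ha x i)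

/-- Here `a i ≥ 1` matters: `t ^ a i ≤ t` on `[0, 1]`. A small step is therefore at most linear in
its anisotropic modulus, and `M` differences gain the full power `|h|_a ^ M`. -/
theorem norm_le_mul_anorm {a : Fin n → ℝ} (ha : ∀ i, 1 ≤ a i) {x : Space m} (hx : anorm a x ≤ 1) :
    ‖x‖ ≤ n * anorm a x := by
  refine (norm_le_sum_anorm_rpow (fun i => one_pos.trans_le (ha i)) x).trans ?_
  calc ∑ i, anorm a x ^ a i ≤ ∑ _i : Fin n, anorm a x := Finset.sum_le_sum fun i _ => by
        rcases (anorm_nonneg a x).eq_or_lt with h | h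
        · rw [← h, Real.zero_rpow (by linarith [ha i])]
        · exact (Real.rpow_le_rpow_of_exponent_ge h hx (ha i)).trans_eq (Real.rpow_one _)
    _ = n * anorm a x := by simp

theorem anorm_le_mul_one_add_norm {a : Fin n → ℝ} (ha : ∀ i, 1 ≤ a i) (x : Space m) :
    anorm a x ≤ n * (1 + ‖x‖) := by
  calc anorm a x ≤ ∑ _i : Fin n, (1 + ‖x‖) := Finset.sum_le_sum fun i _ => by
        have h0 := ha i
        have h1 : ‖x i‖ ≤ 1 + ‖x‖ := (PiLp.norm_apply_le x i).trans (by linarith)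
        calc ‖x i‖ ^ (1 / a i) ≤ (1 + ‖x‖) ^ (1 / a i) := by gcongr
          _ ≤ (1 + ‖x‖) ^ (1 : ℝ) := Real.rpow_le_rpow_of_exponent_le
              (by linarith [norm_nonneg x]) (by rw [div_le_one (by linarith)]; exact h0)
          _ = _ := Real.rpow_one _
    _ = n * (1 + ‖x‖) := by simp; ring

theorem anorm_eq_zero_iff {a : Fin n → ℝ} (ha : ∀ i, 0 < a i) {x : Space m} :
    anorm a x = 0 ↔ x = 0 := by
  constructor
  · intro h
    ext1 i
    have := norm_apply_le_anorm_rpow ha x i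
    rw [h, Real.zero_rpow (ha i).ne', norm_le_zero_iff] at this
    simpa using this
  · rintro rfl
    refine Finset.sum_eq_zero fun i _ => ?_
    have := ha i
    simp [Real.zero_rpow, this.ne']

theorem isCompact_anorm_le {a : Fin n → ℝ} (ha : ∀ i, 0 < a i) (c : ℝ) :
    IsCompact {x : Space m | anorm a x ≤ c} := by
  refine Metric.isCompact_of_isClosed_isBounded
    (isClosed_le (continuous_anorm ha) continuous_const) ?_
  refine isBounded_iff_forall_norm_le.2 ⟨∑ i, c ^ a i, fun x hx => ?_⟩
  refine (norm_le_sum_anorm_rpow ha x).trans (Finset.sum_le_sum fun i _ => ?_)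
  exact Real.rpow_le_rpow (anorm_nonneg a x) hx (ha i).le

/-- The dilation is diagonal in the standard basis, the eigenvalue `2^{t a_i}` having multiplicity
`m_i`; the exponents add up to `t (a · m)`. -/
theorem det_dil (a : Fin n → ℝ) (t : ℝ) :
    LinearMap.det ((dil a t : Space m ≃L[ℝ] Space m) : Space m →ₗ[ℝ] Space m) =
      2 ^ (t * homDim a m) := by
  classical
  let B := Pi.orthonormalBasis fun i : Fin n => EuclideanSpace.basisFun (Fin (m i)) ℝ
  let b := B.toBasis
  have hrepr : ∀ (x : Space m) (s : (i : Fin n) × Fin (m i)), b.repr x s = x s.1 s.2 :=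
    fun x s => rfl
  have hb : LinearMap.toMatrix b b ((dil a t : Space m ≃L[ℝ] Space m) : Space m →ₗ[ℝ] Space m) =
      Matrix.diagonal fun s : (i : Fin n) × Fin (m i) => (2 : ℝ) ^ (t * a s.1) := by
    ext s s'
    rw [LinearMap.toMatrix_apply, Matrix.diagonal_apply, hrepr]
    change (dil a t (b s')) s.1 s.2 = _
    rw [dil_apply, PiLp.smul_apply, ← hrepr (b s') s, Module.Basis.repr_self, Finsupp.single_apply]
    by_cases h : s = s'
    · simp [h]
    · simp [h, Ne.symm h]
  rw [← LinearMap.det_toMatrix b, hb, Matrix.det_diagonal, Fintype.prod_sigma]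
  simp only [Finset.prod_const, Finset.card_univ, Fintype.card_fin, homDim, Finset.mul_sum]
  rw [Real.rpow_sum_of_pos (by norm_num)]
  refine Finset.prod_congr rfl fun i _ => ?_
  rw [← Real.rpow_natCast, ← Real.rpow_mul (by norm_num)]
  congr 1; ring

theorem map_dil_volume (a : Fin n → ℝ) (t : ℝ) :
    Measure.map (dil a t) (volume : Measure (Space m)) =
      ENNReal.ofReal (2 ^ (-(t * homDim a m))) • volume := by
  have h := Measure.map_linearMap_addHaar_eq_smul_addHaar (volume : Measure (Space m))
    (f := ((dil a t : Space m ≃L[ℝ] Space m) : Space m →ₗ[ℝ] Space m))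
    (by rw [det_dil]; positivity)
  rw [det_dil, ← Real.rpow_neg (by norm_num), abs_of_pos (by positivity)] at h
  exact h

theorem lintegral_comp_dil (a : Fin n → ℝ) (t : ℝ) (f : Space m → ℝ≥0∞) :
    ∫⁻ x, f (dil a t x) = ENNReal.ofReal (2 ^ (-(t * homDim a m))) * ∫⁻ x, f x := by
  have h : ∫⁻ x, f x ∂(Measure.map (dil a t) (volume : Measure (Space m))) = ∫⁻ x, f (dil a t x) :=
    (dil a t : Space m ≃L[ℝ] Space m).toHomeomorph.measurableEmbedding.lintegral_map _
  rw [← h, map_dil_volume, lintegral_smul_measure, smul_eq_mul]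

theorem integral_comp_dil {F : Type*} [NormedAddCommGroup F] [NormedSpace ℝ F]
    (a : Fin n → ℝ) (t : ℝ) (f : Space m → F) :
    ∫ x, f (dil a t x) = ((2 : ℝ) ^ (-(t * homDim a m))) • ∫ x, f x := by
  have h : ∫ x, f x ∂(Measure.map (dil a t) (volume : Measure (Space m))) = ∫ x, f (dil a t x) :=
    (dil a t : Space m ≃L[ℝ] Space m).toHomeomorph.measurableEmbedding.integral_map _
  rw [← h, map_dil_volume, integral_smul_measure, ENNReal.toReal_ofReal (by positivity)]

/-- The dilated symbol `ξ ↦ σ (2^{-ta} ξ)`. -/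
def dilSymbol (a : Fin n → ℝ) (t : ℝ) (σ : 𝓢(Space m, ℂ)) : 𝓢(Space m, ℂ) :=
  compCLMOfContinuousLinearEquiv ℂ (dil a (-t)) σ

theorem dilSymbol_apply (a : Fin n → ℝ) (t : ℝ) (σ : 𝓢(Space m, ℂ)) (ξ : Space m) :
    dilSymbol a t σ ξ = σ (dil a (-t) ξ) := rfl

theorem fourier_dilSymbol (a : Fin n → ℝ) (t : ℝ) (σ : 𝓢(Space m, ℂ)) (x : Space m) :
    𝓕 (dilSymbol a t σ) x = ((2 : ℝ) ^ (t * homDim a m) : ℝ) * 𝓕 σ (dil a t x) := by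
  have h := integral_comp_dil a (-t)
    (fun v : Space m => Real.fourierChar (-inner ℝ (dil a t v) x) • σ v)
  rw [SchwartzMap.fourier_coe, SchwartzMap.fourier_coe, Real.fourier_eq, Real.fourier_eq]
  simp only [dilSymbol_apply]
  simp only [dil_dil, add_neg_cancel, dil_zero] at h
  rw [h]
  simp only [inner_dil, neg_mul, neg_neg]
  rw [Complex.real_smul]

end Dilation

/-! ### Multipliers at scale `l` acting on fixed Schwartz functions. -/

section Symbols

variable {n : ℕ} {m : Fin n → ℕ} {a : Fin n → ℝ}

theorem IsAdmissibleWeight.isWeight (ha : ∀ i, 1 ≤ a i) {ρ : Space m → ℝ}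
    (h : IsAdmissibleWeight a ρ) : IsWeight ρ where
  smooth := h.smooth
  pos := h.pos
  deriv_bound j := by
    rcases Nat.eq_zero_or_pos j with rfl | hj
    · exact ⟨1, zero_le_one, fun x => by
        rw [norm_iteratedFDeriv_zero, one_mul, Real.norm_of_nonneg (h.pos x).le]⟩
    · obtain ⟨C, hC, hd⟩ := h.deriv_bound j hj
      exact ⟨C, hC.le, hd⟩
  growth := by
    obtain ⟨C, κ, hC, hκ, hg⟩ := h.growth
    -- The anisotropic modulus is at most `n (1 + ‖·‖)`, whence the factor `n ^ κ`; rounding `κ` up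
    -- makes the exponent a natural number.
    refine ⟨C * (1 + (n : ℝ) ^ κ), ⌈κ⌉₊, by positivity, fun x y => (hg x y).trans ?_⟩
    have hy := (h.pos y).le
    have h1 : (1 : ℝ) ≤ 1 + ‖x - y‖ := by linarith [norm_nonneg (x - y)]
    have h2 : anorm a (x - y) ^ κ ≤ (n : ℝ) ^ κ * (1 + ‖x - y‖) ^ ⌈κ⌉₊ := by
      calc anorm a (x - y) ^ κ ≤ (n * (1 + ‖x - y‖)) ^ κ :=
            Real.rpow_le_rpow (anorm_nonneg a _) (anorm_le_mul_one_add_norm ha _) hκ.le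
        _ = (n : ℝ) ^ κ * (1 + ‖x - y‖) ^ κ := Real.mul_rpow (by positivity) (by positivity)
        _ ≤ (n : ℝ) ^ κ * (1 + ‖x - y‖) ^ ((⌈κ⌉₊ : ℕ) : ℝ) := by
            gcongr ?_ * ?_
            exact Real.rpow_le_rpow_of_exponent_le h1 (Nat.le_ceil κ)
        _ = _ := by rw [Real.rpow_natCast]
    have h3 : (1 : ℝ) ≤ (1 + ‖x - y‖) ^ ⌈κ⌉₊ := one_le_pow₀ h1
    calc C * ρ y * (1 + anorm a (x - y) ^ κ)
        ≤ C * ρ y * ((1 + ‖x - y‖) ^ ⌈κ⌉₊ + (n : ℝ) ^ κ * (1 + ‖x - y‖) ^ ⌈κ⌉₊) := by gcongr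
      _ = _ := by ring

theorem IsCutoff.hasCompactSupport (ha : ∀ i, 0 < a i) {φ : Space m → ℝ} (hφ : IsCutoff a φ) :
    HasCompactSupport φ :=
  HasCompactSupport.intro (isCompact_anorm_le ha (2 / 3)) fun ξ hξ =>
    hφ.eq_zero ξ (not_le.1 hξ)

/-- The function `σ` vanishes in a neighbourhood of the origin. -/
def VanishesNearZero (a : Fin n → ℝ) (σ : Space m → ℂ) : Prop :=
  ∃ c : ℝ, 0 < c ∧ ∀ ξ, anorm a ξ < c → σ ξ = 0

theorem norm_iteratedFDeriv_comp_dil_le (ha : ∀ i, 0 < a i) {F : Type*} [NormedAddCommGroup F]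
    [NormedSpace ℝ F] {g : Space m → F} (hg : ContDiff ℝ ∞ g) {t : ℝ} (ht : t ≤ 0) (i : ℕ)
    (ξ : Space m) :
    ‖iteratedFDeriv ℝ i (fun ξ => g (dil a t ξ)) ξ‖ ≤ ‖iteratedFDeriv ℝ i g (dil a t ξ)‖ := by
  have h := ContinuousLinearMap.iteratedFDeriv_comp_right
    ((dil a t : Space m ≃L[ℝ] Space m) : Space m →L[ℝ] Space m) (f := g) hg ξ (i := i)
    (by exact_mod_cast le_top)
  have e : (fun ξ => g (dil a t ξ)) =
    g ∘ ((dil a t : Space m ≃L[ℝ] Space m) : Space m →L[ℝ] Space m) := rfl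
  rw [e, h]
  refine (ContinuousMultilinearMap.norm_compContinuousLinearMap_le _ _).trans ?_
  refine mul_le_of_le_one_right (norm_nonneg _) ?_
  refine Finset.prod_le_one (fun _ _ => norm_nonneg _) fun _ _ => ?_
  exact opNorm_dil_le (fun i => (ha i).le) ht

theorem hasTemperateGrowth_comp_dil {g : Space m → ℂ} (hg : g.HasTemperateGrowth) (t : ℝ) :
    (fun ξ => g (dil a t ξ)).HasTemperateGrowth :=
  hg.comp (dil a t : Space m ≃L[ℝ] Space m).hasTemperateGrowth

/-- The source of all decay in `|j - k|`. On the support of the dilated symbol `|ξ|_a ≥ c 2^l`,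
hence `2^l ≤ (n / c)(1 + ‖ξ‖)`, and `M` spare powers of decay of `F` are worth `2^{-Ml}`.
Derivatives of the symbol do not grow, since the dilation is a contraction. -/
theorem schwartzNorm_smulLeftCLM_comp_dil_le (ha : ∀ i, 1 ≤ a i) {g : Space m → ℂ}
    (hg : g.HasTemperateGrowth) (h0 : VanishesNearZero a g) {r : ℕ} {B : ℝ} (hB : 0 ≤ B)
    (hgB : ∀ i ≤ r, ∀ ξ, ‖iteratedFDeriv ℝ i g ξ‖ ≤ B) (M : ℕ) :
    ∃ C : ℝ, 0 ≤ C ∧ ∀ (l : ℕ) (F : 𝓢(Space m, ℂ)),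
      schwartzNorm r (smulLeftCLM ℂ (fun ξ => g (dil a (-(l : ℝ)) ξ)) F) ≤
        C * (2 ^ (M * l))⁻¹ * schwartzNorm (r + M) F := by
  obtain ⟨c, hc, h0⟩ := h0
  have ha0 : ∀ i, 0 < a i := fun i => one_pos.trans_le (ha i)
  refine ⟨B * (n / c) ^ M * 2 ^ (r + (r + M)), by positivity, fun l F => ?_⟩
  have hA : ∀ i ≤ r, ∀ ξ : Space m, ‖iteratedFDeriv ℝ i (fun ξ => g (dil a (-(l : ℝ)) ξ)) ξ‖ ≤
      (B * (n / c) ^ M * (2 ^ (M * l))⁻¹) * (1 + ‖ξ‖) ^ M := by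
    intro i hi ξ
    refine (norm_iteratedFDeriv_comp_dil_le ha0 hg.1 (by simp) i ξ).trans ?_
    rcases lt_or_ge (anorm a (dil a (-(l : ℝ)) ξ)) c with hlt | hge
    · have hev : g =ᶠ[nhds (dil a (-(l : ℝ)) ξ)] fun _ => 0 := by
        filter_upwards [(isOpen_lt (continuous_anorm ha0) continuous_const).mem_nhds hlt] with η hη
        exact h0 η hη
      rw [(hev.iteratedFDeriv ℝ i).eq_of_nhds]
      have : iteratedFDeriv ℝ i (fun _ : Space m => (0 : ℂ)) (dil a (-(l : ℝ)) ξ) = 0 := by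
        rw [iteratedFDeriv_fun_zero]; rfl
      rw [this, norm_zero]
      positivity
    · refine (hgB i hi _).trans ?_
      rw [anorm_dil ha0, Real.rpow_neg (by norm_num), Real.rpow_natCast] at hge
      have h1 : (2 : ℝ) ^ l ≤ n / c * (1 + ‖ξ‖) := by
        have h3 := anorm_le_mul_one_add_norm ha ξ
        rw [inv_mul_eq_div, le_div_iff₀ (by positivity)] at hge
        rw [div_mul_eq_mul_div, le_div_iff₀ hc]
        linarith
      have h2 : (2 : ℝ) ^ (M * l) ≤ (n / c) ^ M * (1 + ‖ξ‖) ^ M := by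
        rw [mul_comm M, pow_mul, ← mul_pow]
        gcongr
      calc B = B * ((2 : ℝ) ^ (M * l) * (2 ^ (M * l))⁻¹) := by
            rw [mul_inv_cancel₀ (by positivity), mul_one]
        _ ≤ B * (((n / c) ^ M * (1 + ‖ξ‖) ^ M) * (2 ^ (M * l))⁻¹) := by gcongr
        _ = _ := by ring
  refine (schwartzNorm_smulLeftCLM_le M r (hasTemperateGrowth_comp_dil hg _) (by positivity)
    hA F).trans_eq ?_
  ring

/-- The alternative accommodates the low-pass block, whose symbol does not vanish at the origin: it
will only occur with `l = 0`, where no decay is claimed. -/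
theorem exists_schwartzNorm_op_dilSymbol_le (ha : ∀ i, 1 ≤ a i) (σ : 𝓢(Space m, ℂ)) (M r : ℕ) :
    ∃ (C : ℝ) (r' : ℕ), 0 ≤ C ∧ ∀ (l : ℕ), (l = 0 ∨ VanishesNearZero a σ) →
      ∀ G : 𝓢(Space m, ℂ), schwartzNorm r (op (dilSymbol a l σ) G) ≤
        C * (2 ^ (M * l))⁻¹ * schwartzNorm r' G := by
  obtain ⟨C1, r1, hC1, h1⟩ := exists_schwartzNorm_map_le
    (FourierTransform.fourierCLM ℂ 𝓢(Space m, ℂ)) r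
  have hop : ∀ l : ℕ, ∀ G : 𝓢(Space m, ℂ), op (dilSymbol a l σ) G =
      FourierTransform.fourierCLM ℂ 𝓢(Space m, ℂ)
        (smulLeftCLM ℂ (fun ξ => σ (dil a (-(l : ℝ)) ξ)) (𝓕⁻ G)) := fun l G => rfl
  by_cases hσ : VanishesNearZero a σ
  · obtain ⟨C2, hC2, h2⟩ := schwartzNorm_smulLeftCLM_comp_dil_le ha σ.hasTemperateGrowth hσ
      (r := r1) (B := 2 ^ r1 * schwartzNorm r1 σ) (by positivity)
      (fun i hi ξ => by simpa using schwartzNorm_decay (Nat.zero_le r1) hi σ ξ) M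
    obtain ⟨C3, r3, hC3, h3⟩ := exists_schwartzNorm_map_le
      (FourierTransform.fourierInvCLM ℂ 𝓢(Space m, ℂ)) (r1 + M)
    refine ⟨C1 * C2 * C3, r3, by positivity, fun l _ G => ?_⟩
    rw [hop]
    calc _ ≤ C1 * (C2 * (2 ^ (M * l))⁻¹ * (C3 * schwartzNorm r3 G)) := by
          refine (h1 _).trans ?_
          gcongr
          refine (h2 l _).trans ?_
          gcongr
          exact h3 G
      _ = _ := by ring
  · obtain ⟨C, r', hC, h⟩ := exists_schwartzNorm_map_le (op σ) r
    refine ⟨C, r', hC, fun l hl G => ?_⟩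
    obtain rfl := hl.resolve_right hσ
    have : dilSymbol a ((0 : ℕ) : ℝ) σ = σ := by
      ext ξ; simp [dilSymbol_apply, dil_zero]
    rw [this]
    simpa using h G

/-- The symbol `1 - σ` vanishes near the origin, so the same estimate with `M = 1` makes the
remainder tend to `0` in every seminorm. By duality the sum of the blocks converges weakly to the
distribution. -/
theorem tendsto_op_dilSymbol (ha : ∀ i, 1 ≤ a i) {σ : 𝓢(Space m, ℂ)}
    (h0 : VanishesNearZero a fun ξ => 1 - σ ξ) (ψ : 𝓢(Space m, ℂ)) :
    Filter.Tendsto (fun l : ℕ => op (dilSymbol a l σ) ψ) Filter.atTop (nhds ψ) := by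
  have hψ : FourierTransform.fourierCLM ℂ 𝓢(Space m, ℂ) (𝓕⁻ ψ) = ψ := by
    rw [FourierTransform.fourierCLM_apply, FourierTransform.fourier_fourierInv_eq]
  nth_rewrite 2 [← hψ]
  have hop : ∀ l : ℕ, op (dilSymbol a l σ) ψ = FourierTransform.fourierCLM ℂ 𝓢(Space m, ℂ)
        (smulLeftCLM ℂ (dilSymbol a l σ) (𝓕⁻ ψ)) := fun l => rfl
  simp_rw [hop]
  refine ((FourierTransform.fourierCLM ℂ 𝓢(Space m, ℂ)).continuous.tendsto _).comp ?_
  set F := 𝓕⁻ ψ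
  have htg : (fun ξ => 1 - σ ξ).HasTemperateGrowth :=
    (Function.HasTemperateGrowth.const 1).sub σ.hasTemperateGrowth
  rw [(schwartz_withSeminorms ℂ (Space m) ℂ).tendsto_nhds _ _]
  rintro ⟨k, i⟩ ε hε
  set r := max k i
  obtain ⟨C, hC, h⟩ := schwartzNorm_smulLeftCLM_comp_dil_le ha htg h0
    (r := r) (B := 1 + 2 ^ r * schwartzNorm r σ) (by positivity)
    (fun j hj ξ => by
      have e : (fun ξ => 1 - σ ξ) = (fun _ : Space m => (1 : ℂ)) - (σ : Space m → ℂ) := rfl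
      rw [e, iteratedFDeriv_sub contDiff_const ((σ.smooth ⊤).of_le (by exact_mod_cast le_top)),
        Pi.sub_apply]
      refine (norm_sub_le _ _).trans (add_le_add ?_ (by
        simpa using schwartzNorm_decay (Nat.zero_le r) hj σ ξ))
      rcases Nat.eq_zero_or_pos j with rfl | hj
      · simp
      · simp [iteratedFDeriv_const_of_ne hj.ne']) 1
  have hlim : Filter.Tendsto (fun l : ℕ => C * ((2 : ℝ) ^ (1 * l))⁻¹ * schwartzNorm (r + 1) F)
      Filter.atTop (nhds 0) := by
    have h1 : Filter.Tendsto (fun l : ℕ => ((2 : ℝ) ^ (1 * l))⁻¹) Filter.atTop (nhds 0) := by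
      simp only [one_mul, ← inv_pow]
      exact tendsto_pow_atTop_nhds_zero_of_lt_one (by norm_num) (by norm_num)
    simpa using (h1.const_mul C).mul_const (schwartzNorm (r + 1) F)
  filter_upwards [hlim.eventually (gt_mem_nhds hε)] with l hl
  refine lt_of_le_of_lt ?_ hl
  refine le_trans ?_ (h l F)
  have e : smulLeftCLM ℂ (dilSymbol a l σ) F - F =
      -smulLeftCLM ℂ (fun ξ => 1 - σ (dil a (-(l : ℝ)) ξ)) F := by
    ext ξ
    have h1 := smulLeftCLM_apply_apply (hasTemperateGrowth_comp_dil (a := a) htg (-(l : ℝ))) F ξ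
    rw [sub_apply, neg_apply, h1, smulLeftCLM_apply_apply (dilSymbol a l σ).hasTemperateGrowth,
      dilSymbol_apply]
    simp [sub_mul]
  rw [e, map_neg_eq_map]
  exact Seminorm.le_def.1 (Finset.le_sup (f := schwartzSeminormFamily ℂ (Space m) ℂ)
    (Finset.mem_Iic.2 (Prod.mk_le_mk.2 ⟨le_max_left k i, le_max_right k i⟩))) _

end Symbols

/-! ### A weight between two multipliers: kernel estimates. -/

section Sandwich

variable {n : ℕ} {m : Fin n → ℕ} {a : Fin n → ℝ}

/-- This is where both conditions on a weight are used. Derivatives of `u` are bounded by `u`, and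
`u` at `x + dil a t z` is at most `u x` times a power of `1 + ‖z‖`, which `K` absorbs. The dilation
contracts for `t ≤ 0`, so the constant depends neither on `x` nor on `t`. -/
theorem exists_schwartzNorm_weight_comp_le (ha : ∀ i, 0 < a i) {u : Space m → ℝ} (hu : IsWeight u)
    (K : 𝓢(Space m, ℂ)) (r : ℕ) :
    ∃ C : ℝ, 0 ≤ C ∧ ∀ (x : Space m) (t : ℝ), t ≤ 0 →
      (fun z => (u (x + dil a t z) : ℂ)).HasTemperateGrowth ∧
      schwartzNorm r (smulLeftCLM ℂ (fun z => (u (x + dil a t z) : ℂ)) K) ≤ C * u x := by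
  choose B hB0 hB using hu.deriv_bound
  obtain ⟨D, N, hD, hg⟩ := hu.growth
  set B' : ℝ := ∑ i ∈ Finset.range (r + 1), B i
  have hB'0 : 0 ≤ B' := Finset.sum_nonneg fun i _ => hB0 i
  refine ⟨B' * D * 2 ^ (r + (r + N)) * schwartzNorm (r + N) K, by positivity, fun x t ht => ?_⟩
  have htg : (fun z => (u (x + dil a t z) : ℂ)).HasTemperateGrowth := by
    have h1 : (fun z : Space m => x + dil a t z).HasTemperateGrowth :=
      (Function.HasTemperateGrowth.const x).add
        (dil a t : Space m ≃L[ℝ] Space m).hasTemperateGrowth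
    exact hu.hasTemperateGrowth.comp h1
  refine ⟨htg, ?_⟩
  have hux := hu.pos x
  have hd : ∀ i ≤ r, ∀ z : Space m,
      ‖iteratedFDeriv ℝ i (fun z => (u (x + dil a t z) : ℂ)) z‖ ≤
        (B' * D * u x) * (1 + ‖z‖) ^ N := by
    intro i hi z
    have e1 : ‖iteratedFDeriv ℝ i (fun z => (u (x + dil a t z) : ℂ)) z‖ =
        ‖iteratedFDeriv ℝ i (fun z => u (x + dil a t z)) z‖ := by
      have hcd : ContDiff ℝ ∞ (fun z => u (x + dil a t z)) :=
        hu.smooth.comp (contDiff_const.add (dil a t : Space m ≃L[ℝ] Space m).contDiff)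
      exact Complex.ofRealLI.norm_iteratedFDeriv_comp_left hcd.contDiffAt (i := i)
        (by exact_mod_cast le_top)
    rw [e1]
    have hcd : ContDiff ℝ ∞ (fun z => u (x + z)) := hu.smooth.comp (contDiff_const.add contDiff_id)
    refine (norm_iteratedFDeriv_comp_dil_le ha (g := fun z => u (x + z)) hcd ht i z).trans ?_
    rw [iteratedFDeriv_comp_add_left]
    refine (hB i _).trans ?_
    have h1 := hg (x + dil a t z) x
    rw [add_sub_cancel_left] at h1
    have h2 := norm_dil_le (fun i => (ha i).le) ht z
    have h3 : B i ≤ B' :=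
      Finset.single_le_sum (f := B) (fun i _ => hB0 i) (Finset.mem_range.2 (by omega))
    have h4 := (hu.pos (x + dil a t z)).le
    calc B i * u (x + dil a t z) ≤ B' * (D * u x * (1 + ‖z‖) ^ N) := by
          gcongr
          refine h1.trans ?_
          gcongr
      _ = _ := by ring
  refine (schwartzNorm_smulLeftCLM_le N r htg (by positivity) hd K).trans_eq ?_
  ring

/-- The kernel of the operator `op σ ∘ u ∘ op τ`. -/
def sandwich (u : Space m → ℝ) (σ τ : 𝓢(Space m, ℂ)) (y x : Space m) : ℂ :=
  ∫ z, 𝓕 σ (y - z) * ((u z : ℂ) * 𝓕 τ (z - x))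

/-- Lets the symbol of the finer scale always stand on the left. -/
theorem sandwich_swap (u : Space m → ℝ) {σ τ : 𝓢(Space m, ℂ)} (hσ : ∀ ξ, σ (-ξ) = σ ξ)
    (hτ : ∀ ξ, τ (-ξ) = τ ξ) (y x : Space m) : sandwich u σ τ y x = sandwich u τ σ x y := by
  refine integral_congr_ae (Filter.Eventually.of_forall fun z => ?_)
  simp only
  rw [← fourier_even hσ, ← fourier_even hτ, neg_sub, neg_sub]
  ring

/-- Rescale about `x` by the coarser scale `j`: the coarse kernel becomes the fixed function `𝓕 τ`,
the weight becomes slowly varying, and the fine multiplier acts at the relative scale `k - j`. -/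
theorem sandwich_dilSymbol (ha : ∀ i, 0 < a i) {u : Space m → ℝ} (hu : IsWeight u)
    (σ τ : 𝓢(Space m, ℂ)) {j k : ℕ} (hjk : j ≤ k) (y x : Space m) :
    sandwich u (dilSymbol a k σ) (dilSymbol a j τ) y x =
      ((2 : ℝ) ^ (j * homDim a m) : ℝ) * op (dilSymbol a (k - j : ℕ) σ)
        (smulLeftCLM ℂ (fun z => (u (x + dil a (-(j : ℝ)) z) : ℂ)) (𝓕 τ)) (dil a j (y - x)) := by
  obtain ⟨_, _, hC⟩ := exists_schwartzNorm_weight_comp_le ha hu (𝓕 τ) 0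
  have htg := (hC x (-(j : ℝ)) (by simp)).1
  have h := integral_comp_dil a j (fun z' : Space m => 𝓕 (dilSymbol a (k - j : ℕ) σ)
    (dil a j (y - x) - z') * (smulLeftCLM ℂ (fun z => (u (x + dil a (-(j : ℝ)) z) : ℂ)) (𝓕 τ)) z')
  rw [op_apply]
  rw [← integral_sub_right_eq_self _ x] at h
  have h2 : ∀ z, 𝓕 (dilSymbol a (k - j : ℕ) σ) (dil a j (y - x) - dil a j (z - x)) *
      (smulLeftCLM ℂ (fun z => (u (x + dil a (-(j : ℝ)) z) : ℂ)) (𝓕 τ)) (dil a j (z - x)) =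
      (((2 : ℝ) ^ (-(2 * (j * homDim a m))) : ℝ) : ℂ) *
      (𝓕 (dilSymbol a k σ) (y - z) * ((u z : ℂ) * 𝓕 (dilSymbol a j τ) (z - x))) := by
    intro z
    rw [smulLeftCLM_apply_apply htg, ← map_sub, sub_sub_sub_cancel_right, fourier_dilSymbol,
      fourier_dilSymbol, fourier_dilSymbol, dil_dil, dil_dil, neg_add_cancel, dil_zero,
      add_sub_cancel, Nat.cast_sub hjk, sub_add_cancel, smul_eq_mul]
    -- With `D = a · m`, `(k - j) D = -2jD + kD + jD`. The Jacobian contributes `2^{-jD}`, which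
    -- leaves the factor `2^{jD}` of the statement.
    have e : (((2 : ℝ) ^ (((k : ℝ) - j) * homDim a m) : ℝ) : ℂ) =
        (((2 : ℝ) ^ (-(2 * (j * homDim a m))) : ℝ) : ℂ) * ((2 : ℝ) ^ (k * homDim a m) : ℝ) *
          ((2 : ℝ) ^ (j * homDim a m) : ℝ) := by
      rw [← Complex.ofReal_mul, ← Complex.ofReal_mul, ← Real.rpow_add (by norm_num),
        ← Real.rpow_add (by norm_num)]
      congr 2; ring
    rw [e]; ring
  simp_rw [h2] at h
  rw [integral_const_mul, Complex.real_smul] at h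
  rw [sandwich]
  have e1 : (((2 : ℝ) ^ (-(2 * (j * homDim a m))) : ℝ) : ℂ) ≠ 0 := by
    rw [Complex.ofReal_ne_zero]; positivity
  apply mul_left_cancel₀ e1
  rw [h, ← mul_assoc, ← Complex.ofReal_mul, ← Real.rpow_add (by norm_num)]
  congr 3; ring

theorem exists_norm_sandwich_le (ha : ∀ i, 1 ≤ a i) {u : Space m → ℝ} (hu : IsWeight u)
    (σ τ : 𝓢(Space m, ℂ)) (M r : ℕ) :
    ∃ C : ℝ, 0 ≤ C ∧ ∀ j k : ℕ, j ≤ k → (k = j ∨ VanishesNearZero a σ) → ∀ y x : Space m,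
      ‖sandwich u (dilSymbol a k σ) (dilSymbol a j τ) y x‖ ≤ C * (2 ^ (M * (k - j)))⁻¹ * u x *
        ((2 : ℝ) ^ (j * homDim a m) * ((1 + ‖dil a j (y - x)‖) ^ r)⁻¹) := by
  have ha0 : ∀ i, 0 < a i := fun i => one_pos.trans_le (ha i)
  obtain ⟨C1, r1, hC1, h1⟩ := exists_schwartzNorm_op_dilSymbol_le ha σ M r
  obtain ⟨C2, hC2, h2⟩ := exists_schwartzNorm_weight_comp_le ha0 hu (𝓕 τ) r1
  refine ⟨2 ^ r * C1 * C2, by positivity, fun j k hjk hσ y x => ?_⟩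
  rw [sandwich_dilSymbol ha0 hu σ τ hjk, norm_mul, Complex.norm_real,
    Real.norm_of_nonneg (by positivity)]
  have h3 := h1 (k - j) (by rcases hσ with h | h; · left; omega
                            · exact Or.inr h)
    (smulLeftCLM ℂ (fun z => (u (x + dil a (-(j : ℝ)) z) : ℂ)) (𝓕 τ))
  have h4 := (h2 x (-(j : ℝ)) (by simp)).2
  calc _ ≤ (2 : ℝ) ^ (j * homDim a m) * (2 ^ r * (C1 * (2 ^ (M * (k - j)))⁻¹ * (C2 * u x)) *
        ((1 + ‖dil a j (y - x)‖) ^ r)⁻¹) := by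
        gcongr
        refine (norm_apply_le_schwartzNorm r _ _).trans ?_
        gcongr
        refine h3.trans ?_
        gcongr
    _ = _ := by ring

end Sandwich

/-! ### Pairings and series in `L^p`. -/

section Lp

variable {X : Type*} [MeasurableSpace X] {μ : Measure X}

/-- A bounded integrable function pairs with `L^p` for every `p`. Jensen with weight `f` avoids the
conjugate exponent. -/
theorem lintegral_mul_lt_top_of_eLpNorm_lt_top {f G : X → ℝ≥0∞} (hf : Measurable f)
    (hG : Measurable G) (hfi : ∫⁻ x, f x ∂μ < ⊤) {B : ℝ≥0∞} (hB : B < ⊤) (hfB : ∀ x, f x ≤ B)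
    {p : ℝ≥0∞} (hp : 1 ≤ p) (hGp : eLpNorm G p μ < ⊤) : ∫⁻ x, f x * G x ∂μ < ⊤ := by
  rcases eq_or_ne p ⊤ with rfl | hpt
  · calc ∫⁻ x, f x * G x ∂μ ≤ ∫⁻ x, f x * eLpNorm G ⊤ μ ∂μ := by
          refine lintegral_mono_ae ?_
          filter_upwards [enorm_ae_le_eLpNormEssSup G μ] with x hx
          rw [eLpNorm_exponent_top]
          simp only [enorm_eq_self] at hx
          gcongr
      _ = (∫⁻ x, f x ∂μ) * eLpNorm G ⊤ μ := lintegral_mul_const _ hf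
      _ < ⊤ := ENNReal.mul_lt_top hfi hGp
  · have hp0 : p ≠ 0 := by rintro rfl; simp at hp
    have hr : 1 ≤ p.toReal := by
      rw [← ENNReal.toReal_one]; exact ENNReal.toReal_mono hpt hp
    have h1 := lintegral_mul_rpow_le (ν := μ) hf hG hr
    have h2 : ∫⁻ x, G x ^ p.toReal ∂μ < ⊤ := by
      simpa using lintegral_rpow_enorm_lt_top_of_eLpNorm_lt_top hp0 hpt hGp
    have h3 : ∫⁻ x, f x * G x ^ p.toReal ∂μ < ⊤ := by
      calc _ ≤ ∫⁻ x, B * G x ^ p.toReal ∂μ := lintegral_mono fun x => by gcongr; exact hfB x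
        _ = B * ∫⁻ x, G x ^ p.toReal ∂μ := lintegral_const_mul _ (hG.pow_const _)
        _ < ⊤ := ENNReal.mul_lt_top hB h2
    have h4 : (∫⁻ x, f x * G x ∂μ) ^ p.toReal < ⊤ :=
      h1.trans_lt (ENNReal.mul_lt_top (ENNReal.rpow_lt_top_of_nonneg (by linarith) hfi.ne) h3)
    exact (ENNReal.rpow_lt_top_iff_of_pos (by linarith)).1 h4

theorem ae_lt_top_of_eLpNorm_lt_top {G : X → ℝ≥0∞} (hG : Measurable G) {p : ℝ≥0∞} (hp : 1 ≤ p)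
    (hGp : eLpNorm G p μ < ⊤) : ∀ᵐ x ∂μ, G x < ⊤ := by
  rcases eq_or_ne p ⊤ with rfl | hpt
  · filter_upwards [enorm_ae_le_eLpNormEssSup G μ] with x hx
    rw [eLpNorm_exponent_top] at hGp
    simp only [enorm_eq_self] at hx
    exact hx.trans_lt hGp
  · have hp0 : p ≠ 0 := by rintro rfl; simp at hp
    have hr : 1 ≤ p.toReal := by
      rw [← ENNReal.toReal_one]; exact ENNReal.toReal_mono hpt hp
    have h2 : ∫⁻ x, G x ^ p.toReal ∂μ < ⊤ := by
      simpa using lintegral_rpow_enorm_lt_top_of_eLpNorm_lt_top hp0 hpt hGp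
    filter_upwards [ae_lt_top (hG.pow_const _) h2.ne] with x hx
    exact (ENNReal.rpow_lt_top_iff_of_pos (by linarith)).1 hx

theorem eLpNorm_tsum_le {G : ℕ → X → ℝ≥0∞} [SFinite μ] (hG : ∀ k, Measurable (G k)) {p : ℝ≥0∞}
    (hp : 1 ≤ p) : eLpNorm (fun x => ∑' k, G k x) p μ ≤ ∑' k, eLpNorm (G k) p μ := by
  have h := eLpNorm_lintegral_le (μ := μ) (ν := (Measure.count : Measure ℕ))
    (F := fun x k => G k x) (measurable_from_prod_countable_left fun k => hG k) hp
  simpa only [lintegral_count] using h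

end Lp

/-! ### Distributions that are functions. -/

section Represent

variable {n : ℕ} {m : Fin n → ℕ}

theorem wLpNorm_eq {ρ : Space m → ℝ} (hρ : ∀ x, 0 < ρ x) (p : ℝ≥0∞) (g : Space m → ℂ) :
    wLpNorm ρ p g = eLpNorm (fun x => ENNReal.ofReal (ρ x) * ‖g x‖ₑ) p volume := by
  refine eLpNorm_congr_enorm_ae (Filter.Eventually.of_forall fun x => ?_)
  rw [enorm_mul, enorm_eq_self, ← ofReal_norm, Complex.norm_real,
    Real.norm_of_nonneg (hρ x).le]

theorem wLpNorm_congr {ρ : Space m → ℝ} {p : ℝ≥0∞} {g g' : Space m → ℂ} (h : g =ᵐ[volume] g') :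
    wLpNorm ρ p g = wLpNorm ρ p g' := by
  refine eLpNorm_congr_ae ?_
  filter_upwards [h] with x hx
  rw [hx]

theorem Represents.congr {g g' : Space m → ℂ} {u : 𝓢'(Space m, ℂ)} (h : Represents g u)
    (hg : g =ᵐ[volume] g') : Represents g' u := by
  refine ⟨h.1.congr hg, fun ψ => ?_⟩
  have : (fun x => ψ x * g x) =ᵐ[volume] fun x => ψ x * g' x := by
    filter_upwards [hg] with x hx
    rw [hx]
  exact ⟨(h.2 ψ).1.congr this, (h.2 ψ).2.trans (integral_congr_ae this)⟩

/-- A smooth compactly supported real function as a complex Schwartz function. -/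
def realSchwartz {f : Space m → ℝ} (hf : ContDiff ℝ ∞ f) (hc : HasCompactSupport f) :
    𝓢(Space m, ℂ) :=
  (hc.comp_left (g := Complex.ofReal) Complex.ofReal_zero).toSchwartzMap
    (Complex.ofRealCLM.contDiff.comp hf)

theorem realSchwartz_apply {f : Space m → ℝ} (hf : ContDiff ℝ ∞ f) (hc : HasCompactSupport f)
    (x : Space m) : realSchwartz hf hc x = (f x : ℂ) := rfl

theorem Represents.locallyIntegrable {g : Space m → ℂ} {u : 𝓢'(Space m, ℂ)}
    (h : Represents g u) : LocallyIntegrable g volume := by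
  intro x
  let b : ContDiffBump x := ⟨1, 2, one_pos, one_lt_two⟩
  refine ⟨Metric.closedBall x 1, Metric.closedBall_mem_nhds x one_pos, ?_⟩
  have h1 := ((h.2 (realSchwartz b.contDiff b.hasCompactSupport)).1).integrableOn
    (s := Metric.closedBall x 1)
  refine h1.congr_fun (fun y hy => ?_) measurableSet_closedBall
  simp [realSchwartz_apply, b.one_of_mem_closedBall hy]

theorem Represents.ae_eq {g g' : Space m → ℂ} {u : 𝓢'(Space m, ℂ)} (h : Represents g u)
    (h' : Represents g' u) : g =ᵐ[volume] g' := by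
  refine ae_eq_of_integral_contDiff_smul_eq h.locallyIntegrable h'.locallyIntegrable
    fun ψ hψ hc => ?_
  have := (h.2 (realSchwartz hψ hc)).2.symm.trans (h'.2 (realSchwartz hψ hc)).2
  simpa [realSchwartz_apply] using this

theorem Represents.distWLpNorm_eq {g : Space m → ℂ} {u : 𝓢'(Space m, ℂ)} (h : Represents g u)
    (ρ : Space m → ℝ) (p : ℝ≥0∞) : distWLpNorm ρ p u = wLpNorm ρ p g := by
  refine le_antisymm (iInf₂_le g h) (le_iInf₂ fun g' h' => ?_)
  rw [wLpNorm_congr (h.ae_eq h')]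

theorem exists_represents_of_lt_top {ρ : Space m → ℝ} {p : ℝ≥0∞} {u : 𝓢'(Space m, ℂ)}
    (h : distWLpNorm ρ p u < ⊤) :
    ∃ g, StronglyMeasurable g ∧ Represents g u ∧ wLpNorm ρ p g = distWLpNorm ρ p u := by
  obtain ⟨g, hg⟩ := iInf_lt_iff.1 h
  obtain ⟨hg, -⟩ := iInf_lt_iff.1 hg
  have hr := hg.congr hg.1.ae_eq_mk
  exact ⟨_, hg.1.stronglyMeasurable_mk, hr, (hr.distWLpNorm_eq ρ p).symm⟩

/-- `ψ / w` is again a Schwartz function, hence bounded and integrable, and it pairs with `w H` in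
`L^p`. -/
theorem lintegral_schwartz_mul_lt_top {w : Space m → ℝ} (hw : IsWeight w) {p : ℝ≥0∞} (hp : 1 ≤ p)
    {H : Space m → ℝ≥0∞} (hH : Measurable H)
    (hHp : eLpNorm (fun x => ENNReal.ofReal (w x) * H x) p volume < ⊤) (ψ : 𝓢(Space m, ℂ)) :
    ∫⁻ x, ‖ψ x‖ₑ * H x < ⊤ := by
  set η := smulLeftCLM ℂ (fun x => ((w x)⁻¹ : ℝ) : Space m → ℂ) ψ with hη
  have hηx : ∀ x, η x = ((w x)⁻¹ : ℝ) * ψ x := fun x => by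
    rw [hη, smulLeftCLM_apply_apply hw.inv.hasTemperateGrowth, smul_eq_mul]
  have hwm : Measurable fun x => ENNReal.ofReal (w x) :=
    hw.smooth.continuous.measurable.ennreal_ofReal
  have h := lintegral_mul_lt_top_of_eLpNorm_lt_top (μ := volume) (f := fun x => ‖η x‖ₑ)
    (G := fun x => ENNReal.ofReal (w x) * H x) (by fun_prop) (hwm.mul hH)
    η.integrable.2 (B := ENNReal.ofReal (SchwartzMap.seminorm ℝ 0 0 η)) ENNReal.ofReal_lt_top
    (fun x => by
      rw [← ofReal_norm]
      exact ENNReal.ofReal_le_ofReal (SchwartzMap.norm_le_seminorm ℝ η x)) hp hHp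
  refine lt_of_le_of_lt (lintegral_mono fun x => ?_) h
  have hwx := hw.pos x
  have e : ‖η x‖ₑ * ENNReal.ofReal (w x) = ‖ψ x‖ₑ := by
    rw [hηx, enorm_mul, ← ofReal_norm ((((w x)⁻¹ : ℝ)) : ℂ), Complex.norm_real,
      Real.norm_of_nonneg (inv_pos.2 hwx).le, mul_right_comm, ← ENNReal.ofReal_mul (by positivity),
      inv_mul_cancel₀ hwx.ne', ENNReal.ofReal_one, one_mul]
  change ‖ψ x‖ₑ * H x ≤ ‖η x‖ₑ * (ENNReal.ofReal (w x) * H x)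
  rw [← mul_assoc, e]

theorem represents_of_integral_eq {w : Space m → ℝ} (hw : IsWeight w) {p : ℝ≥0∞} (hp : 1 ≤ p)
    {g : Space m → ℂ} (hg : StronglyMeasurable g) (hgp : wLpNorm w p g < ⊤)
    {u : 𝓢'(Space m, ℂ)} (hu : ∀ ψ : 𝓢(Space m, ℂ), u ψ = ∫ x, ψ x * g x) : Represents g u := by
  refine ⟨hg.aestronglyMeasurable, fun ψ => ⟨⟨?_, ?_⟩, hu ψ⟩⟩
  · exact ψ.continuous.aestronglyMeasurable.mul hg.aestronglyMeasurable
  · rw [wLpNorm_eq hw.pos] at hgp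
    have := lintegral_schwartz_mul_lt_top hw hp hg.enorm hgp ψ
    simpa [HasFiniteIntegral] using this

/-- A weakly convergent series of functions that converges absolutely in `L^p(w)`. -/
theorem represents_tsum {w : Space m → ℝ} (hw : IsWeight w) {p : ℝ≥0∞} (hp : 1 ≤ p)
    {g : ℕ → Space m → ℂ} (hg : ∀ k, StronglyMeasurable (g k))
    (hsum : ∑' k, wLpNorm w p (g k) < ⊤) {u : 𝓢'(Space m, ℂ)}
    (hu : ∀ ψ : 𝓢(Space m, ℂ), Filter.Tendsto
      (fun K : ℕ => ∑ k ∈ Finset.range K, ∫ x, ψ x * g k x) Filter.atTop (nhds (u ψ))) :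
    ∃ G : Space m → ℂ, StronglyMeasurable G ∧ Represents G u ∧
      wLpNorm w p G ≤ ∑' k, wLpNorm w p (g k) ∧ ∀ᵐ x, HasSum (fun k => g k x) (G x) := by
  have hwm : Measurable fun x => ENNReal.ofReal (w x) :=
    hw.smooth.continuous.measurable.ennreal_ofReal
  set H : Space m → ℝ≥0∞ := fun x => ∑' k, ‖g k x‖ₑ with hH
  have hHm : Measurable H := Measurable.tsum fun k => (hg k).enorm
  have hHp : eLpNorm (fun x => ENNReal.ofReal (w x) * H x) p volume ≤ ∑' k, wLpNorm w p (g k) := by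
    simp only [hH, ← ENNReal.tsum_mul_left, wLpNorm_eq hw.pos]
    exact eLpNorm_tsum_le (fun k => hwm.mul (hg k).enorm) hp
  have hae : ∀ᵐ x, Summable fun k => g k x := by
    filter_upwards [ae_lt_top_of_eLpNorm_lt_top (hwm.mul hHm) hp (hHp.trans_lt hsum)] with x hx
    have hx' : H x ≠ ⊤ := by
      intro h
      have : ENNReal.ofReal (w x) ≠ 0 := by simpa using hw.pos x
      rw [Pi.mul_apply, h, ENNReal.mul_top this] at hx
      exact lt_irrefl _ hx
    exact Summable.of_enorm hx'
  set G : Space m → ℂ := fun x => ∑' k, g k x with hG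
  have hGm : AEStronglyMeasurable G volume := by
    have hm : ∀ K : ℕ, AEStronglyMeasurable (fun x => ∑ k ∈ Finset.range K, g k x) volume :=
      fun K => (Finset.stronglyMeasurable_fun_sum _ fun k _ => hg k).aestronglyMeasurable
    refine aestronglyMeasurable_of_tendsto_ae Filter.atTop hm ?_
    filter_upwards [hae] with x hx
    exact hx.hasSum.tendsto_sum_nat
  -- At points where the series diverges `tsum` is `0`, so the domination holds everywhere.
  have hGH : ∀ x, ‖G x‖ₑ ≤ H x := fun x => enorm_tsum_le_tsum_enorm
  have hGp : wLpNorm w p G ≤ ∑' k, wLpNorm w p (g k) := by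
    rw [wLpNorm_eq hw.pos]
    refine (eLpNorm_mono_enorm fun x => ?_).trans hHp
    simp only [enorm_eq_self]
    gcongr
    exact hGH x
  have hcongr := hGm.ae_eq_mk
  refine ⟨hGm.mk G, hGm.stronglyMeasurable_mk, ?_, ?_, ?_⟩
  · refine represents_of_integral_eq hw hp hGm.stronglyMeasurable_mk
      (by rw [← wLpNorm_congr hcongr]; exact hGp.trans_lt hsum) fun ψ => ?_
    have hψg : ∀ k, AEStronglyMeasurable (fun x => ψ x * g k x) volume := fun k =>
      ψ.continuous.aestronglyMeasurable.mul (hg k).aestronglyMeasurable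
    have h1 : ∑' k, ∫⁻ x, ‖ψ x * g k x‖ₑ < ⊤ := by
      rw [← lintegral_tsum fun k => (hψg k).enorm]
      simp only [enorm_mul, ENNReal.tsum_mul_left]
      exact lintegral_schwartz_mul_lt_top hw hp hHm (hHp.trans_lt hsum) ψ
    have h2 := integral_tsum hψg h1.ne
    have h3 : Summable fun k => ∫ x, ψ x * g k x := by
      refine Summable.of_enorm (ne_top_of_le_ne_top h1.ne ?_)
      exact ENNReal.tsum_le_tsum fun k => enorm_integral_le_lintegral_enorm _
    have h4 := tendsto_nhds_unique (hu ψ) h3.hasSum.tendsto_sum_nat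
    rw [h4]
    refine Eq.trans h2.symm (integral_congr_ae ?_)
    filter_upwards [hcongr] with x hx
    rw [← hx, tsum_mul_left]
  · rwa [← wLpNorm_congr hcongr]
  · filter_upwards [hae, hcongr] with x hx hx'
    rw [← hx']
    exact hx.hasSum

theorem enorm_integral_mul_le_lintegral {X : Type*} [MeasurableSpace X] {μ : Measure X}
    (f g : X → ℂ) : ‖∫ y, f y * g y ∂μ‖ₑ ≤ ∫⁻ y, ‖f y‖ₑ * ‖g y‖ₑ ∂μ := by
  refine (enorm_integral_le_lintegral_enorm _).trans_eq ?_
  simp only [enorm_mul]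

/-- Weighted `L^p` bound for positive kernels dominated by a convolution. -/
theorem eLpNorm_kernel_le {w W : Space m → ℝ} (hW : Measurable W)
    {p : ℝ≥0∞} (hp : 1 ≤ p) {T : Space m → Space m → ℝ≥0∞} {Φ : Space m → ℝ≥0∞}
    (hΦ : Measurable Φ) {Γ : ℝ≥0} (hΓ : ∫⁻ x, Φ x ≤ Γ)
    (hT : ∀ x y, ENNReal.ofReal (w x) * T x y ≤ Φ (x - y) * ENNReal.ofReal (W y))
    {g : Space m → ℝ≥0∞} (hg : Measurable g) :
    eLpNorm (fun x => ENNReal.ofReal (w x) * ∫⁻ y, T x y * g y) p volume ≤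
      Γ * eLpNorm (fun y => ENNReal.ofReal (W y) * g y) p volume := by
  refine le_trans (eLpNorm_mono_enorm fun x => ?_) (eLpNorm_lintegral_kernel_le
    (k := fun x y : Space m => Φ (x - y)) (hΦ.comp measurable_sub) (Γ := Γ)
    (fun x => by rw [lintegral_sub_left_eq_self]; exact hΓ)
    (fun y => by rw [lintegral_sub_right_eq_self]; exact hΓ)
    (hW.ennreal_ofReal.mul hg) hp)
  simp only [enorm_eq_self]
  rw [← lintegral_const_mul' _ _ ENNReal.ofReal_ne_top]
  refine lintegral_mono fun y => ?_
  calc ENNReal.ofReal (w x) * (T x y * g y) = ENNReal.ofReal (w x) * T x y * g y := by ring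
    _ ≤ Φ (x - y) * ENNReal.ofReal (W y) * g y := mul_le_mul_left (hT x y) _
    _ = Φ (x - y) * (ENNReal.ofReal (W y) * g y) := by ring

/-- The distribution is given by the transposed operator on test functions. The domination of `T` by
a convolution bounds the integral of `|T| |g|` in `L^p(w)`; this justifies Fubini, which identifies
the distribution with the function obtained by integrating `T` against `g`. -/
theorem represents_kernel {w W : Space m → ℝ} (hw : IsWeight w) (hW : Measurable W)
    (hW0 : ∀ x, 0 < W x) {p : ℝ≥0∞} (hp : 1 ≤ p) {T : Space m → Space m → ℂ}
    (hTm : StronglyMeasurable (Function.uncurry T)) {Φ : Space m → ℝ≥0∞}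
    (hΦ : Measurable Φ) {Γ : ℝ≥0} (hΓ : ∫⁻ x, Φ x ≤ Γ)
    (hT : ∀ x y, ENNReal.ofReal (w x) * ‖T x y‖ₑ ≤ Φ (x - y) * ENNReal.ofReal (W y))
    {g : Space m → ℂ} (hg : StronglyMeasurable g) (hgp : wLpNorm W p g < ⊤)
    {u : 𝓢'(Space m, ℂ)}
    (hu : ∀ ψ : 𝓢(Space m, ℂ), u ψ = ∫ y, (∫ x, T x y * ψ x) * g y) :
    StronglyMeasurable (fun x => ∫ y, T x y * g y) ∧
      Represents (fun x => ∫ y, T x y * g y) u ∧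
      wLpNorm w p (fun x => ∫ y, T x y * g y) ≤ Γ * wLpNorm W p g := by
  have hTm' : StronglyMeasurable fun z : Space m × Space m => T z.1 z.2 := hTm
  have hm : StronglyMeasurable (fun x => ∫ y, T x y * g y) :=
    StronglyMeasurable.integral_prod_right (f := fun x y => T x y * g y)
      (hTm'.mul (hg.comp_measurable measurable_snd))
  have hker := eLpNorm_kernel_le (w := w) hW hp hΦ hΓ hT hg.enorm
  rw [← wLpNorm_eq hW0] at hker
  set H : Space m → ℝ≥0∞ := fun x => ∫⁻ y, ‖T x y‖ₑ * ‖g y‖ₑ with hH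
  have hHm : Measurable H := Measurable.lintegral_prod_right'
    (f := fun z : Space m × Space m => ‖T z.1 z.2‖ₑ * ‖g z.2‖ₑ)
    (hTm'.enorm.mul (hg.enorm.comp measurable_snd))
  have hnorm : wLpNorm w p (fun x => ∫ y, T x y * g y) ≤ Γ * wLpNorm W p g := by
    rw [wLpNorm_eq hw.pos]
    refine (eLpNorm_mono_enorm fun x => ?_).trans hker
    simp only [enorm_eq_self]
    gcongr
    exact enorm_integral_mul_le_lintegral _ _
  have hfin : Γ * wLpNorm W p g < ⊤ := ENNReal.mul_lt_top ENNReal.coe_lt_top hgp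
  refine ⟨hm, represents_of_integral_eq hw hp hm (hnorm.trans_lt hfin) fun ψ => ?_, hnorm⟩
  have hint : Integrable (Function.uncurry fun x y => ψ x * (T x y * g y))
      (volume.prod volume) := by
    refine ⟨?_, ?_⟩
    · exact ((ψ.continuous.stronglyMeasurable.comp_measurable measurable_fst).mul
        (hTm'.mul (hg.comp_measurable measurable_snd))).aestronglyMeasurable
    · have h1 := lintegral_schwartz_mul_lt_top hw hp hHm (hker.trans_lt hfin) ψ
      rw [HasFiniteIntegral, lintegral_prod]
      · refine lt_of_le_of_lt (lintegral_mono fun x => ?_) h1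
        simp only [Function.uncurry_apply_pair, enorm_mul]
        rw [lintegral_const_mul' _ _ enorm_ne_top]
      · exact ((ψ.continuous.stronglyMeasurable.comp_measurable measurable_fst).mul
          (hTm'.mul (hg.comp_measurable measurable_snd))).enorm.aemeasurable
  rw [hu]
  calc ∫ y, (∫ x, T x y * ψ x) * g y = ∫ y, ∫ x, ψ x * (T x y * g y) := by
        refine integral_congr_ae (Filter.Eventually.of_forall fun y => ?_)
        simp only
        rw [← integral_mul_const]
        refine integral_congr_ae (Filter.Eventually.of_forall fun x => ?_)
        simp only
        ring
    _ = ∫ x, ∫ y, ψ x * (T x y * g y) := (integral_integral_swap hint).symm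
    _ = _ := by
        refine integral_congr_ae (Filter.Eventually.of_forall fun x => ?_)
        simp only
        rw [integral_const_mul]

end Represent

/-! ### The symbols of the dyadic decomposition. -/

section LittlewoodPaley

variable {n : ℕ} {m : Fin n → ℕ} {a : Fin n → ℝ}

/-- A Schwartz function that is a low-frequency cut-off for the kernel `exp (-2πi x·ξ)`. -/
structure IsLowPass (a : Fin n → ℝ) (L : 𝓢(Space m, ℂ)) : Prop where
  even : ∀ ξ : Space m, L (-ξ) = L ξ
  eq_one : ∀ ξ : Space m, anorm a ((2 * Real.pi) • ξ) ≤ 1 / 2 → L ξ = 1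
  eq_zero : ∀ ξ : Space m, 2 / 3 < anorm a ((2 * Real.pi) • ξ) → L ξ = 0

theorem anorm_smul_dil (ha : ∀ i, 0 < a i) (c t : ℝ) (ξ : Space m) :
    anorm a (c • dil a t ξ) = 2 ^ t * anorm a (c • ξ) := by
  rw [← map_smul, anorm_dil ha]

theorem anorm_two_pi_smul_le (ha : ∀ i, 1 ≤ a i) (ξ : Space m) :
    anorm a ((2 * Real.pi) • ξ) ≤ 2 * Real.pi * anorm a ξ := by
  simp only [anorm, Finset.mul_sum]
  refine Finset.sum_le_sum fun i _ => ?_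
  have hpi := Real.pi_gt_three
  rw [PiLp.smul_apply, norm_smul, Real.norm_of_nonneg (by positivity),
    Real.mul_rpow (by positivity) (by positivity)]
  gcongr
  calc (2 * Real.pi) ^ (1 / a i) ≤ (2 * Real.pi) ^ (1 : ℝ) :=
        Real.rpow_le_rpow_of_exponent_le (by linarith) (by
          rw [div_le_one (by linarith [ha i])]; exact ha i)
    _ = _ := Real.rpow_one _

theorem vanishesNearZero_of_anorm_two_pi (ha : ∀ i, 1 ≤ a i) {σ : Space m → ℂ} {c : ℝ}
    (hc : 0 < c) (h : ∀ ξ : Space m, anorm a ((2 * Real.pi) • ξ) ≤ c → σ ξ = 0) : VanishesNearZero a σ := by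
  have hpi := Real.pi_pos
  refine ⟨c / (2 * Real.pi), by positivity, fun ξ hξ => h ξ ?_⟩
  rw [lt_div_iff₀ (by positivity)] at hξ
  linarith [anorm_two_pi_smul_le ha ξ]

/-- The undilated symbols of the blocks. -/
def blockBase (a : Fin n → ℝ) (L : 𝓢(Space m, ℂ)) (k : ℕ) : 𝓢(Space m, ℂ) :=
  if k = 0 then L else L - dilSymbol a (-1) L

/-- Undilated symbols that are `1` on the support of `blockBase`. -/
def fatBase (a : Fin n → ℝ) (L : 𝓢(Space m, ℂ)) (k : ℕ) : 𝓢(Space m, ℂ) :=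
  if k = 0 then dilSymbol a 1 L else dilSymbol a 1 L - dilSymbol a (-2) L

/-- The symbol of the `k`-th block. -/
def blockSymbol (a : Fin n → ℝ) (L : 𝓢(Space m, ℂ)) (k : ℕ) : 𝓢(Space m, ℂ) :=
  dilSymbol a k (blockBase a L k)

/-- A symbol that is `1` on the support of the symbol of the `k`-th block. -/
def fatSymbol (a : Fin n → ℝ) (L : 𝓢(Space m, ℂ)) (k : ℕ) : 𝓢(Space m, ℂ) :=
  dilSymbol a k (fatBase a L k)

theorem dilSymbol_even (t : ℝ) {σ : 𝓢(Space m, ℂ)} (h : ∀ ξ, σ (-ξ) = σ ξ) (ξ : Space m) :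
    dilSymbol a t σ (-ξ) = dilSymbol a t σ ξ := by
  simp [dilSymbol_apply, h]

theorem IsLowPass.blockBase_even {L : 𝓢(Space m, ℂ)} (h : IsLowPass a L) (k : ℕ) (ξ : Space m) :
    blockBase a L k (-ξ) = blockBase a L k ξ := by
  unfold blockBase
  split_ifs
  · exact h.even ξ
  · simp [dilSymbol_even _ h.even, h.even]

theorem IsLowPass.fatBase_even {L : 𝓢(Space m, ℂ)} (h : IsLowPass a L) (k : ℕ) (ξ : Space m) :
    fatBase a L k (-ξ) = fatBase a L k ξ := by
  unfold fatBase
  split_ifs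
  · exact dilSymbol_even _ h.even ξ
  · simp [dilSymbol_even _ h.even]

theorem IsLowPass.vanishesNearZero_one_sub (ha : ∀ i, 1 ≤ a i) {L : 𝓢(Space m, ℂ)}
    (h : IsLowPass a L) : VanishesNearZero a fun ξ => 1 - L ξ :=
  vanishesNearZero_of_anorm_two_pi ha (c := 1 / 2) (by norm_num) fun ξ hξ => by
    rw [h.eq_one ξ hξ, sub_self]

theorem IsLowPass.vanishesNearZero_blockBase (ha : ∀ i, 1 ≤ a i) {L : 𝓢(Space m, ℂ)}
    (h : IsLowPass a L) {k : ℕ} (hk : k ≠ 0) : VanishesNearZero a (blockBase a L k) :=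
  vanishesNearZero_of_anorm_two_pi ha (c := 1 / 4) (by norm_num) fun ξ hξ => by
    have ha0 : ∀ i, 0 < a i := fun i => one_pos.trans_le (ha i)
    simp only [blockBase, hk, if_false, sub_apply, dilSymbol_apply]
    rw [h.eq_one ξ (by linarith), h.eq_one, sub_self]
    rw [anorm_smul_dil ha0]
    norm_num
    linarith

theorem IsLowPass.vanishesNearZero_fatBase (ha : ∀ i, 1 ≤ a i) {L : 𝓢(Space m, ℂ)}
    (h : IsLowPass a L) {k : ℕ} (hk : k ≠ 0) : VanishesNearZero a (fatBase a L k) :=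
  vanishesNearZero_of_anorm_two_pi ha (c := 1 / 8) (by norm_num) fun ξ hξ => by
    have ha0 : ∀ i, 0 < a i := fun i => one_pos.trans_le (ha i)
    simp only [fatBase, hk, if_false, sub_apply, dilSymbol_apply]
    rw [h.eq_one, h.eq_one, sub_self]
    · rw [anorm_smul_dil ha0, neg_neg, Real.rpow_two]
      linarith
    · rw [anorm_smul_dil ha0, Real.rpow_neg_one]
      linarith

/-- Let `t` be the anisotropic modulus of `2π η`, where `η` is the rescaled frequency. For `k ≠ 0`
the block lives on `1/4 < t ≤ 2/3`; there `t/2 ≤ 1/2`, so the first term of the fat symbol is `1`,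
and `4t > 2/3`, so the second is `0`. For `k = 0` only the bound `t/2 ≤ 1/2` is needed. -/
theorem IsLowPass.fatSymbol_mul_blockSymbol (ha : ∀ i, 0 < a i) {L : 𝓢(Space m, ℂ)}
    (h : IsLowPass a L) (k : ℕ) (ξ : Space m) :
    fatSymbol a L k ξ * blockSymbol a L k ξ = blockSymbol a L k ξ := by
  simp only [fatSymbol, blockSymbol, dilSymbol_apply]
  set η := dil a (-(k : ℝ)) ξ
  have key : fatBase a L k η = 1 ∨ blockBase a L k η = 0 := by
    by_cases hk : k = 0
    · simp only [fatBase, blockBase, hk, if_true, dilSymbol_apply]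
      rcases le_or_gt (anorm a ((2 * Real.pi) • η)) (2 / 3) with h1 | h1
      · left
        apply h.eq_one
        rw [anorm_smul_dil ha, Real.rpow_neg_one]
        linarith
      · exact Or.inr (h.eq_zero η h1)
    · simp only [fatBase, blockBase, hk, if_false, sub_apply, dilSymbol_apply, neg_neg]
      rcases le_or_gt (anorm a ((2 * Real.pi) • η)) (2 / 3) with h1 | h1
      · rcases le_or_gt (anorm a ((2 * Real.pi) • η)) (1 / 4) with h2 | h2
        · right
          rw [h.eq_one _ (by linarith), h.eq_one, sub_self]
          rw [anorm_smul_dil ha, Real.rpow_one]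
          linarith
        · left
          rw [h.eq_one, h.eq_zero, sub_zero]
          · rw [anorm_smul_dil ha, Real.rpow_two]
            linarith
          · rw [anorm_smul_dil ha, Real.rpow_neg_one]
            linarith
      · right
        rw [h.eq_zero _ h1, h.eq_zero, sub_zero]
        rw [anorm_smul_dil ha, Real.rpow_one]
        linarith
  rcases key with h1 | h1
  · rw [h1, one_mul]
  · rw [h1, mul_zero]

theorem sum_blockSymbol (L : 𝓢(Space m, ℂ)) (K : ℕ) (ξ : Space m) :
    ∑ k ∈ Finset.range (K + 1), blockSymbol a L k ξ = dilSymbol a K L ξ := by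
  induction K with
  | zero => simp [blockSymbol, blockBase]
  | succ K ih =>
    rw [Finset.sum_range_succ, ih]
    simp only [blockSymbol, blockBase, Nat.succ_ne_zero, if_false, dilSymbol_apply, sub_apply,
      dil_dil]
    have : - -1 + -((K + 1 : ℕ) : ℝ) = -(K : ℝ) := by push_cast; ring
    rw [this]
    ring

theorem tendsto_sum_op_blockSymbol (ha : ∀ i, 1 ≤ a i) {L : 𝓢(Space m, ℂ)} (h : IsLowPass a L)
    (ψ : 𝓢(Space m, ℂ)) :
    Filter.Tendsto (fun K : ℕ => ∑ k ∈ Finset.range K, op (blockSymbol a L k) ψ) Filter.atTop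
      (nhds ψ) := by
  rw [← Filter.tendsto_add_atTop_iff_nat 1]
  have := tendsto_op_dilSymbol ha (h.vanishesNearZero_one_sub ha) ψ
  refine this.congr fun K => ?_
  exact (op_sum _ (fun ξ => sum_blockSymbol L K ξ) ψ).symm

/-- Dilations commute with scalars, so the factor `2π` of the Fourier normalisation is absorbed into
`L` once and for all; the later estimates see `φ` only through `L`. -/
theorem IsCutoff.exists_isLowPass (ha : ∀ i, 0 < a i) {φ : Space m → ℝ} (hφ : IsCutoff a φ) :
    ∃ L : 𝓢(Space m, ℂ), IsLowPass a L ∧ ∀ (k : ℕ) (f : 𝓢'(Space m, ℂ)) (ψ : 𝓢(Space m, ℂ)),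
      block a φ k f ψ = f (op (blockSymbol a L k) ψ) := by
  have hpi := Real.pi_pos
  have hs : ContDiff ℝ ∞ fun ξ : Space m => φ ((2 * Real.pi) • ξ) :=
    hφ.smooth.comp (contDiff_id.const_smul _)
  have hc : HasCompactSupport fun ξ : Space m => φ ((2 * Real.pi) • ξ) :=
    (hφ.hasCompactSupport ha).comp_smul (by positivity)
  refine ⟨realSchwartz hs hc, ⟨fun ξ => ?_, fun ξ hξ => ?_, fun ξ hξ => ?_⟩, fun k f ψ => ?_⟩
  · simp [realSchwartz_apply, hφ.symmetric]
  · simp [realSchwartz_apply, hφ.eq_one _ hξ]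
  · simp [realSchwartz_apply, hφ.eq_zero _ hξ]
  · have e : (fun ξ : Space m => ((dyadic a φ k ((2 * Real.pi) • ξ) : ℝ) : ℂ)) =
        blockSymbol a (realSchwartz hs hc) k := by
      ext ξ
      rcases k with _ | j
      · simp [blockSymbol, blockBase, dyadic, dilSymbol_apply, dil_zero, realSchwartz_apply]
      · simp only [blockSymbol, blockBase, dyadic, Nat.succ_ne_zero, if_false, dilSymbol_apply,
          sub_apply, realSchwartz_apply, dil_dil, ← coe_dil, map_smul]
        have e1 : - -1 + -((j + 1 : ℕ) : ℝ) = -(j : ℝ) := by push_cast; ring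
        rw [e1]
        push_cast
        rfl
    rw [block, e]
    rfl

end LittlewoodPaley

/-! ### Multiplication by a weight is almost diagonal in the blocks. -/

section WeightedBlocks

variable {n : ℕ} {m : Fin n → ℕ} {a : Fin n → ℝ}

/-- The function `z ↦ K (y - z)`. -/
def reflectShift (y : Space m) (K : 𝓢(Space m, ℂ)) : 𝓢(Space m, ℂ) :=
  compSubConstCLM ℂ y (compCLMOfContinuousLinearEquiv ℂ (ContinuousLinearEquiv.neg ℝ) K)

theorem reflectShift_apply (y : Space m) (K : 𝓢(Space m, ℂ)) (z : Space m) :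
    reflectShift y K z = K (y - z) := by
  simp [reflectShift]

theorem op_weight_op_apply {u : Space m → ℝ} (hu : IsWeight u) (σ τ ψ : 𝓢(Space m, ℂ))
    (y : Space m) :
    op σ (smulLeftCLM ℂ (fun x => (u x : ℂ)) (op τ ψ)) y = ∫ x, sandwich u σ τ y x * ψ x := by
  have hutg := hu.hasTemperateGrowth
  rw [op_apply]
  have hcu : Continuous u := hu.smooth.continuous
  have h1 : Integrable (fun z => 𝓕 σ (y - z) * (u z : ℂ)) := by
    have := (smulLeftCLM ℂ (fun x => (u x : ℂ)) (reflectShift y (𝓕 σ))).integrable (μ := volume)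
    refine this.congr (Filter.Eventually.of_forall fun z => ?_)
    simp only
    rw [smulLeftCLM_apply_apply hutg, reflectShift_apply, smul_eq_mul, mul_comm]
  have h2 : Integrable (Function.uncurry fun z x : Space m =>
      𝓕 σ (y - z) * ((u z : ℂ) * 𝓕 τ (z - x)) * ψ x) (volume.prod volume) := by
    have h3 := (h1.mul_prod (ψ.integrable (μ := volume)))
    have hb : ∀ v, ‖𝓕 τ v‖ ≤ SchwartzMap.seminorm ℝ 0 0 (𝓕 τ) :=
      fun v => SchwartzMap.norm_le_seminorm ℝ _ v
    have h4 := h3.bdd_mul (f := fun z : Space m × Space m => 𝓕 τ (z.1 - z.2))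
      (c := SchwartzMap.seminorm ℝ 0 0 (𝓕 τ))
      (by exact ((𝓕 τ).continuous.comp (continuous_fst.sub continuous_snd)).aestronglyMeasurable)
      (Filter.Eventually.of_forall fun z => hb _)
    refine h4.congr (Filter.Eventually.of_forall fun z => ?_)
    simp only [Function.uncurry]
    ring
  have h3 := integral_integral_swap h2
  have e1 : ∀ z, 𝓕 σ (y - z) * (smulLeftCLM ℂ (fun x => (u x : ℂ)) (op τ ψ)) z =
      ∫ x, 𝓕 σ (y - z) * ((u z : ℂ) * 𝓕 τ (z - x)) * ψ x := by
    intro z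
    rw [smulLeftCLM_apply_apply hutg, op_apply, smul_eq_mul, ← integral_const_mul,
      ← integral_const_mul]
    refine integral_congr_ae (Filter.Eventually.of_forall fun x => ?_)
    simp only
    ring
  simp_rw [e1]
  rw [h3]
  refine integral_congr_ae (Filter.Eventually.of_forall fun x => ?_)
  simp only [sandwich]
  rw [← integral_mul_const]

theorem stronglyMeasurable_sandwich {u : Space m → ℝ} (hu : IsWeight u) (σ τ : 𝓢(Space m, ℂ)) :
    StronglyMeasurable (Function.uncurry fun x y => sandwich u σ τ y x) := by
  have hcu : Continuous u := hu.smooth.continuous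
  have hc : Continuous fun q : (Space m × Space m) × Space m =>
      𝓕 σ (q.1.2 - q.2) * ((u q.2 : ℂ) * 𝓕 τ (q.2 - q.1.1)) := by
    have h1 := (𝓕 σ).continuous
    have h2 := (𝓕 τ).continuous
    fun_prop
  exact hc.stronglyMeasurable.integral_prod_right'

/-- The `L^1`-normalised kernel of scale `2^{-i}`. -/
def scaleKernel (a : Fin n → ℝ) (i : ℕ) (z : Space m) : ℝ :=
  (2 : ℝ) ^ (i * homDim a m) * ((1 + ‖dil a i z‖) ^ (Module.finrank ℝ (Space m) + 1))⁻¹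

theorem scaleKernel_nonneg (i : ℕ) (z : Space m) : 0 ≤ scaleKernel a i z := by
  unfold scaleKernel; positivity

theorem continuous_scaleKernel (i : ℕ) : Continuous (scaleKernel a i : Space m → ℝ) := by
  unfold scaleKernel
  refine continuous_const.mul (Continuous.inv₀ ?_ fun z => by positivity)
  have := (dil a i : Space m ≃L[ℝ] Space m).continuous
  fun_prop

theorem exists_lintegral_scaleKernel (a : Fin n → ℝ) (m : Fin n → ℕ) :
    ∃ I : ℝ≥0, ∀ i : ℕ, ∫⁻ z : Space m, ENNReal.ofReal (scaleKernel a i z) = I := by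
  have h := integrable_one_add_norm (E := Space m) (μ := volume)
    (r := (Module.finrank ℝ (Space m) + 1 : ℕ)) (by push_cast; linarith)
  have hI : ∫⁻ z : Space m, ENNReal.ofReal
      (((1 + ‖z‖) ^ (Module.finrank ℝ (Space m) + 1))⁻¹) < ⊤ := by
    have h2 := h.lintegral_lt_top
    refine lt_of_eq_of_lt (lintegral_congr fun z => ?_) h2
    rw [Real.rpow_neg (by positivity), Real.rpow_natCast]
  refine ⟨(∫⁻ z : Space m, ENNReal.ofReal
    (((1 + ‖z‖) ^ (Module.finrank ℝ (Space m) + 1))⁻¹)).toNNReal, fun i => ?_⟩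
  rw [ENNReal.coe_toNNReal hI.ne]
  simp only [scaleKernel]
  simp_rw [ENNReal.ofReal_mul (show 0 ≤ (2 : ℝ) ^ (i * homDim a m) by positivity)]
  rw [lintegral_const_mul' _ _ ENNReal.ofReal_ne_top, lintegral_comp_dil a i
    (fun z => ENNReal.ofReal (((1 + ‖z‖) ^ (Module.finrank ℝ (Space m) + 1))⁻¹)), ← mul_assoc,
    ← ENNReal.ofReal_mul (by positivity), ← Real.rpow_add (by norm_num)]
  simp

/-- Passage of a weight through the decay of a kernel at scale `2^{-i}`. -/
theorem IsWeight.exists_mul_decay_le (ha : ∀ i, 0 ≤ a i) {w : Space m → ℝ} (hw : IsWeight w) :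
    ∃ (C : ℝ) (N : ℕ), 0 < C ∧ ∀ (i : ℕ) (r : ℕ) (x y : Space m),
      w x * ((1 + ‖dil a i (x - y)‖) ^ (r + N))⁻¹ ≤
        C * w y * ((1 + ‖dil a i (x - y)‖) ^ r)⁻¹ := by
  obtain ⟨C, N, hC, hg⟩ := hw.growth
  refine ⟨C, N, hC, fun i r x y => ?_⟩
  have h1 := norm_le_norm_dil ha (Nat.cast_nonneg (α := ℝ) i) (x - y)
  have hy := (hw.pos y).le
  set D := ‖dil a i (x - y)‖
  have hD : 0 ≤ D := norm_nonneg _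
  calc w x * ((1 + D) ^ (r + N))⁻¹ ≤ C * w y * (1 + D) ^ N * ((1 + D) ^ (r + N))⁻¹ := by
        gcongr
        refine (hg x y).trans ?_
        gcongr
    _ = _ := by
        rw [pow_add]
        field_simp

/-- If `j ≤ k` the fat symbol is the finer one and supplies the decay; otherwise the kernel is
swapped and the block `j` supplies it. The bound carries `u` at the point attached to the coarser
symbol: this is `x` in the first case, where `u` has to be moved to `y` at the cost of `Nu` powers
of decay, and already `y` in the second. Moving `w` costs `Nw` powers in both, and `d` powers remain
for integrability. -/
theorem exists_weighted_sandwich_le (ha : ∀ i, 1 ≤ a i) {w u : Space m → ℝ} (hw : IsWeight w)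
    (hu : IsWeight u) {L : 𝓢(Space m, ℂ)} (hL : IsLowPass a L) (M : ℕ) :
    ∃ C : ℝ, 0 < C ∧ ∀ (j k : ℕ) (x y : Space m),
      w x * ‖sandwich u (fatSymbol a L k) (blockSymbol a L j) y x‖ ≤
        C * (2 : ℝ) ^ (-(M : ℝ) * |(j : ℝ) - k|) * scaleKernel a (min j k) (x - y) *
          (w y * u y) := by
  have ha0 : ∀ i, 0 ≤ a i := fun i => zero_le_one.trans (ha i)
  obtain ⟨Cw, Nw, hCw, hw'⟩ := hw.exists_mul_decay_le ha0
  obtain ⟨Cu, Nu, hCu, hu'⟩ := hu.exists_mul_decay_le ha0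
  set d := Module.finrank ℝ (Space m) + 1
  -- There are only two base symbols of each kind, so `C0` has to dominate just four pairs of
  -- constants.
  have hbase : ∀ k : ℕ, blockBase a L k = blockBase a L (min k 1) := fun k => by
    rcases k with _ | k <;> simp [blockBase]
  have hfat : ∀ k : ℕ, fatBase a L k = fatBase a L (min k 1) := fun k => by
    rcases k with _ | k <;> simp [fatBase]
  choose A hA0 hA using fun k j : ℕ => exists_norm_sandwich_le ha hu (fatBase a L k)
    (blockBase a L j) M (d + Nw + Nu)
  choose B hB0 hB using fun k j : ℕ => exists_norm_sandwich_le ha hu (blockBase a L j)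
    (fatBase a L k) M (d + Nw)
  set C0 : ℝ := 1 + ∑ k ∈ Finset.range 2, ∑ j ∈ Finset.range 2, (A k j + B k j)
  have hsum : ∀ k ∈ Finset.range 2, ∀ j ∈ Finset.range 2, A k j + B k j ≤ C0 := by
    intro k hk j hj
    have h1 : A k j + B k j ≤ ∑ j ∈ Finset.range 2, (A k j + B k j) :=
      Finset.single_le_sum (f := fun j => A k j + B k j)
        (fun j _ => add_nonneg (hA0 k j) (hB0 k j)) hj
    have h2 : ∑ j ∈ Finset.range 2, (A k j + B k j) ≤
        ∑ k ∈ Finset.range 2, ∑ j ∈ Finset.range 2, (A k j + B k j) :=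
      Finset.single_le_sum (f := fun k => ∑ j ∈ Finset.range 2, (A k j + B k j))
        (fun k _ => Finset.sum_nonneg fun j _ => add_nonneg (hA0 k j) (hB0 k j)) hk
    linarith
  have hmin : ∀ k : ℕ, min k 1 ∈ Finset.range 2 := fun k => by simp
  have hC0 : 0 < C0 := add_pos_of_pos_of_nonneg one_pos (Finset.sum_nonneg fun k _ =>
    Finset.sum_nonneg fun j _ => add_nonneg (hA0 k j) (hB0 k j))
  have hpow : ∀ p q : ℕ, p ≤ q → ((2 : ℝ) ^ (M * (q - p)))⁻¹ =
      (2 : ℝ) ^ (-(M : ℝ) * ((q : ℝ) - p)) := fun p q hpq => by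
    rw [neg_mul, Real.rpow_neg (by norm_num), ← Nat.cast_sub hpq, ← Nat.cast_mul,
      Real.rpow_natCast]
  refine ⟨C0 * Cw * (1 + Cu), by positivity, fun j k x y => ?_⟩
  have hwx := (hw.pos x).le
  have hwy := (hw.pos y).le
  have hux := (hu.pos x).le
  have huy := (hu.pos y).le
  rcases le_total j k with hjk | hkj
  · have h1 := hA (min k 1) (min j 1) j k hjk (by
      rcases Nat.eq_zero_or_pos k with rfl | hk
      · left; omega
      · right; exact hL.vanishesNearZero_fatBase ha (by omega)) y x
    rw [← hbase, ← hfat] at h1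
    have hAC : A (min k 1) (min j 1) ≤ C0 := by
      have := hsum _ (hmin k) _ (hmin j)
      linarith [hB0 (min k 1) (min j 1)]
    rw [min_eq_left hjk, abs_sub_comm, abs_of_nonneg (by simpa using hjk), ← hpow j k hjk]
    have e1 : ‖dil a j (y - x)‖ = ‖dil a j (x - y)‖ := by
      rw [← neg_sub, map_neg, norm_neg]
    rw [e1] at h1
    set D := ‖dil a j (x - y)‖ with hD
    set P := ((2 : ℝ) ^ (M * (k - j)))⁻¹
    set Q := (2 : ℝ) ^ (j * homDim a m)
    calc w x * ‖sandwich u (fatSymbol a L k) (blockSymbol a L j) y x‖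
        ≤ w x * (C0 * P * u x * (Q * ((1 + D) ^ (d + Nw + Nu))⁻¹)) := by
          gcongr
          refine h1.trans ?_
          gcongr
      _ = C0 * P * Q * (w x * (u x * ((1 + D) ^ (d + Nw + Nu))⁻¹)) := by ring
      _ ≤ C0 * P * Q * (w x * (Cu * u y * ((1 + D) ^ (d + Nw))⁻¹)) := by
          gcongr C0 * P * Q * (w x * ?_)
          exact hu' j (d + Nw) x y
      _ = C0 * P * Q * (Cu * u y) * (w x * ((1 + D) ^ (d + Nw))⁻¹) := by ring
      _ ≤ C0 * P * Q * (Cu * u y) * (Cw * w y * ((1 + D) ^ d)⁻¹) := by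
          gcongr C0 * P * Q * (Cu * u y) * ?_
          exact hw' j d x y
      _ ≤ C0 * P * Q * ((1 + Cu) * u y) * (Cw * w y * ((1 + D) ^ d)⁻¹) := by
          gcongr
          linarith
      _ = _ := by rw [scaleKernel]; ring
  · rw [fatSymbol, blockSymbol, sandwich_swap u (dilSymbol_even _ (hL.fatBase_even k))
      (dilSymbol_even _ (hL.blockBase_even j))]
    have h1 := hB (min k 1) (min j 1) k j hkj (by
      rcases Nat.eq_zero_or_pos j with rfl | hj
      · left; omega
      · right; exact hL.vanishesNearZero_blockBase ha (by omega)) x y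
    rw [← hbase, ← hfat] at h1
    have hBC : B (min k 1) (min j 1) ≤ C0 := by
      have := hsum _ (hmin k) _ (hmin j)
      linarith [hA0 (min k 1) (min j 1)]
    rw [min_eq_right hkj, abs_of_nonneg (by simpa using hkj), ← hpow k j hkj]
    set D := ‖dil a k (x - y)‖ with hD
    set P := ((2 : ℝ) ^ (M * (j - k)))⁻¹
    set Q := (2 : ℝ) ^ (k * homDim a m)
    calc w x * ‖sandwich u (dilSymbol a j (blockBase a L j)) (dilSymbol a k (fatBase a L k)) x y‖
        ≤ w x * (C0 * P * u y * (Q * ((1 + D) ^ (d + Nw))⁻¹)) := by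
          gcongr
          refine h1.trans ?_
          gcongr
      _ = C0 * P * Q * u y * (w x * ((1 + D) ^ (d + Nw))⁻¹) := by ring
      _ ≤ C0 * P * Q * u y * (Cw * w y * ((1 + D) ^ d)⁻¹) := by
          gcongr C0 * P * Q * u y * ?_
          exact hw' k d x y
      _ = C0 * P * Q * (1 * u y) * (Cw * w y * ((1 + D) ^ d)⁻¹) := by ring
      _ ≤ C0 * P * Q * ((1 + Cu) * u y) * (Cw * w y * ((1 + D) ^ d)⁻¹) := by
          gcongr
          linarith
      _ = _ := by rw [scaleKernel]; ring

theorem weightMul_apply (u : Space m → ℝ) (f : 𝓢'(Space m, ℂ)) (ψ : 𝓢(Space m, ℂ)) :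
    weightMul u f ψ = f (smulLeftCLM ℂ (fun x => (u x : ℂ)) ψ) := rfl

theorem tempered_map_sum (f : 𝓢'(Space m, ℂ)) {ι : Type*} (s : Finset ι)
    (g : ι → 𝓢(Space m, ℂ)) : f (∑ i ∈ s, g i) = ∑ i ∈ s, f (g i) :=
  map_sum (show 𝓢(Space m, ℂ) →L[ℂ] ℂ from f) g s

/-- Almost diagonality of the multiplication by a weight with respect to the blocks. -/
theorem exists_distWLpNorm_block_weightMul_le (ha : ∀ i, 1 ≤ a i) {φ : Space m → ℝ}
    (hφ : IsCutoff a φ) {w u : Space m → ℝ} (hw : IsWeight w) (hu : IsWeight u) (M : ℕ) :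
    ∃ Γ : ℝ≥0, 1 ≤ Γ ∧ ∀ p : ℝ≥0∞, 1 ≤ p → ∀ (f : 𝓢'(Space m, ℂ)) (j : ℕ),
      distWLpNorm w p (block a φ j (weightMul u f)) ≤
        ∑' k : ℕ, Γ * (ENNReal.ofReal ((2 : ℝ) ^ (-(M : ℝ) * |(j : ℝ) - k|)) *
          distWLpNorm (fun x => w x * u x) p (block a φ k f)) := by
  have ha0 : ∀ i, 0 < a i := fun i => one_pos.trans_le (ha i)
  obtain ⟨L, hL, hblock⟩ := hφ.exists_isLowPass ha0
  obtain ⟨C, hC, hker⟩ := exists_weighted_sandwich_le ha hw hu hL M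
  obtain ⟨I, hI⟩ := exists_lintegral_scaleKernel a m
  -- The summand `1` keeps the constant positive: since `0 * ∞ = 0`, a zero constant would lose the
  -- case in which some block has infinite norm.
  refine ⟨1 + C.toNNReal * I, by simp, fun p hp f j => ?_⟩
  set W : Space m → ℝ := fun x => w x * u x
  have hW0 : ∀ x, 0 < W x := fun x => mul_pos (hw.pos x) (hu.pos x)
  have hWm : Measurable W := (hw.smooth.continuous.mul hu.smooth.continuous).measurable
  set γ : ℕ → ℝ := fun k => (2 : ℝ) ^ (-(M : ℝ) * |(j : ℝ) - k|) with hγ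
  have hγ0 : ∀ k, 0 < γ k := fun k => by positivity
  by_cases hfin : ∀ k, distWLpNorm W p (block a φ k f) < ⊤
  swap
  · push Not at hfin
    obtain ⟨k, hk⟩ := hfin
    refine le_trans ?_ (ENNReal.le_tsum k)
    rw [top_le_iff.1 hk, ENNReal.mul_top (ENNReal.ofReal_pos.2 (hγ0 k)).ne', ENNReal.mul_top (by simp)]
    exact le_top
  have hg := fun k => exists_represents_of_lt_top (hfin k)
  choose g hgm hgr hgn using hg
  have hrep : ∀ k, ∃ G, StronglyMeasurable G ∧
      Represents G (block a φ j (weightMul u (block a φ k f))) ∧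
      wLpNorm w p G ≤ (1 + C.toNNReal * I : ℝ≥0) * (ENNReal.ofReal (γ k) *
        distWLpNorm W p (block a φ k f)) := by
    intro k
    have h := represents_kernel hw hWm hW0 hp
      (T := fun x y => sandwich u (fatSymbol a L k) (blockSymbol a L j) y x)
      (stronglyMeasurable_sandwich hu _ _)
      (Φ := fun z => ENNReal.ofReal (C * γ k * scaleKernel a (min j k) z))
      (by
        have := (continuous_scaleKernel (a := a) (m := m) (min j k)).measurable
        fun_prop)
      (Γ := (C.toNNReal * I) * (γ k).toNNReal) (by
        simp_rw [ENNReal.ofReal_mul (show 0 ≤ C * γ k by have := hγ0 k; positivity)]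
        rw [lintegral_const_mul' _ _ ENNReal.ofReal_ne_top, hI, ENNReal.ofReal_mul hC.le]
        simp only [ENNReal.ofReal, ENNReal.coe_mul]
        rw [mul_right_comm])
      (fun x y => by
        rw [← ofReal_norm, ← ENNReal.ofReal_mul (hw.pos x).le,
          ← ENNReal.ofReal_mul (by
            have := hγ0 k
            have := scaleKernel_nonneg (a := a) (min j k) (x - y)
            positivity)]
        exact ENNReal.ofReal_le_ofReal (hker j k x y))
      (hgm k) (by rw [hgn k]; exact hfin k)
      (u := block a φ j (weightMul u (block a φ k f))) (fun ψ => by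
        rw [hblock, weightMul_apply, hblock]
        -- Inserting the fat multiplier produces a kernel acting on the function `R_k f`, rather
        -- than on the distribution `f`.
        have e1 : op (blockSymbol a L k)
            (smulLeftCLM ℂ (fun x => (u x : ℂ)) (op (blockSymbol a L j) ψ)) =
            op (blockSymbol a L k) (op (fatSymbol a L k)
              (smulLeftCLM ℂ (fun x => (u x : ℂ)) (op (blockSymbol a L j) ψ))) :=
          (op_op (fun ξ => by
            rw [mul_comm]; exact hL.fatSymbol_mul_blockSymbol ha0 k ξ) _).symm
        rw [e1, ← hblock, ((hgr k).2 _).2]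
        simp_rw [op_weight_op_apply hu])
    refine ⟨_, h.1, h.2.1, h.2.2.trans ?_⟩
    rw [hgn k, ENNReal.coe_mul, mul_assoc]
    exact mul_le_mul' (by exact_mod_cast le_add_self) le_rfl
  choose G hGm hGr hGn using hrep
  by_cases hS : ∑' k : ℕ, (1 + C.toNNReal * I : ℝ≥0) * (ENNReal.ofReal (γ k) *
      distWLpNorm W p (block a φ k f)) < ⊤
  swap
  · rw [not_lt, top_le_iff] at hS
    rw [hS]
    exact le_top
  have hle := ENNReal.tsum_le_tsum hGn
  obtain ⟨H, -, hHr, hHn, -⟩ := represents_tsum hw hp hGm (hle.trans_lt hS)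
    (u := block a φ j (weightMul u f)) (fun ψ => by
      rw [hblock, weightMul_apply]
      set η := smulLeftCLM ℂ (fun x => (u x : ℂ)) (op (blockSymbol a L j) ψ)
      have h1 := ((ContinuousLinearMap.continuous f).tendsto η).comp
        (tendsto_sum_op_blockSymbol ha hL η)
      refine h1.congr fun K => ?_
      refine (tempered_map_sum f _ _).trans ?_
      refine Finset.sum_congr rfl fun k _ => ?_
      rw [← ((hGr k).2 ψ).2, hblock, weightMul_apply, hblock])
  rw [hHr.distWLpNorm_eq]
  exact hHn.trans hle

theorem exists_besovNorm_weightMul_le (ha : ∀ i, 1 ≤ a i) {φ : Space m → ℝ}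
    (hφ : IsCutoff a φ) {w u : Space m → ℝ} (hw : IsWeight w) (hu : IsWeight u) (s : ℝ) :
    ∃ Γ : ℝ≥0, ∀ p q : ℝ≥0∞, 1 ≤ p → 1 ≤ q → ∀ f : 𝓢'(Space m, ℂ),
      besovNorm a φ s p q w (weightMul u f) ≤
        Γ * besovNorm a φ s p q (fun x => w x * u x) f := by
  -- Exchanging `2^{sj}` for `2^{sk}` costs at most `2^{|s||j-k|}`; the order `⌈|s|⌉ + 1` leaves
  -- `2^{-|j-k|}` for the Schur test.
  obtain ⟨Γ, -, hΓ⟩ := exists_distWLpNorm_block_weightMul_le ha hφ hw hu (⌈|s|⌉₊ + 1)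
  obtain ⟨D, hD⟩ := exists_eLpNorm_tsum_geometric_le one_pos
  refine ⟨Γ * D, fun p q hp hq f => ?_⟩
  set b : ℕ → ℝ≥0∞ := fun k => ENNReal.ofReal ((2 : ℝ) ^ (s * ((k : ℝ) - 1))) *
    distWLpNorm (fun x => w x * u x) p (block a φ k f) with hb
  have h1 : besovNorm a φ s p q w (weightMul u f) ≤ eLpNorm (fun j : ℕ => (Γ : ℝ≥0∞) *
      ∑' k : ℕ, ENNReal.ofReal ((2 : ℝ) ^ (-1 * |(j : ℝ) - k|)) * b k) q Measure.count := by
    refine eLpNorm_mono_enorm fun j => ?_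
    simp only [enorm_eq_self]
    rw [← ENNReal.tsum_mul_left]
    refine (mul_le_mul_right (hΓ p hp f j) _).trans ?_
    rw [← ENNReal.tsum_mul_left]
    refine ENNReal.tsum_le_tsum fun k => ?_
    have h2 : (2 : ℝ) ^ (s * ((j : ℝ) - 1)) *
        (2 : ℝ) ^ (-((⌈|s|⌉₊ + 1 : ℕ) : ℝ) * |(j : ℝ) - k|) ≤
        (2 : ℝ) ^ (-1 * |(j : ℝ) - k|) * (2 : ℝ) ^ (s * ((k : ℝ) - 1)) := by
      rw [← Real.rpow_add (by norm_num), ← Real.rpow_add (by norm_num)]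
      refine Real.rpow_le_rpow_of_exponent_le (by norm_num) ?_
      push_cast
      have h3 : s * ((j : ℝ) - k) ≤ |s| * |(j : ℝ) - k| := by
        rw [← abs_mul]; exact le_abs_self _
      have h4 : |s| * |(j : ℝ) - k| ≤ ⌈|s|⌉₊ * |(j : ℝ) - k| := by
        gcongr; exact Nat.le_ceil _
      linarith
    calc _ = Γ * (ENNReal.ofReal ((2 : ℝ) ^ (s * ((j : ℝ) - 1)) *
          (2 : ℝ) ^ (-((⌈|s|⌉₊ + 1 : ℕ) : ℝ) * |(j : ℝ) - k|)) *
          distWLpNorm (fun x => w x * u x) p (block a φ k f)) := by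
          rw [ENNReal.ofReal_mul (by positivity)]; ring
      _ ≤ Γ * (ENNReal.ofReal ((2 : ℝ) ^ (-1 * |(j : ℝ) - k|) * (2 : ℝ) ^ (s * ((k : ℝ) - 1))) *
          distWLpNorm (fun x => w x * u x) p (block a φ k f)) := by gcongr
      _ = _ := by rw [ENNReal.ofReal_mul (by positivity), hb]; ring
  refine h1.trans ((eLpNorm_const_mul_ennreal _ _ _).trans ?_)
  rw [ENNReal.coe_mul, mul_assoc]
  gcongr
  exact hD q hq b

theorem weightMul_inv_weightMul {ρ : Space m → ℝ} (hρ : IsWeight ρ) (f : 𝓢'(Space m, ℂ)) :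
    weightMul (fun x => (ρ x)⁻¹) (weightMul ρ f) = f := by
  unfold weightMul
  rw [TemperedDistribution.smulLeftCLM_smulLeftCLM_apply hρ.hasTemperateGrowth
    hρ.inv.hasTemperateGrowth]
  have : ((fun x => (ρ x : ℂ)) * fun x => (((ρ x)⁻¹ : ℝ) : ℂ)) = fun _ => 1 := by
    ext x
    have := (hρ.pos x).ne'
    rw [Pi.mul_apply, ← Complex.ofReal_mul, mul_inv_cancel₀ this, Complex.ofReal_one]
  rw [this, TemperedDistribution.smulLeftCLM_const, one_smul]

/-- Multiplication by the weight is an isomorphism from the weighted to the unweighted Besov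
space. -/
theorem exists_comparable_besovNorm_weightMul (ha : ∀ i, 1 ≤ a i) {φ : Space m → ℝ}
    (hφ : IsCutoff a φ) {ρ : Space m → ℝ} (hρ : IsWeight ρ) (s : ℝ) :
    ∃ C : ℝ≥0, 1 ≤ C ∧ ∀ p q : ℝ≥0∞, 1 ≤ p → 1 ≤ q → ∀ f : 𝓢'(Space m, ℂ),
      besovNorm a φ s p q ρ f ≤ C * besovNorm a φ s p q (fun _ => 1) (weightMul ρ f) ∧
      besovNorm a φ s p q (fun _ => 1) (weightMul ρ f) ≤ C * besovNorm a φ s p q ρ f := by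
  -- Applied to `ρ f`: the target weight is `ρ`, the multiplier `1/ρ`, and their product is `1`. The
  -- next line has target weight `1` and multiplier `ρ`.
  obtain ⟨C1, h1⟩ := exists_besovNorm_weightMul_le ha hφ hρ hρ.inv s
  obtain ⟨C2, h2⟩ := exists_besovNorm_weightMul_le ha hφ IsWeight.one hρ s
  have e1 : (fun x => ρ x * (ρ x)⁻¹) = fun _ => 1 := by
    ext x
    exact mul_inv_cancel₀ (hρ.pos x).ne'
  have e2 : (fun x => 1 * ρ x) = ρ := by ext x; simp
  rw [e1] at h1
  rw [e2] at h2
  refine ⟨1 + C1 + C2, by rw [add_assoc]; simp, fun p q hp hq f => ⟨?_, ?_⟩⟩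
  · have := h1 p q hp hq (weightMul ρ f)
    rw [weightMul_inv_weightMul hρ] at this
    refine this.trans ?_
    gcongr
    exact le_add_right le_add_self
  · refine (h2 p q hp hq f).trans ?_
    gcongr
    exact le_add_self

end WeightedBlocks

/-! ### Differences of Schwartz functions. -/

section SchwartzDifference

variable {E : Type*} [NormedAddCommGroup E] [NormedSpace ℝ E]

/-- The forward difference of a Schwartz function. -/
def schwartzDiff (h : E) (ψ : 𝓢(E, ℂ)) : 𝓢(E, ℂ) := compSubConstCLM ℂ (-h) ψ - ψ

theorem schwartzDiff_apply (h : E) (ψ : 𝓢(E, ℂ)) (x : E) :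
    schwartzDiff h ψ x = ψ (x + h) - ψ x := by
  simp [schwartzDiff]

theorem coe_schwartzDiff (h : E) (ψ : 𝓢(E, ℂ)) : ⇑(schwartzDiff h ψ) = fwdDiff h ψ := by
  ext x; exact schwartzDiff_apply h ψ x

theorem coe_schwartzDiff_iter (h : E) (M : ℕ) (ψ : 𝓢(E, ℂ)) :
    ⇑((schwartzDiff h)^[M] ψ) = (fwdDiff h)^[M] ψ := by
  induction M with
  | zero => rfl
  | succ M ih => rw [Function.iterate_succ_apply', Function.iterate_succ_apply', coe_schwartzDiff, ih]

theorem fwdDiff_iter_comp_linear {E F : Type*} [AddCommGroup E] [AddCommGroup F] (A : F →+ E) (c : ℂ) (f : E → ℂ)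
    (h : F) (M : ℕ) :
    (fwdDiff h)^[M] (fun z => c * f (A z)) = fun z => c * (fwdDiff (A h))^[M] f (A z) := by
  induction M with
  | zero => rfl
  | succ M ih =>
    rw [Function.iterate_succ_apply', ih]
    ext z
    simp only [fwdDiff, Function.iterate_succ_apply', map_add]
    ring

/-- The mean value inequality trades one derivative for a factor `‖h‖`; along the segment `1 + ‖x‖`
changes by a factor at most `1 + R`. -/
theorem exists_schwartzNorm_schwartzDiff_le (R : ℝ) (hR : 0 ≤ R) (r : ℕ) :
    ∃ C : ℝ, 0 ≤ C ∧ ∀ h : E, ‖h‖ ≤ R → ∀ ψ : 𝓢(E, ℂ),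
      schwartzNorm r (schwartzDiff h ψ) ≤ C * ‖h‖ * schwartzNorm (r + 1) ψ := by
  refine ⟨(1 + R) ^ r * 2 ^ (r + 1), by positivity, fun h hh ψ => ?_⟩
  refine schwartzNorm_le_of_bound (by positivity) fun n hn x => ?_
  have hd : ContDiff ℝ ∞ ψ := ψ.smooth ⊤
  have e : iteratedFDeriv ℝ n (schwartzDiff h ψ) x =
      iteratedFDeriv ℝ n ψ (x + h) - iteratedFDeriv ℝ n ψ x := by
    have e1 : ⇑(schwartzDiff h ψ) = (fun y => ψ (y + h)) - ψ := by
      ext y; exact schwartzDiff_apply h ψ y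
    rw [e1, iteratedFDeriv_sub_apply, iteratedFDeriv_comp_add_right]
    · exact ((hd.comp (contDiff_id.add contDiff_const)).of_le
        (by exact_mod_cast le_top)).contDiffAt
    · exact (hd.of_le (by exact_mod_cast le_top)).contDiffAt
  set S := schwartzNorm (r + 1) ψ
  have hS : 0 ≤ S := apply_nonneg _ _
  have hmv := (convex_segment (𝕜 := ℝ) x (x + h)).norm_image_sub_le_of_norm_fderiv_le (𝕜 := ℝ)
    (f := iteratedFDeriv ℝ n ψ) (C := (1 + R) ^ r * 2 ^ (r + 1) * S * ((1 + ‖x‖) ^ r)⁻¹)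
    (fun y _ => (hd.differentiable_iteratedFDeriv (by exact_mod_cast WithTop.coe_lt_top n)) y)
    (fun y hy => by
      rw [norm_fderiv_iteratedFDeriv]
      have h1 := schwartzNorm_decay (r := r + 1) (k := r) (n := n + 1) (by omega) (by omega) ψ y
      obtain ⟨θ, hθ, rfl⟩ : ∃ θ ∈ Set.Icc (0 : ℝ) 1, x + θ • h = y := by
        rw [segment_eq_image'] at hy
        simpa using hy
      have h2 : 1 + ‖x‖ ≤ (1 + R) * (1 + ‖x + θ • h‖) := by
        have h3 : ‖x‖ ≤ ‖x + θ • h‖ + ‖θ • h‖ := by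
          simpa using norm_sub_le (x + θ • h) (θ • h)
        have h4 : ‖θ • h‖ ≤ R := by
          rw [norm_smul, Real.norm_of_nonneg hθ.1]
          nlinarith [hθ.2, hθ.1, norm_nonneg h]
        nlinarith [norm_nonneg (x + θ • h)]
      rw [← div_eq_mul_inv, le_div_iff₀ (by positivity)]
      calc _ ≤ ‖iteratedFDeriv ℝ (n + 1) ψ (x + θ • h)‖ * ((1 + R) * (1 + ‖x + θ • h‖)) ^ r := by
            gcongr
        _ = (1 + R) ^ r * ((1 + ‖x + θ • h‖) ^ r * ‖iteratedFDeriv ℝ (n + 1) ψ (x + θ • h)‖) := by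
            rw [mul_pow]; ring
        _ ≤ (1 + R) ^ r * (2 ^ (r + 1) * S) := by gcongr
        _ = _ := by ring)
    (left_mem_segment ℝ x (x + h)) (right_mem_segment ℝ x (x + h))
  rw [e]
  rw [add_sub_cancel_left] at hmv
  calc _ ≤ (1 + ‖x‖) ^ r * ((1 + R) ^ r * 2 ^ (r + 1) * S * ((1 + ‖x‖) ^ r)⁻¹ * ‖h‖) := by gcongr
    _ = _ := by field_simp

theorem exists_schwartzNorm_schwartzDiff_iter_le (R : ℝ) (hR : 0 ≤ R) (M r : ℕ) :
    ∃ C : ℝ, 0 ≤ C ∧ ∀ h : E, ‖h‖ ≤ R → ∀ ψ : 𝓢(E, ℂ),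
      schwartzNorm r ((schwartzDiff h)^[M] ψ) ≤ C * ‖h‖ ^ M * schwartzNorm (r + M) ψ := by
  induction M generalizing r with
  | zero => exact ⟨1, zero_le_one, fun h _ ψ => by simp⟩
  | succ M ih =>
    obtain ⟨C1, hC1, h1⟩ := exists_schwartzNorm_schwartzDiff_le (E := E) R hR r
    obtain ⟨C2, hC2, h2⟩ := ih (r + 1)
    refine ⟨C1 * C2, by positivity, fun h hh ψ => ?_⟩
    rw [Function.iterate_succ_apply']
    refine (h1 h hh _).trans ?_
    calc _ ≤ C1 * ‖h‖ * (C2 * ‖h‖ ^ M * schwartzNorm (r + 1 + M) ψ) := by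
          gcongr
          exact h2 h hh ψ
      _ = _ := by rw [show r + 1 + M = r + (M + 1) by ring]; ring

end SchwartzDifference

/-! ### Differences and convolutions in weighted `L^p`. -/

section Differences

variable {n : ℕ} {m : Fin n → ℕ} {a : Fin n → ℝ}

theorem fwdDiff_iter_congr_ae {f g : Space m → ℂ} (h : Space m) (hfg : f =ᵐ[volume] g) (M : ℕ) :
    (fwdDiff h)^[M] f =ᵐ[volume] (fwdDiff h)^[M] g := by
  induction M with
  | zero => exact hfg
  | succ M ih =>
    rw [Function.iterate_succ_apply', Function.iterate_succ_apply']
    have h1 := (measurePreserving_add_right (volume : Measure (Space m)) h).quasiMeasurePreserving.ae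
      ih
    filter_upwards [ih, h1] with x hx hx'
    simp only [fwdDiff, hx, hx']

theorem hasSum_fwdDiff_iter_ae {f : ℕ → Space m → ℂ} {g : Space m → ℂ} (h : Space m)
    (hfg : ∀ᵐ x, HasSum (fun k => f k x) (g x)) (M : ℕ) :
    ∀ᵐ x, HasSum (fun k => (fwdDiff h)^[M] (f k) x) ((fwdDiff h)^[M] g x) := by
  induction M with
  | zero => exact hfg
  | succ M ih =>
    simp only [Function.iterate_succ_apply']
    have h1 := (measurePreserving_add_right (volume : Measure (Space m)) h).quasiMeasurePreserving.ae
      ih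
    filter_upwards [ih, h1] with x hx hx'
    exact hx'.sub hx

/-- Joint measurability in the point and the step is needed to apply Minkowski and to measure the
norm as a function of `h`. -/
theorem stronglyMeasurable_fwdDiff_iter {g : Space m → ℂ} (hg : StronglyMeasurable g) (M : ℕ) :
    StronglyMeasurable (Function.uncurry fun x h : Space m => (fwdDiff h)^[M] g x) := by
  induction M with
  | zero => exact hg.comp_measurable measurable_fst
  | succ M ih =>
    have : (Function.uncurry fun x h : Space m => (fwdDiff h)^[M + 1] g x) =
        (fun q : Space m × Space m => (Function.uncurry fun x h => (fwdDiff h)^[M] g x)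
          (q.1 + q.2, q.2)) - Function.uncurry fun x h => (fwdDiff h)^[M] g x := by
      ext ⟨x, h⟩
      simp [Function.uncurry, Function.iterate_succ_apply', fwdDiff]
    rw [this]
    exact (ih.comp_measurable (by fun_prop)).sub ih

theorem stronglyMeasurable_fwdDiff_iter_right {g : Space m → ℂ} (hg : StronglyMeasurable g) (M : ℕ)
    (h : Space m) : StronglyMeasurable ((fwdDiff h)^[M] g) :=
  (stronglyMeasurable_fwdDiff_iter hg M).comp_measurable (g := fun x => (x, h)) (by fun_prop)

theorem IsWeight.exists_wLpNorm_translate_le {w : Space m → ℝ} (hw : IsWeight w) (R : ℝ) :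
    ∃ C : ℝ≥0, 1 ≤ C ∧ ∀ v : Space m, ‖v‖ ≤ R → ∀ (p : ℝ≥0∞) (g : Space m → ℂ),
      AEStronglyMeasurable g volume → wLpNorm w p (fun x => g (x + v)) ≤ C * wLpNorm w p g := by
  obtain ⟨C, N, hC, hg⟩ := hw.growth
  refine ⟨1 + (C * (1 + R) ^ N).toNNReal, by simp, fun v hv p g hgm => ?_⟩
  have hR : 0 ≤ R := (norm_nonneg v).trans hv
  have h1 := eLpNorm_comp_measurePreserving (p := p)
    (g := fun x => (w x : ℂ) * g x) (f := fun x : Space m => x + v)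
    ((Complex.continuous_ofReal.comp hw.smooth.continuous).aestronglyMeasurable.mul hgm)
    (measurePreserving_add_right (volume : Measure (Space m)) v)
  have h2 := eLpNorm_le_nnreal_smul_eLpNorm_of_ae_le_mul
    (f := fun x => (w x : ℂ) * g (x + v)) (g := fun x => (w (x + v) : ℂ) * g (x + v))
    (c := 1 + (C * (1 + R) ^ N).toNNReal) (μ := volume)
    (Filter.Eventually.of_forall fun x => by
      rw [nnnorm_mul, nnnorm_mul, ← mul_assoc]
      gcongr
      rw [← NNReal.coe_le_coe]
      push_cast
      rw [Real.coe_toNNReal _ (by positivity), Complex.norm_real, Complex.norm_real,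
        Real.norm_of_nonneg (hw.pos _).le, Real.norm_of_nonneg (hw.pos _).le]
      have h3 := hg x (x + v)
      have h4 : ‖x - (x + v)‖ = ‖v‖ := by simp
      rw [h4] at h3
      have hwv := (hw.pos (x + v)).le
      calc w x ≤ C * w (x + v) * (1 + ‖v‖) ^ N := h3
        _ ≤ C * w (x + v) * (1 + R) ^ N := by gcongr
        _ = C * (1 + R) ^ N * w (x + v) := by ring
        _ ≤ _ := by linarith) p
  refine h2.trans_eq ?_
  rw [wLpNorm, ← h1]
  rfl

theorem IsWeight.aestronglyMeasurable_mul {w : Space m → ℝ} (hw : IsWeight w) {g : Space m → ℂ}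
    (hg : AEStronglyMeasurable g volume) :
    AEStronglyMeasurable (fun x => (w x : ℂ) * g x) volume :=
  (Complex.continuous_ofReal.comp hw.smooth.continuous).aestronglyMeasurable.mul hg

theorem aestronglyMeasurable_translate {g : Space m → ℂ} (hg : AEStronglyMeasurable g volume)
    (v : Space m) : AEStronglyMeasurable (fun x => g (x + v)) volume :=
  hg.comp_quasiMeasurePreserving
    (measurePreserving_add_right (volume : Measure (Space m)) v).quasiMeasurePreserving

theorem IsWeight.exists_wLpNorm_fwdDiff_iter_le {w : Space m → ℝ} (hw : IsWeight w) (R : ℝ)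
    (M : ℕ) :
    ∃ C : ℝ≥0, 1 ≤ C ∧ ∀ h : Space m, ‖h‖ ≤ R → ∀ (p : ℝ≥0∞), 1 ≤ p → ∀ (g : Space m → ℂ),
      AEStronglyMeasurable g volume → AEStronglyMeasurable ((fwdDiff h)^[M] g) volume ∧
        wLpNorm w p ((fwdDiff h)^[M] g) ≤ C * wLpNorm w p g := by
  obtain ⟨C, hC1, hC⟩ := hw.exists_wLpNorm_translate_le R
  induction M with
  | zero => exact ⟨1, le_rfl, fun h _ p _ g hg => ⟨hg, by simp⟩⟩
  | succ M ih =>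
    obtain ⟨D, hD1, hD⟩ := ih
    refine ⟨(C + 1) * D, one_le_mul le_add_self hD1, fun h hh p hp g hg => ?_⟩
    obtain ⟨h1, h2⟩ := hD h hh p hp g hg
    rw [Function.iterate_succ_apply']
    set G := (fwdDiff h)^[M] g
    have h3 := aestronglyMeasurable_translate h1 h
    refine ⟨h3.sub h1, ?_⟩
    have h4 := eLpNorm_sub_le (hw.aestronglyMeasurable_mul h3) (hw.aestronglyMeasurable_mul h1) hp
    have e : (fun x => (w x : ℂ) * fwdDiff h G x) =
        (fun x => (w x : ℂ) * G (x + h)) - fun x => (w x : ℂ) * G x := by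
      ext x; simp [fwdDiff, mul_sub]
    rw [wLpNorm, e]
    refine h4.trans ?_
    calc _ ≤ C * wLpNorm w p G + wLpNorm w p G := add_le_add (hC h hh p G h1) le_rfl
      _ = (C + 1) * wLpNorm w p G := by ring
      _ ≤ (C + 1) * (D * wLpNorm w p g) := by gcongr
      _ = _ := by push_cast; ring

/-- The convolution of a Schwartz function with a function. -/
def conv (X : 𝓢(Space m, ℂ)) (g : Space m → ℂ) (x : Space m) : ℂ := ∫ z, X z * g (x - z)

/-- The functions that can be convolved with every Schwartz function. -/
def IsConvolvable (g : Space m → ℂ) : Prop :=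
  ∀ (X : 𝓢(Space m, ℂ)) (x : Space m), Integrable (fun z => X z * g (x - z)) volume

theorem Represents.isConvolvable {g : Space m → ℂ} {u : 𝓢'(Space m, ℂ)} (h : Represents g u) :
    IsConvolvable g := by
  intro X x
  have h1 := ((h.2 (reflectShift x X)).1).comp_sub_left x
  refine h1.congr (Filter.Eventually.of_forall fun z => ?_)
  simp [reflectShift_apply]

theorem IsConvolvable.translate {g : Space m → ℂ} (h : IsConvolvable g) (v : Space m) :
    IsConvolvable fun x => g (x + v) := by
  intro X x
  have := h X (x + v)
  simpa only [sub_add_eq_add_sub] using this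

theorem IsConvolvable.fwdDiff_iter {g : Space m → ℂ} (h : IsConvolvable g) (v : Space m) (M : ℕ) :
    IsConvolvable ((fwdDiff v)^[M] g) := by
  induction M with
  | zero => exact h
  | succ M ih =>
    rw [Function.iterate_succ_apply']
    intro X x
    have := ((ih.translate v) X x).sub (ih X x)
    refine this.congr (Filter.Eventually.of_forall fun z => ?_)
    simp [fwdDiff, mul_sub]

theorem conv_eq_integral (X : 𝓢(Space m, ℂ)) (g : Space m → ℂ) (x : Space m) :
    conv X g x = ∫ y, X (x - y) * g y := by
  rw [conv, ← integral_sub_left_eq_self _ volume x]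
  simp

/-- A difference may be put on either factor. On the function it serves to bound blocks by
differences; on the kernel, as in `fwdDiff_conv'`, it gains powers of the step. -/
theorem fwdDiff_conv {g : Space m → ℂ} (h : IsConvolvable g) (X : 𝓢(Space m, ℂ)) (v : Space m) :
    fwdDiff v (conv X g) = conv X (fwdDiff v g) := by
  ext x
  simp only [fwdDiff, conv, mul_sub]
  rw [integral_sub ((h.translate v) X x) (h X x)]
  simp only [sub_add_eq_add_sub]

theorem fwdDiff_conv' {g : Space m → ℂ} (h : IsConvolvable g) (X : 𝓢(Space m, ℂ)) (v : Space m) :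
    fwdDiff v (conv X g) = conv (schwartzDiff v X) g := by
  ext x
  simp only [fwdDiff, conv, schwartzDiff_apply, sub_mul]
  have e : ∀ z, X (z + v) * g (x - z) = X (z + v) * g (x + v - (z + v)) := fun z => by
    rw [add_sub_add_right_eq_sub]
  have hi : Integrable (fun z => X (z + v) * g (x - z)) volume := by
    simp_rw [e]
    exact (h X (x + v)).comp_add_right v
  rw [integral_sub hi (h X x)]
  simp_rw [e]
  rw [integral_add_right_eq_self fun z => X z * g (x + v - z)]

theorem fwdDiff_iter_conv {g : Space m → ℂ} (h : IsConvolvable g) (X : 𝓢(Space m, ℂ))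
    (v : Space m) (M : ℕ) : (fwdDiff v)^[M] (conv X g) = conv X ((fwdDiff v)^[M] g) := by
  induction M with
  | zero => rfl
  | succ M ih =>
    rw [Function.iterate_succ_apply', ih, fwdDiff_conv (h.fwdDiff_iter v M),
      Function.iterate_succ_apply']

theorem fwdDiff_iter_conv' {g : Space m → ℂ} (h : IsConvolvable g) (X : 𝓢(Space m, ℂ))
    (v : Space m) (M : ℕ) : (fwdDiff v)^[M] (conv X g) = conv ((schwartzDiff v)^[M] X) g := by
  induction M with
  | zero => rfl
  | succ M ih =>
    rw [Function.iterate_succ_apply', ih, fwdDiff_conv' h, Function.iterate_succ_apply']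

theorem stronglyMeasurable_conv (X : 𝓢(Space m, ℂ)) {g : Space m → ℂ} (hg : StronglyMeasurable g) :
    StronglyMeasurable (conv X g) := by
  have : StronglyMeasurable fun q : Space m × Space m => X q.2 * g (q.1 - q.2) :=
    (X.continuous.stronglyMeasurable.comp_measurable measurable_snd).mul
      (hg.comp_measurable (by fun_prop))
  exact this.integral_prod_right'

/-- Convolution with a kernel of scale `2^{-k}` is bounded on `L^p(w)`. -/
theorem IsWeight.exists_wLpNorm_conv_le (ha : ∀ i, 0 ≤ a i) {w : Space m → ℝ} (hw : IsWeight w) :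
    ∃ (C : ℝ≥0) (r : ℕ), 1 ≤ C ∧ ∀ (k : ℕ) (A : ℝ≥0) (X : 𝓢(Space m, ℂ)),
      (∀ z, ‖X z‖ ≤ A * (2 ^ (k * homDim a m) * ((1 + ‖dil a k z‖) ^ r)⁻¹)) →
      ∀ p : ℝ≥0∞, 1 ≤ p → ∀ g : Space m → ℂ, StronglyMeasurable g →
        wLpNorm w p (conv X g) ≤ C * A * wLpNorm w p g := by
  obtain ⟨C, N, hC, hdec⟩ := hw.exists_mul_decay_le ha
  obtain ⟨I, hI⟩ := exists_lintegral_scaleKernel a m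
  set d := Module.finrank ℝ (Space m) + 1 with hd
  refine ⟨1 + C.toNNReal * I, d + N, by simp, fun k A X hX p hp g hg => ?_⟩
  have h := eLpNorm_kernel_le (w := w) (W := w) hw.smooth.continuous.measurable hp
    (T := fun x y => ‖X (x - y)‖ₑ) (Φ := fun z => ENNReal.ofReal (A * C * scaleKernel a k z))
    (by
      have := (continuous_scaleKernel (a := a) (m := m) k).measurable
      fun_prop)
    (Γ := A * (C.toNNReal * I)) (by
      simp_rw [ENNReal.ofReal_mul (show 0 ≤ (A : ℝ) * C by positivity)]
      rw [lintegral_const_mul' _ _ ENNReal.ofReal_ne_top, hI, ENNReal.ofReal_mul A.coe_nonneg]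
      simp only [ENNReal.ofReal, ENNReal.coe_mul, Real.toNNReal_coe]
      rw [mul_assoc])
    (fun x y => by
      rw [← ofReal_norm, ← ENNReal.ofReal_mul (hw.pos x).le, ← ENNReal.ofReal_mul (by
        have := scaleKernel_nonneg (a := a) k (x - y)
        positivity)]
      refine ENNReal.ofReal_le_ofReal ?_
      have h1 := hdec k d x y
      have hwx := (hw.pos x).le
      calc w x * ‖X (x - y)‖
          ≤ w x * (A * (2 ^ (k * homDim a m) * ((1 + ‖dil a k (x - y)‖) ^ (d + N))⁻¹)) := by
            gcongr; exact hX _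
        _ = A * 2 ^ (k * homDim a m) * (w x * ((1 + ‖dil a k (x - y)‖) ^ (d + N))⁻¹) := by ring
        _ ≤ A * 2 ^ (k * homDim a m) * (C * w y * ((1 + ‖dil a k (x - y)‖) ^ d)⁻¹) := by gcongr
        _ = _ := by rw [scaleKernel]; ring)
    hg.enorm
  rw [wLpNorm_eq hw.pos, wLpNorm_eq hw.pos]
  refine le_trans (eLpNorm_mono_enorm fun x => ?_) (h.trans ?_)
  · simp only [enorm_eq_self]
    gcongr
    rw [conv_eq_integral]
    exact enorm_integral_mul_le_lintegral _ _
  · gcongr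
    rw [← ENNReal.coe_mul, ENNReal.coe_le_coe, add_mul, mul_comm A]
    exact le_add_self

/-- After rescaling, a difference of the kernel with step `h` is a difference of the fixed function
`𝓕 σ` with step `dil a k h`, whose Euclidean length is at most `n 2^k |h|_a ≤ n`. -/
theorem exists_norm_fourier_fwdDiff_iter_le (ha : ∀ i, 1 ≤ a i) (σ : 𝓢(Space m, ℂ)) (M r : ℕ) :
    ∃ C : ℝ≥0, ∀ (k : ℕ) (h : Space m), 2 ^ (k : ℝ) * anorm a h ≤ 1 → ∀ z,
      ‖((schwartzDiff h)^[M] (𝓕 (dilSymbol a k σ))) z‖ ≤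
        (C * ⟨(2 ^ (k : ℝ) * anorm a h) ^ M,
          pow_nonneg (mul_nonneg (by positivity) (anorm_nonneg a h)) M⟩ : ℝ≥0) *
          (2 ^ (k * homDim a m) * ((1 + ‖dil a k z‖) ^ r)⁻¹) := by
  have ha0 : ∀ i, 0 < a i := fun i => one_pos.trans_le (ha i)
  obtain ⟨C, hC, hb⟩ := exists_schwartzNorm_schwartzDiff_iter_le (E := Space m) n n.cast_nonneg M r
  set S := schwartzNorm (r + M) (𝓕 σ)
  have hS : 0 ≤ S := apply_nonneg _ _
  refine ⟨⟨2 ^ r * (C * n ^ M * S), by positivity⟩, fun k h hh z => ?_⟩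
  have e : ⇑(𝓕 (dilSymbol a k σ) : 𝓢(Space m, ℂ)) =
      fun z => (((2 : ℝ) ^ (k * homDim a m) : ℝ) : ℂ) *
        𝓕 σ ((dil a k : Space m ≃L[ℝ] Space m).toLinearEquiv.toAddEquiv.toAddMonoidHom z) := by
    ext z; exact fourier_dilSymbol a k σ z
  rw [coe_schwartzDiff_iter, e, fwdDiff_iter_comp_linear]
  change ‖_ * (fwdDiff (dil a k h))^[M] (⇑(𝓕 σ : 𝓢(Space m, ℂ))) (dil a k z)‖ ≤ _
  rw [← coe_schwartzDiff_iter, norm_mul, Complex.norm_real, Real.norm_of_nonneg (by positivity)]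
  have h1 : anorm a (dil a k h) ≤ 1 := by rwa [anorm_dil ha0]
  have h2 := norm_le_mul_anorm ha h1
  have h3 : ‖dil a k h‖ ≤ n := h2.trans (mul_le_of_le_one_right n.cast_nonneg h1)
  have h4 := norm_apply_le_schwartzNorm r ((schwartzDiff (dil a k h))^[M] (𝓕 σ)) (dil a k z)
  have h5 := hb _ h3 (𝓕 σ)
  rw [anorm_dil ha0] at h2
  change _ ≤ (2 ^ r * (C * n ^ M * S) * (2 ^ (k : ℝ) * anorm a h) ^ M) *
    (2 ^ (k * homDim a m) * ((1 + ‖dil a k z‖) ^ r)⁻¹)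
  calc _ ≤ (2 : ℝ) ^ (k * homDim a m) * (2 ^ r * (C * (n * (2 ^ (k : ℝ) * anorm a h)) ^ M * S) *
          ((1 + ‖dil a k z‖) ^ r)⁻¹) := by
        gcongr
        refine h4.trans ?_
        gcongr
        refine h5.trans ?_
        gcongr
    _ = _ := by rw [mul_pow]; ring

end Differences

/-! ### Dyadic annuli and the measure of the increments. -/

section Annuli

variable {n : ℕ} {m : Fin n → ℕ} {a : Fin n → ℝ}

/-- The dyadic annulus `2^{-(j+1)} < |h|_a ≤ 2^{-j}`. -/
def annulus (a : Fin n → ℝ) (m : Fin n → ℕ) (j : ℕ) : Set (Space m) :=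
  {h | (2 : ℝ) ^ (-((j : ℝ) + 1)) < anorm a h ∧ anorm a h ≤ 2 ^ (-(j : ℝ))}

theorem measurableSet_annulus (ha : ∀ i, 0 < a i) (j : ℕ) : MeasurableSet (annulus a m j) :=
  (measurableSet_lt measurable_const (continuous_anorm ha).measurable).inter
    (measurableSet_le (continuous_anorm ha).measurable measurable_const)

theorem anorm_le_one_of_mem_annulus {j : ℕ} {h : Space m} (hh : h ∈ annulus a m j) :
    anorm a h ≤ 1 :=
  hh.2.trans (Real.rpow_le_one_of_one_le_of_nonpos one_le_two (by simp))

theorem anorm_pos_of_mem_annulus {j : ℕ} {h : Space m} (hh : h ∈ annulus a m j) :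
    0 < anorm a h := lt_trans (by positivity) hh.1

theorem pairwise_disjoint_annulus : Pairwise (Function.onFun Disjoint (annulus a m)) := by
  refine (pairwise_disjoint_on _).2 fun i j hij => Set.disjoint_left.2 fun h hi hj => ?_
  have h1 := hi.1.trans_le hj.2
  rw [Real.rpow_lt_rpow_left_iff one_lt_two] at h1
  have h2 : (i : ℝ) + 1 ≤ j := by exact_mod_cast hij
  linarith

theorem exists_mem_annulus (ha : ∀ i, 0 < a i) {h : Space m} (h0 : h ≠ 0) (h1 : anorm a h ≤ 1) :
    ∃ j, h ∈ annulus a m j := by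
  have hpos : 0 < anorm a h :=
    (anorm_nonneg a h).lt_of_ne fun e => h0 ((anorm_eq_zero_iff ha).1 e.symm)
  obtain ⟨j, hj1, hj2⟩ := exists_nat_pow_near_of_lt_one hpos h1 (y := (1 / 2 : ℝ)) (by norm_num)
    (by norm_num)
  refine ⟨j, ?_, ?_⟩
  · rw [Real.rpow_neg (by norm_num), ← Nat.cast_succ, Real.rpow_natCast, ← inv_pow]
    simpa using hj1
  · rw [Real.rpow_neg (by norm_num), Real.rpow_natCast, ← inv_pow]
    simpa using hj2

theorem homDim_nonneg (ha : ∀ i, 0 ≤ a i) : 0 ≤ homDim a m :=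
  Finset.sum_nonneg fun i _ => mul_nonneg (ha i) (Nat.cast_nonneg _)

/-- Rescaling the integral over the annulus of index `0`. -/
theorem lintegral_annulus_zero (ha : ∀ i, 0 < a i) (k : ℕ) (c : Space m → ℝ≥0∞) :
    ∫⁻ h in annulus a m 0, c (dil a (-(k : ℝ)) h) =
      ENNReal.ofReal (2 ^ (k * homDim a m)) * ∫⁻ h in annulus a m k, c h := by
  rw [← lintegral_indicator (measurableSet_annulus ha 0),
    ← lintegral_indicator (measurableSet_annulus ha k)]
  have h1 := lintegral_comp_dil a (-(k : ℝ)) ((annulus a m k).indicator c)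
  rw [neg_mul, neg_neg] at h1
  rw [← h1]
  refine lintegral_congr fun h => ?_
  have h2 : h ∈ annulus a m 0 ↔ dil a (-(k : ℝ)) h ∈ annulus a m k := by
    change (_ ∧ _) ↔ (_ ∧ _)
    have hp : (0 : ℝ) < 2 ^ (-(k : ℝ)) := by positivity
    have e : (2 : ℝ) ^ (-((k : ℝ) + 1)) = 2 ^ (-(k : ℝ)) * 2 ^ (-1 : ℝ) := by
      rw [← Real.rpow_add (by norm_num)]; congr 1; ring
    rw [anorm_dil ha, e, mul_lt_mul_iff_right₀ hp, mul_le_iff_le_one_right hp]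
    norm_num
  by_cases h3 : h ∈ annulus a m 0
  · rw [Set.indicator_of_mem h3, Set.indicator_of_mem (h2.1 h3)]
  · rw [Set.indicator_of_notMem h3, Set.indicator_of_notMem (mt h2.2 h3)]

theorem volume_annulus_zero_lt_top (ha : ∀ i, 0 < a i) : volume (annulus a m 0) < ⊤ :=
  (measure_mono fun _ hh => anorm_le_one_of_mem_annulus hh).trans_lt
    (isCompact_anorm_le ha 1).measure_lt_top

theorem incrementMeasure_restrict_annulus (ha : ∀ i, 0 < a i) (j : ℕ) :
    (incrementMeasure a m).restrict (annulus a m j) =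
      (volume.restrict (annulus a m j)).withDensity
        fun h => ENNReal.ofReal (anorm a h ^ (-(homDim a m))) := by
  have hsub : annulus a m j ⊆ {h | anorm a h ≤ 1} := fun _ hh => anorm_le_one_of_mem_annulus hh
  rw [incrementMeasure, restrict_withDensity (measurableSet_annulus ha j),
    Measure.restrict_restrict (measurableSet_annulus ha j), Set.inter_eq_left.2 hsub]

theorem measurable_density (ha : ∀ i, 0 < a i) :
    Measurable fun h : Space m => ENNReal.ofReal (anorm a h ^ (-(homDim a m))) :=
  ((continuous_anorm ha).measurable.pow_const _).ennreal_ofReal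

/-- With `D = a · m`, the density is at most `2^{(j+1)D}` on the annulus of index `j`, whose volume
is `2^{-jD}` times that of the annulus of index `0`. -/
theorem exists_incrementMeasure_annulus_le (ha : ∀ i, 0 < a i) :
    ∃ V : ℝ≥0, ∀ j, incrementMeasure a m (annulus a m j) ≤ V := by
  have hd := homDim_nonneg (m := m) fun i => (ha i).le
  refine ⟨(ENNReal.ofReal (2 ^ homDim a m) * volume (annulus a m 0)).toNNReal, fun j => ?_⟩
  rw [ENNReal.coe_toNNReal (ENNReal.mul_lt_top ENNReal.ofReal_lt_top
    (volume_annulus_zero_lt_top ha)).ne, ← Measure.restrict_apply_univ,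
    incrementMeasure_restrict_annulus ha, withDensity_apply _ MeasurableSet.univ,
    Measure.restrict_univ]
  have h0 := lintegral_annulus_zero (m := m) ha j fun _ => 1
  simp only [lintegral_one, Measure.restrict_apply_univ] at h0
  calc _ ≤ ∫⁻ h in annulus a m j, ENNReal.ofReal (2 ^ homDim a m * 2 ^ (j * homDim a m)) := by
        refine setLIntegral_mono measurable_const fun h hh => ENNReal.ofReal_le_ofReal ?_
        rw [Real.rpow_neg (anorm_nonneg a h), ← Real.rpow_add (by norm_num)]
        rw [inv_le_comm₀ (Real.rpow_pos_of_pos (anorm_pos_of_mem_annulus hh) _) (by positivity),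
          ← Real.rpow_neg (by norm_num)]
        calc _ = ((2 : ℝ) ^ (-((j : ℝ) + 1))) ^ homDim a m := by
              rw [← Real.rpow_mul (by norm_num)]; congr 1; ring
          _ ≤ _ := Real.rpow_le_rpow (by positivity) hh.1.le hd
    _ = _ := by
        rw [lintegral_const, Measure.restrict_apply_univ, ENNReal.ofReal_mul (by positivity),
          mul_assoc, ← h0]

theorem measurableSet_anorm_le_one (ha : ∀ i, 0 < a i) :
    MeasurableSet {h : Space m | anorm a h ≤ 1} :=
  measurableSet_le (continuous_anorm ha).measurable measurable_const

theorem ae_incrementMeasure_anorm_le (ha : ∀ i, 0 < a i) :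
    ∀ᵐ h ∂(incrementMeasure a m), anorm a h ≤ 1 :=
  (withDensity_absolutelyContinuous _ _).ae_le
    (ae_restrict_mem (measurableSet_anorm_le_one ha))

/-- Keeps the constants independent of `q`. -/
theorem rpow_one_div_le_one_add {V : ℝ≥0∞} {q : ℝ} (hq : 1 ≤ q) : V ^ (1 / q) ≤ 1 + V := by
  rcases le_total V 1 with h | h
  · exact (ENNReal.rpow_le_one h (by positivity)).trans le_self_add
  · calc V ^ (1 / q) ≤ V ^ (1 : ℝ) := ENNReal.rpow_le_rpow_of_exponent_le h (by
          rw [div_le_one (by linarith)]; exact hq)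
      _ ≤ _ := by rw [ENNReal.rpow_one]; exact le_add_self

theorem eLpNorm_nat_eq_tsum {c : ℕ → ℝ≥0∞} {q : ℝ≥0∞} (h0 : q ≠ 0) (h1 : q ≠ ⊤) :
    eLpNorm c q Measure.count = (∑' j, c j ^ q.toReal) ^ (1 / q.toReal) := by
  rw [eLpNorm_rpow_eq_lintegral h0 h1, lintegral_count]

/-- Discretises the norm in `h`. The origin lies in no annulus; the condition `F 0 = 0` disposes of
it without showing that it is a null set. -/
theorem exists_eLpNorm_incrementMeasure_le (ha : ∀ i, 0 < a i) :
    ∃ V : ℝ≥0, 1 ≤ V ∧ ∀ q : ℝ≥0∞, 1 ≤ q → ∀ (F : Space m → ℝ≥0∞) (c : ℕ → ℝ≥0∞), F 0 = 0 →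
      (∀ j, ∀ h ∈ annulus a m j, F h ≤ c j) →
      eLpNorm F q (incrementMeasure a m) ≤ V * eLpNorm c q Measure.count := by
  obtain ⟨V, hV⟩ := exists_incrementMeasure_annulus_le (m := m) ha
  refine ⟨1 + V, by simp, fun q hq F c hF0 hFc => ?_⟩
  rcases eq_or_ne q ⊤ with rfl | hqt
  · rw [eLpNorm_exponent_top, eLpNorm_exponent_top, eLpNormEssSup_count]
    refine le_trans ?_ (le_mul_of_one_le_left zero_le (by simp))
    refine essSup_le_of_ae_le _ ?_
    filter_upwards [ae_incrementMeasure_anorm_le (m := m) ha] with h hh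
    rw [enorm_eq_self]
    rcases eq_or_ne h 0 with rfl | h0
    · rw [hF0]; exact zero_le
    · obtain ⟨j, hj⟩ := exists_mem_annulus ha h0 hh
      exact (hFc j h hj).trans (le_iSup (fun j => ‖c j‖ₑ) j)
  · have hq0 : q ≠ 0 := (one_pos.trans_le hq).ne'
    have hr : 1 ≤ q.toReal := by
      rw [← ENNReal.toReal_one]; exact ENNReal.toReal_mono hqt hq
    set r := q.toReal
    rw [eLpNorm_rpow_eq_lintegral hq0 hqt, eLpNorm_nat_eq_tsum hq0 hqt]
    have h1 : ∫⁻ h, F h ^ r ∂(incrementMeasure a m) ≤ V * ∑' j, c j ^ r := by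
      calc _ ≤ ∫⁻ h, ∑' j, (annulus a m j).indicator (fun _ => c j ^ r) h
            ∂(incrementMeasure a m) := by
            refine lintegral_mono_ae ?_
            filter_upwards [ae_incrementMeasure_anorm_le (m := m) ha] with h hh
            rcases eq_or_ne h 0 with rfl | h0
            · rw [hF0, ENNReal.zero_rpow_of_pos (by linarith)]; exact zero_le
            · obtain ⟨j, hj⟩ := exists_mem_annulus ha h0 hh
              refine le_trans ?_ (ENNReal.le_tsum j)
              rw [Set.indicator_of_mem hj]
              exact ENNReal.rpow_le_rpow (hFc j h hj) (by linarith)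
        _ = ∑' j, c j ^ r * incrementMeasure a m (annulus a m j) := by
            rw [lintegral_tsum fun j => (measurable_const.indicator
              (measurableSet_annulus ha j)).aemeasurable]
            refine tsum_congr fun j => ?_
            rw [lintegral_indicator_const (measurableSet_annulus ha j)]
        _ ≤ ∑' j, c j ^ r * V := ENNReal.tsum_le_tsum fun j => by gcongr; exact hV j
        _ = _ := by rw [ENNReal.tsum_mul_right, mul_comm]
    calc _ ≤ (V * ∑' j, c j ^ r) ^ (1 / r) := ENNReal.rpow_le_rpow h1 (by positivity)
      _ = (V : ℝ≥0∞) ^ (1 / r) * (∑' j, c j ^ r) ^ (1 / r) :=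
          ENNReal.mul_rpow_of_nonneg _ _ (by positivity)
      _ ≤ _ := by
          gcongr
          rw [ENNReal.coe_add, ENNReal.coe_one]
          exact rpow_one_div_le_one_add hr

/-- The converse discretisation: Jensen on each annulus, whose measures are uniformly bounded, and
disjointness. -/
theorem exists_eLpNorm_lintegral_annulus_le (ha : ∀ i, 0 < a i) :
    ∃ V : ℝ≥0, 1 ≤ V ∧ ∀ q : ℝ≥0∞, 1 ≤ q → ∀ F : Space m → ℝ≥0∞, Measurable F →
      eLpNorm (fun j => ∫⁻ h in annulus a m j, F h ∂(incrementMeasure a m)) q Measure.count ≤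
        V * eLpNorm F q (incrementMeasure a m) := by
  obtain ⟨V, hV⟩ := exists_incrementMeasure_annulus_le (m := m) ha
  refine ⟨1 + V, by simp, fun q hq F hF => ?_⟩
  set ν := incrementMeasure a m
  rcases eq_or_ne q ⊤ with rfl | hqt
  · rw [eLpNorm_exponent_top, eLpNorm_exponent_top, eLpNormEssSup_count]
    refine iSup_le fun j => ?_
    rw [enorm_eq_self]
    calc _ ≤ ∫⁻ h in annulus a m j, eLpNormEssSup F ν ∂ν := by
          refine lintegral_mono_ae (ae_restrict_of_ae ?_)
          exact enorm_ae_le_eLpNormEssSup F ν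
      _ = eLpNormEssSup F ν * ν (annulus a m j) := by
          rw [lintegral_const, Measure.restrict_apply_univ]
      _ ≤ eLpNormEssSup F ν * (1 + V : ℝ≥0) := by
          gcongr
          exact (hV j).trans (by exact_mod_cast le_add_self)
      _ = _ := mul_comm _ _
  · have hq0 : q ≠ 0 := (one_pos.trans_le hq).ne'
    have hr : 1 ≤ q.toReal := by
      rw [← ENNReal.toReal_one]; exact ENNReal.toReal_mono hqt hq
    set r := q.toReal
    rw [eLpNorm_nat_eq_tsum hq0 hqt, eLpNorm_rpow_eq_lintegral hq0 hqt]
    have h1 : ∑' j, (∫⁻ h in annulus a m j, F h ∂ν) ^ r ≤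
        (1 + V : ℝ≥0) ^ r * ∫⁻ h, F h ^ r ∂ν := by
      calc _ ≤ ∑' j, ((1 + V : ℝ≥0) : ℝ≥0∞) ^ r * ∫⁻ h in annulus a m j, F h ^ r ∂ν := by
            refine ENNReal.tsum_le_tsum fun j => ?_
            have h2 := lintegral_mul_rpow_le (ν := ν.restrict (annulus a m j))
              (k := fun _ => 1) measurable_const hF hr
            simp only [one_mul, lintegral_one, Measure.restrict_apply_univ] at h2
            refine h2.trans ?_
            gcongr ?_ * _
            have h3 : (1 : ℝ≥0∞) ≤ (1 + V : ℝ≥0) := by simp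
            calc ν (annulus a m j) ^ (r - 1) ≤ ((1 + V : ℝ≥0) : ℝ≥0∞) ^ (r - 1) := by
                  refine ENNReal.rpow_le_rpow ?_ (by linarith)
                  exact (hV j).trans (by exact_mod_cast le_add_self)
              _ ≤ _ := ENNReal.rpow_le_rpow_of_exponent_le h3 (by linarith)
        _ = ((1 + V : ℝ≥0) : ℝ≥0∞) ^ r * ∫⁻ h in ⋃ j, annulus a m j, F h ^ r ∂ν := by
            rw [ENNReal.tsum_mul_left, lintegral_iUnion (measurableSet_annulus ha)
              pairwise_disjoint_annulus]
        _ ≤ _ := by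
            gcongr
            exact Measure.restrict_le_self
    calc _ ≤ (((1 + V : ℝ≥0) : ℝ≥0∞) ^ r * ∫⁻ h, F h ^ r ∂ν) ^ (1 / r) :=
          ENNReal.rpow_le_rpow h1 (by positivity)
      _ = _ := by
          rw [ENNReal.mul_rpow_of_nonneg _ _ (by positivity), ← ENNReal.rpow_mul,
            mul_one_div_cancel (by linarith), ENNReal.rpow_one]

end Annuli

/-! ### The difference norm is bounded by the Besov norm. -/

section Upper

variable {n : ℕ} {m : Fin n → ℕ} {a : Fin n → ℝ}

theorem diffNorm_congr {s : ℝ} {p q : ℝ≥0∞} {ρ : Space m → ℝ} {g g' : Space m → ℂ}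
    (h : g =ᵐ[volume] g') : diffNorm a s p q ρ g = diffNorm a s p q ρ g' := by
  unfold diffNorm
  rw [wLpNorm_congr h]
  congr 2
  ext v
  rw [wLpNorm_congr (fwdDiff_iter_congr_ae v h _)]

/-- A multiplier acts on functions by convolution. -/
theorem Represents.conv {w : Space m → ℝ} (hw : IsWeight w) {p : ℝ≥0∞} (hp : 1 ≤ p)
    {σ : 𝓢(Space m, ℂ)} (hσ : ∀ ξ, σ (-ξ) = σ ξ) {u u' : 𝓢'(Space m, ℂ)} {g : Space m → ℂ}
    (hgr : Represents g u) (hgm : StronglyMeasurable g) (hgp : wLpNorm w p g < ⊤)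
    (hu : ∀ ψ : 𝓢(Space m, ℂ), u' ψ = u (op σ ψ)) :
    Represents (AnisoBesov.conv (𝓕 σ) g) u' := by
  -- Only the decay of one fixed kernel matters here, so the isotropic exponents `a = 1` at scale
  -- `0` are enough.
  obtain ⟨D, N, hD, hdec⟩ := hw.exists_mul_decay_le (a := fun _ => 1) fun i => zero_le_one
  obtain ⟨I, hI⟩ := exists_lintegral_scaleKernel (fun _ => 1) m
  set d := Module.finrank ℝ (Space m) + 1 with hd
  set S := schwartzNorm (d + N) (𝓕 σ)
  have hS : 0 ≤ S := apply_nonneg _ _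
  have h := represents_kernel hw hw.smooth.continuous.measurable hw.pos hp
    (T := fun x y => 𝓕 σ (x - y))
    ((𝓕 σ).continuous.stronglyMeasurable.comp_measurable (measurable_fst.sub measurable_snd))
    (Φ := fun z => ENNReal.ofReal (2 ^ (d + N) * S * D * scaleKernel (fun _ => 1) 0 z))
    (by
      have := (continuous_scaleKernel (a := fun _ => 1) (m := m) 0).measurable
      fun_prop)
    (Γ := (2 ^ (d + N) * S * D).toNNReal * I) (by
      simp_rw [ENNReal.ofReal_mul (show 0 ≤ 2 ^ (d + N) * S * D by positivity)]
      rw [lintegral_const_mul' _ _ ENNReal.ofReal_ne_top, hI, ENNReal.coe_mul]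
      rfl)
    (fun x y => by
      rw [← ofReal_norm, ← ENNReal.ofReal_mul (hw.pos x).le, ← ENNReal.ofReal_mul (by
        have := scaleKernel_nonneg (a := fun _ => 1) 0 (x - y)
        positivity)]
      refine ENNReal.ofReal_le_ofReal ?_
      have h1 := hdec 0 d x y
      have h2 := norm_apply_le_schwartzNorm (d + N) (𝓕 σ) (x - y)
      rw [Nat.cast_zero, dil_zero] at h1
      have hwx := (hw.pos x).le
      calc _ ≤ w x * (2 ^ (d + N) * S * ((1 + ‖x - y‖) ^ (d + N))⁻¹) := by gcongr
        _ = 2 ^ (d + N) * S * (w x * ((1 + ‖x - y‖) ^ (d + N))⁻¹) := by ring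
        _ ≤ 2 ^ (d + N) * S * (D * w y * ((1 + ‖x - y‖) ^ d)⁻¹) := by gcongr
        _ = _ := by
          rw [scaleKernel, Nat.cast_zero, dil_zero, zero_mul, Real.rpow_zero]; ring)
    hgm hgp (u := u') (fun ψ => by
      rw [hu, (hgr.2 _).2]
      refine integral_congr_ae (Filter.Eventually.of_forall fun y => ?_)
      simp only
      rw [op_apply]
      congr 1
      refine integral_congr_ae (Filter.Eventually.of_forall fun x => ?_)
      simp only
      rw [← fourier_even hσ, neg_sub])
  refine h.2.1.congr (Filter.EventuallyEq.of_eq ?_)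
  ext x
  rw [conv_eq_integral]

/-- A block is reproduced by the convolution with the kernel of the fattened symbol. -/
theorem block_ae_eq_conv (ha : ∀ i, 0 < a i) {φ : Space m → ℝ} {L : 𝓢(Space m, ℂ)}
    (hL : IsLowPass a L)
    (hblock : ∀ (k : ℕ) (f : 𝓢'(Space m, ℂ)) (ψ : 𝓢(Space m, ℂ)),
      block a φ k f ψ = f (op (blockSymbol a L k) ψ))
    {w : Space m → ℝ} (hw : IsWeight w) {p : ℝ≥0∞} (hp : 1 ≤ p) {f : 𝓢'(Space m, ℂ)} {k : ℕ}
    {g : Space m → ℂ} (hgm : StronglyMeasurable g) (hgr : Represents g (block a φ k f))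
    (hgp : wLpNorm w p g < ⊤) : g =ᵐ[volume] conv (𝓕 (fatSymbol a L k)) g :=
  hgr.ae_eq (hgr.conv hw hp (fun ξ => dilSymbol_even _ (hL.fatBase_even k) ξ) hgm hgp fun ψ => by
    rw [hblock, hblock, op_op (υ := blockSymbol a L k) fun ξ => by
      rw [mul_comm]; exact hL.fatSymbol_mul_blockSymbol ha k ξ])

/-- Differences of a block. -/
theorem exists_wLpNorm_fwdDiff_block_le (ha : ∀ i, 1 ≤ a i) {φ : Space m → ℝ} {L : 𝓢(Space m, ℂ)}
    (hL : IsLowPass a L)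
    (hblock : ∀ (k : ℕ) (f : 𝓢'(Space m, ℂ)) (ψ : 𝓢(Space m, ℂ)),
      block a φ k f ψ = f (op (blockSymbol a L k) ψ))
    {w : Space m → ℝ} (hw : IsWeight w) (M : ℕ) :
    ∃ C : ℝ≥0, ∀ (p : ℝ≥0∞), 1 ≤ p → ∀ (f : 𝓢'(Space m, ℂ)) (k : ℕ) (g : Space m → ℂ),
      StronglyMeasurable g → Represents g (block a φ k f) → wLpNorm w p g < ⊤ →
      ∀ (j : ℕ), ∀ h ∈ annulus a m j, wLpNorm w p ((fwdDiff h)^[M] g) ≤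
        C * ENNReal.ofReal (2 ^ (-(M : ℝ) * max ((j : ℝ) - k) 0)) * wLpNorm w p g := by
  have ha0 : ∀ i, 0 < a i := fun i => one_pos.trans_le (ha i)
  obtain ⟨C, r, -, hC⟩ := hw.exists_wLpNorm_conv_le (fun i => (ha0 i).le)
  choose B hB using fun k => exists_norm_fourier_fwdDiff_iter_le ha (fatBase a L k) M r
  have hfat : ∀ k : ℕ, fatBase a L k = fatBase a L (min k 1) := fun k => by
    rcases k with _ | k <;> simp [fatBase]
  obtain ⟨D, hD1, hD⟩ := hw.exists_wLpNorm_fwdDiff_iter_le n M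
  refine ⟨C * (B 0 + B 1) + D, fun p hp f k g hgm hgr hgp j h hh => ?_⟩
  have hh1 := anorm_le_one_of_mem_annulus hh
  rcases le_or_gt k j with hkj | hkj
  -- Step shorter than the scale of the block: the differences fall on the reproducing kernel and
  -- gain `(2^k |h|_a)^M ≤ 2^{-M(j-k)}`.
  · have hmax : max ((j : ℝ) - k) 0 = (j : ℝ) - k := max_eq_left (by simpa using hkj)
    rw [hmax]
    have hsm : 2 ^ (k : ℝ) * anorm a h ≤ 2 ^ (-((j : ℝ) - k)) := by
      calc _ ≤ (2 : ℝ) ^ (k : ℝ) * 2 ^ (-(j : ℝ)) := by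
            gcongr
            exact hh.2
        _ = _ := by rw [← Real.rpow_add (by norm_num)]; congr 1; ring
    have hsm1 : 2 ^ (k : ℝ) * anorm a h ≤ 1 :=
      hsm.trans (Real.rpow_le_one_of_one_le_of_nonpos one_le_two (by
        have : (k : ℝ) ≤ j := by exact_mod_cast hkj
        linarith))
    have e := block_ae_eq_conv ha0 hL hblock hw hp hgm hgr hgp
    rw [wLpNorm_congr (fwdDiff_iter_congr_ae h e M), fwdDiff_iter_conv' hgr.isConvolvable]
    set δ : ℝ≥0 := ⟨(2 ^ (k : ℝ) * anorm a h) ^ M,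
      pow_nonneg (mul_nonneg (by positivity) (anorm_nonneg a h)) M⟩ with hδ
    have h1 := hC k (B (min k 1) * δ) ((schwartzDiff h)^[M] (𝓕 (fatSymbol a L k)))
      (fun z => by
        rw [fatSymbol, hfat]
        exact hB (min k 1) k h hsm1 z) p hp g hgm
    refine h1.trans ?_
    gcongr ?_ * _
    rw [ENNReal.coe_mul, ← mul_assoc]
    refine mul_le_mul' ?_ ?_
    · rw [← ENNReal.coe_mul, ENNReal.coe_le_coe]
      have : B (min k 1) ≤ B 0 + B 1 := by
        rcases k with _ | k <;> simp
      exact (mul_le_mul_right this C).trans le_self_add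
    · rw [← ENNReal.ofReal_coe_nnreal]
      refine ENNReal.ofReal_le_ofReal ?_
      change (2 ^ (k : ℝ) * anorm a h) ^ M ≤ _
      calc _ ≤ ((2 : ℝ) ^ (-((j : ℝ) - k))) ^ M :=
            pow_le_pow_left₀ (mul_nonneg (by positivity) (anorm_nonneg a h)) hsm M
        _ = _ := by rw [← Real.rpow_natCast, ← Real.rpow_mul (by norm_num)]; congr 1; ring
  -- Step longer than the scale of the block: differences are merely bounded on `L^p(w)`.
  · have hmax : max ((j : ℝ) - k) 0 = 0 := max_eq_right (by
      have : (j : ℝ) ≤ k := by exact_mod_cast hkj.le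
      linarith)
    rw [hmax, mul_zero, Real.rpow_zero, ENNReal.ofReal_one, mul_one]
    have hn : ‖h‖ ≤ n := (norm_le_mul_anorm ha hh1).trans
      (mul_le_of_le_one_right n.cast_nonneg hh1)
    refine (hD h hn p hp g hgm.aestronglyMeasurable).2.trans ?_
    gcongr
    exact le_add_self

theorem fwdDiff_zero_iter {g : Space m → ℂ} {M : ℕ} (hM : M ≠ 0) :
    (fwdDiff (0 : Space m))^[M] g = 0 := by
  obtain ⟨M, rfl⟩ := Nat.exists_eq_succ_of_ne_zero hM
  rw [Function.iterate_succ_apply']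
  ext x
  simp [fwdDiff]

/-- A Besov distribution is a function, whose difference norm is controlled. -/
theorem exists_diffNorm_le (ha : ∀ i, 1 ≤ a i) {φ : Space m → ℝ} (hφ : IsCutoff a φ)
    {w : Space m → ℝ} (hw : IsWeight w) {s : ℝ} (hs : 0 < s) :
    ∃ C : ℝ≥0, ∀ p q : ℝ≥0∞, 1 ≤ p → 1 ≤ q → ∀ f : 𝓢'(Space m, ℂ),
      besovNorm a φ s p q w f < ⊤ → (∃ g, Represents g f) ∧
        ∀ g, Represents g f → diffNorm a s p q w g ≤ C * besovNorm a φ s p q w f := by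
  have ha0 : ∀ i, 0 < a i := fun i => one_pos.trans_le (ha i)
  obtain ⟨L, hL, hblock⟩ := hφ.exists_isLowPass ha0
  set M := ⌊s⌋₊ + 1 with hM
  have hsM : s < M := by rw [hM]; push_cast; exact Nat.lt_floor_add_one s
  obtain ⟨B, hB⟩ := exists_wLpNorm_fwdDiff_block_le ha hL hblock hw M
  obtain ⟨V, hV1, hV⟩ := exists_eLpNorm_incrementMeasure_le (m := m) ha0
  -- For `k ≥ j` the decay rate is `s`, for `k ≤ j` it is `M - s`; both are positive.
  obtain ⟨Γ, hΓ⟩ := exists_eLpNorm_tsum_geometric_le (ε := min s (M - s))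
    (lt_min hs (by linarith))
  obtain ⟨Λ, hΛ⟩ := exists_eLpNorm_tsum_geometric_le hs
  -- One factor `2^s` comes from the index shift `k - 1` in the Besov norm, the other from the inner
  -- edge `2^{-(j+1)}` of the annulus. Only the first one enters `E'`.
  set E : ℝ≥0 := ((2 : ℝ) ^ (2 * s)).toNNReal
  set E' : ℝ≥0 := ((2 : ℝ) ^ s).toNNReal
  refine ⟨V * (B * E * Γ) + E' * Λ, fun p q hp hq f hf => ?_⟩
  have hq0 : q ≠ 0 := (one_pos.trans_le hq).ne'
  set b : ℕ → ℝ≥0∞ := fun k => ENNReal.ofReal ((2 : ℝ) ^ (s * ((k : ℝ) - 1))) *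
    distWLpNorm w p (block a φ k f) with hb
  have hbn : eLpNorm b q Measure.count = besovNorm a φ s p q w f := rfl
  have hfin : ∀ k, distWLpNorm w p (block a φ k f) < ⊤ := fun k => by
    have h1 := (enorm_le_eLpNorm_count b k hq0).trans_lt hf
    rw [enorm_eq_self] at h1
    refine lt_top_iff_ne_top.2 fun h2 => ?_
    simp only [hb, h2] at h1
    rw [ENNReal.mul_top (ENNReal.ofReal_pos.2 (by positivity)).ne'] at h1
    exact lt_irrefl _ h1
  choose g hgm hgr hgn using fun k => exists_represents_of_lt_top (hfin k)
  have hgb : ∀ k, wLpNorm w p (g k) = ENNReal.ofReal (2 ^ (-(s * ((k : ℝ) - 1)))) * b k :=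
    fun k => by
      rw [hgn, hb, ← mul_assoc, ← ENNReal.ofReal_mul (by positivity),
        ← Real.rpow_add (by norm_num)]
      simp
  -- Absolute convergence in `L^p(w)` is the entry `j = 0` of the discrete Schur bound with rate
  -- `s`.
  have hsumle : ∑' k, wLpNorm w p (g k) ≤ E' * Λ * besovNorm a φ s p q w f := by
    calc ∑' k, wLpNorm w p (g k) = E' * ∑' k : ℕ, ENNReal.ofReal
          ((2 : ℝ) ^ (-s * |((0 : ℕ) : ℝ) - k|)) * b k := by
          rw [← ENNReal.tsum_mul_left]
          refine tsum_congr fun k => ?_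
          have e : ENNReal.ofReal ((2 : ℝ) ^ (-(s * ((k : ℝ) - 1)))) =
              E' * ENNReal.ofReal ((2 : ℝ) ^ (-s * |((0 : ℕ) : ℝ) - k|)) := by
            change _ = ENNReal.ofReal _ * _
            rw [← ENNReal.ofReal_mul (by positivity), ← Real.rpow_add (by norm_num)]
            congr 2
            rw [Nat.cast_zero, zero_sub, abs_neg, abs_of_nonneg k.cast_nonneg]
            ring
          rw [hgb, e, mul_assoc]
      _ ≤ E' * (Λ * besovNorm a φ s p q w f) := by
          gcongr
          rw [← hbn]
          refine le_trans ?_ (hΛ q hq b)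
          have := enorm_le_eLpNorm_count (fun j : ℕ => ∑' k : ℕ, ENNReal.ofReal
            ((2 : ℝ) ^ (-s * |(j : ℝ) - k|)) * b k) 0 hq0
          rwa [enorm_eq_self] at this
      _ = _ := by rw [mul_assoc]
  have hsum : ∑' k, wLpNorm w p (g k) < ⊤ :=
    hsumle.trans_lt (ENNReal.mul_lt_top (by simp [ENNReal.mul_lt_top]) hf)
  obtain ⟨G, hGm, hGr, hGn, hGs⟩ := represents_tsum hw hp hgm hsum (u := f) (fun ψ => by
    have h1 := ((ContinuousLinearMap.continuous f).tendsto ψ).comp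
      (tendsto_sum_op_blockSymbol ha hL ψ)
    refine h1.congr fun K => ?_
    refine (tempered_map_sum f _ _).trans ?_
    refine Finset.sum_congr rfl fun k _ => ?_
    rw [← ((hgr k).2 ψ).2, hblock])
  refine ⟨⟨G, hGr⟩, fun g' hg' => ?_⟩
  rw [diffNorm_congr (hg'.ae_eq hGr), diffNorm]
  rw [ENNReal.coe_add, add_mul]
  refine add_le_add ?_ (hGn.trans (by rw [ENNReal.coe_mul]; exact hsumle))
  set c : ℕ → ℝ≥0∞ := fun j => ((B * E : ℝ≥0) : ℝ≥0∞) * ∑' k : ℕ, ENNReal.ofReal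
    ((2 : ℝ) ^ (-(min s (M - s)) * |(j : ℝ) - k|)) * b k with hc
  have hcn : eLpNorm c q Measure.count ≤ (B * E * Γ : ℝ≥0) * besovNorm a φ s p q w f := by
    refine (eLpNorm_const_mul_ennreal _ _ _).trans ?_
    rw [ENNReal.coe_mul (B * E) Γ, mul_assoc]
    gcongr
    exact hΓ q hq b
  refine (hV q hq _ c ?_ ?_).trans ?_
  -- At `h = 0` the quotient has zero numerator and so equals `0` in `[0, ∞]`, whatever the
  -- denominator.
  · rw [fwdDiff_zero_iter (by omega)]
    simp [wLpNorm]
  · intro j h hh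
    have hpos := anorm_pos_of_mem_annulus hh
    refine ENNReal.div_le_of_le_mul ?_
    have h1 : wLpNorm w p ((fwdDiff h)^[M] G) ≤ ∑' k, wLpNorm w p ((fwdDiff h)^[M] (g k)) := by
      simp only [wLpNorm_eq hw.pos]
      refine le_trans ?_ (eLpNorm_tsum_le (fun k => ?_) hp)
      · refine eLpNorm_mono_enorm_ae ?_
        filter_upwards [hasSum_fwdDiff_iter_ae h hGs M] with x hx
        simp only [enorm_eq_self, ENNReal.tsum_mul_left]
        gcongr
        rw [← hx.tsum_eq]
        exact enorm_tsum_le_tsum_enorm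
      · have := (stronglyMeasurable_fwdDiff_iter_right (hgm k) M h).enorm
        have h2 := hw.smooth.continuous.measurable
        fun_prop
    refine h1.trans ?_
    simp only [hc]
    rw [← ENNReal.tsum_mul_left, ← ENNReal.tsum_mul_right]
    refine ENNReal.tsum_le_tsum fun k => ?_
    refine (hB p hp f k (g k) (hgm k) (hgr k) (by rw [hgn]; exact hfin k) j h hh).trans ?_
    rw [hgb]
    have h3 : (2 : ℝ) ^ (-(M : ℝ) * max ((j : ℝ) - k) 0) * 2 ^ (-(s * ((k : ℝ) - 1))) ≤
        2 ^ (2 * s) * 2 ^ (-(min s (M - s)) * |(j : ℝ) - k|) * anorm a h ^ s := by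
      calc _ ≤ (2 : ℝ) ^ (2 * s) * 2 ^ (-(min s (M - s)) * |(j : ℝ) - k|) *
            (2 ^ (-((j : ℝ) + 1))) ^ s := by
            rw [← Real.rpow_mul (by norm_num), ← Real.rpow_add (by norm_num),
              ← Real.rpow_add (by norm_num), ← Real.rpow_add (by norm_num)]
            refine Real.rpow_le_rpow_of_exponent_le one_le_two ?_
            rcases le_total (k : ℝ) j with hkj | hkj
            · rw [max_eq_left (by linarith), abs_of_nonneg (by linarith)]
              have : min s (M - s) ≤ M - s := min_le_right _ _
              nlinarith
            · rw [max_eq_right (by linarith), abs_of_nonpos (by linarith)]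
              have : min s (M - s) ≤ s := min_le_left _ _
              nlinarith
        _ ≤ _ := by
            gcongr
            exact hh.1.le
    calc _ = B * ENNReal.ofReal ((2 : ℝ) ^ (-(M : ℝ) * max ((j : ℝ) - k) 0) *
            2 ^ (-(s * ((k : ℝ) - 1)))) * b k := by
            rw [ENNReal.ofReal_mul (by positivity)]; ring
      _ ≤ B * ENNReal.ofReal (2 ^ (2 * s) * 2 ^ (-(min s (M - s)) * |(j : ℝ) - k|) *
            anorm a h ^ s) * b k := by gcongr
      _ = _ := by
          rw [ENNReal.ofReal_mul (by positivity), ENNReal.ofReal_mul (by positivity),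
            ENNReal.coe_mul]
          change _ = B * ENNReal.ofReal _ * _ * _
          ring
  · calc _ ≤ V * ((B * E * Γ : ℝ≥0) * besovNorm a φ s p q w f) := by gcongr
      _ = _ := by
        rw [ENNReal.coe_mul V]
        exact (mul_assoc _ _ _).symm

end Upper

/-! ### The averaged centred difference as a multiplier. -/

section DifferenceSymbol

variable {n : ℕ} {m : Fin n → ℕ} {a : Fin n → ℝ}

/-- The coefficients of the difference of order `2M`. -/
def diffCoeff (M l : ℕ) : ℤ := (-1) ^ (2 * M - l) * (2 * M).choose l

/-- The symbol of the mean over the annulus of index `0` of the centred differences of order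
`2M`. -/
def diffSymbol (a : Fin n → ℝ) (M : ℕ) (ξ : Space m) : ℂ :=
  ∑ l ∈ Finset.range (2 * M + 1), (diffCoeff M l : ℂ) *
    ∫ h in annulus a m 0, Complex.exp (((-2 * Real.pi * (((l : ℝ) - M) * inner ℝ h ξ) : ℝ) : ℂ) *
      Complex.I)

theorem integrable_pow_mul_indicator_annulus (ha : ∀ i, 1 ≤ a i) (k : ℕ) :
    Integrable (fun h : Space m => ‖h‖ ^ k * ‖(annulus a m 0).indicator (fun _ => (1 : ℂ)) h‖)
      volume := by
  have ha0 : ∀ i, 0 < a i := fun i => one_pos.trans_le (ha i)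
  have h1 : IntegrableOn (fun _ : Space m => (n : ℝ) ^ k) (annulus a m 0) volume :=
    integrableOn_const (volume_annulus_zero_lt_top ha0).ne
  rw [← integrable_indicator_iff (measurableSet_annulus ha0 0)] at h1
  refine h1.mono' ?_ (Filter.Eventually.of_forall fun h => ?_)
  · exact (continuous_norm.pow k).aestronglyMeasurable.mul
      (aestronglyMeasurable_const.indicator (measurableSet_annulus ha0 0)).norm
  · by_cases hh : h ∈ annulus a m 0
    · have hh1 := anorm_le_one_of_mem_annulus hh
      have hn : ‖h‖ ≤ n := (norm_le_mul_anorm ha hh1).trans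
        (mul_le_of_le_one_right n.cast_nonneg hh1)
      simp only [Set.indicator_of_mem hh, norm_one, mul_one, norm_pow, norm_norm]
      gcongr
    · simp [Set.indicator_of_notMem hh]

/-- Each summand is the Fourier transform of the indicator of the annulus at a multiple of `ξ`, and
is smooth because all moments of a bounded set are finite. -/
theorem contDiff_diffSymbol (ha : ∀ i, 1 ≤ a i) (M : ℕ) :
    ContDiff ℝ ∞ (diffSymbol a M : Space m → ℂ) := by
  have ha0 : ∀ i, 0 < a i := fun i => one_pos.trans_le (ha i)
  have h1 : ContDiff ℝ ∞ (𝓕 ((annulus a m 0).indicator fun _ => (1 : ℂ)) : Space m → ℂ) :=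
    Real.contDiff_fourier (N := ⊤) fun k _ => integrable_pow_mul_indicator_annulus ha k
  refine ContDiff.sum fun l _ => contDiff_const.mul ?_
  have h2 := h1.comp (contDiff_id.const_smul ((l : ℝ) - M))
  refine (congrArg (ContDiff ℝ ∞) (funext fun ξ => ?_)).mpr h2
  rw [Function.comp_apply, Real.fourier_eq', ← integral_indicator (measurableSet_annulus ha0 0)]
  refine integral_congr_ae (Filter.Eventually.of_forall fun h => ?_)
  simp only [id, inner_smul_right]
  by_cases hh : h ∈ annulus a m 0
  · simp [Set.indicator_of_mem hh]
  · simp [Set.indicator_of_notMem hh]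

theorem integrableOn_annulus_of_continuous (ha : ∀ i, 0 < a i) {F : Type*} [NormedAddCommGroup F]
    {f : Space m → F} (hf : Continuous f) : IntegrableOn f (annulus a m 0) volume :=
  (hf.continuousOn.integrableOn_compact (isCompact_anorm_le ha 1)).mono_set
    fun _ hh => anorm_le_one_of_mem_annulus hh

/-- With `z = exp(-2πiθ)` the sum is `z^{-M} (z - 1)^{2M} = (z + z⁻¹ - 2)^M`. The even order and the
centring make the symbol real and of constant sign. -/
theorem sum_diffCoeff_exp (M : ℕ) (θ : ℝ) :
    ∑ l ∈ Finset.range (2 * M + 1), (diffCoeff M l : ℂ) *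
      Complex.exp (((-2 * Real.pi * (((l : ℝ) - M) * θ) : ℝ) : ℂ) * Complex.I) =
      (((2 * Real.cos (2 * Real.pi * θ) - 2) ^ M : ℝ) : ℂ) := by
  set z := Complex.exp (((-2 * Real.pi * θ : ℝ) : ℂ) * Complex.I) with hz
  have hz0 : z ≠ 0 := Complex.exp_ne_zero _
  have e1 : ∀ l : ℕ, Complex.exp (((-2 * Real.pi * (((l : ℝ) - M) * θ) : ℝ) : ℂ) * Complex.I) =
      z ^ l * (z ^ M)⁻¹ := fun l => by
    rw [hz, ← Complex.exp_nat_mul, ← Complex.exp_nat_mul, ← Complex.exp_neg, ← Complex.exp_add]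
    congr 1
    push_cast
    ring
  have e2 : z + z⁻¹ = ((2 * Real.cos (2 * Real.pi * θ) : ℝ) : ℂ) := by
    rw [hz, ← Complex.exp_neg]
    have := Complex.two_cos ((2 * Real.pi * θ : ℝ) : ℂ)
    push_cast at this ⊢
    rw [this, add_comm]
    congr 2 <;> ring
  have e3 : (z - 1) ^ (2 * M) = ∑ l ∈ Finset.range (2 * M + 1), (diffCoeff M l : ℂ) * z ^ l := by
    rw [sub_eq_add_neg, add_pow]
    refine Finset.sum_congr rfl fun l _ => ?_
    rw [diffCoeff]
    push_cast
    ring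
  simp_rw [e1, ← mul_assoc]
  rw [← Finset.sum_mul, ← e3, pow_mul, ← inv_pow, ← mul_pow]
  rw [Complex.ofReal_pow, Complex.ofReal_sub, ← e2]
  congr 1
  field_simp
  push_cast
  ring

theorem diffSymbol_eq (ha : ∀ i, 0 < a i) (M : ℕ) (ξ : Space m) :
    diffSymbol a M ξ = ((∫ h in annulus a m 0,
      (2 * Real.cos (2 * Real.pi * inner ℝ h ξ) - 2) ^ M : ℝ) : ℂ) := by
  rw [← integral_complex_ofReal, diffSymbol]
  simp_rw [← sum_diffCoeff_exp, ← integral_const_mul]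
  rw [integral_finsetSum]
  intro l _
  exact integrableOn_annulus_of_continuous ha (by fun_prop)

/-- Up to the sign `(-1)^M` the integrand is nonnegative, so it suffices to find one point in the
interior of the annulus where the cosine is not `1`. The candidate is a dilate `h0` of `ξ`, whose
inner product with `ξ` is the square of the norm of a half-way dilate, hence nonzero. If the cosine
is `1` at `h0`, a slight stretching of `h0` changes this. -/
theorem diffSymbol_ne_zero (ha : ∀ i, 0 < a i) (M : ℕ) {ξ : Space m} (hξ : ξ ≠ 0) :
    diffSymbol a M ξ ≠ 0 := by
  rw [diffSymbol_eq ha, Complex.ofReal_ne_zero]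
  set f : Space m → ℝ := fun h => (2 - 2 * Real.cos (2 * Real.pi * inner ℝ h ξ)) ^ M with hf
  have hfc : Continuous f := by fun_prop
  have e : ∀ h : Space m, (2 * Real.cos (2 * Real.pi * inner ℝ h ξ) - 2) ^ M = (-1) ^ M * f h :=
    fun h => by rw [hf, ← mul_pow]; congr 1; ring
  simp_rw [e]
  rw [integral_const_mul]
  refine mul_ne_zero (by simp) (ne_of_gt ?_)
  have hf0 : ∀ h, 0 ≤ f h := fun h => by
    have := Real.cos_le_one (2 * Real.pi * inner ℝ h ξ)
    exact pow_nonneg (by linarith) M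
  rw [setIntegral_pos_iff_support_of_nonneg_ae (Filter.Eventually.of_forall hf0)
    (integrableOn_annulus_of_continuous ha hfc)]
  set U : Set (Space m) := {h | 1 / 2 < anorm a h ∧ anorm a h < 1 ∧
    Real.cos (2 * Real.pi * inner ℝ h ξ) < 1} with hU
  have hUo : IsOpen U := by
    have h1 := continuous_anorm (m := m) ha
    refine (isOpen_lt continuous_const h1).inter ((isOpen_lt h1 continuous_const).inter
      (isOpen_lt
        (f := fun h : Space m => Real.cos (2 * Real.pi * inner ℝ h ξ)) (by fun_prop)
        continuous_const))
  have hUs : U ⊆ Function.support f ∩ annulus a m 0 := by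
    rintro h ⟨h1, h2, h3⟩
    refine ⟨(pow_pos (by linarith) M).ne', ?_, ?_⟩
    · rw [Nat.cast_zero, zero_add, Real.rpow_neg_one]; linarith
    · rw [Nat.cast_zero, neg_zero, Real.rpow_zero]; exact h2.le
  refine lt_of_lt_of_le (hUo.measure_pos volume ?_) (measure_mono hUs)
  have hξ0 : 0 < anorm a ξ :=
    (anorm_nonneg a ξ).lt_of_ne fun e => hξ ((anorm_eq_zero_iff ha).1 e.symm)
  -- Chosen so that the dilate has modulus `3/4`, strictly between `1/2` and `1`.
  set t := Real.logb 2 (3 / 4 / anorm a ξ) with ht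
  set h0 : Space m := dil a t ξ with hh0
  have hn0 : anorm a h0 = 3 / 4 := by
    rw [hh0, anorm_dil ha, ht, Real.rpow_logb (by norm_num) (by norm_num) (by positivity)]
    field_simp
  have hc : inner ℝ h0 ξ ≠ 0 := by
    have hh : h0 = dil a (t / 2) (dil a (t / 2) ξ) := by rw [dil_dil, add_halves]
    rw [hh, inner_dil, real_inner_self_eq_norm_sq]
    have : dil a (t / 2) ξ ≠ 0 := by simpa using hξ
    exact pow_ne_zero 2 (norm_ne_zero_iff.2 this)
  set c := inner ℝ h0 ξ
  by_cases hcos : Real.cos (2 * Real.pi * c) < 1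
  · exact ⟨h0, by rw [hn0]; norm_num, by rw [hn0]; norm_num, hcos⟩
  have hcos1 : Real.cos (2 * Real.pi * c) = 1 := le_antisymm (Real.cos_le_one _) (not_lt.1 hcos)
  obtain ⟨N, hN⟩ := (Real.cos_eq_one_iff _).1 hcos1
  have hcont : Continuous fun δ : ℝ => anorm a ((1 + δ) • h0) :=
    (continuous_anorm ha).comp (by fun_prop)
  have hev : ∀ᶠ δ in nhds (0 : ℝ), anorm a ((1 + δ) • h0) ∈ Set.Ioo (1 / 2 : ℝ) 1 := by
    refine hcont.continuousAt.eventually (isOpen_Ioo.mem_nhds ?_)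
    simp only [add_zero, one_smul, hn0]
    norm_num
  have hev2 : ∀ᶠ δ in nhds (0 : ℝ), 2 * Real.pi * (δ * c) ∈ Set.Ioo (-(2 * Real.pi))
      (2 * Real.pi) := by
    have h1 : Continuous fun δ : ℝ => 2 * Real.pi * (δ * c) := by fun_prop
    refine h1.continuousAt.eventually (isOpen_Ioo.mem_nhds ?_)
    simp [Real.pi_pos]
  obtain ⟨δ, ⟨h1, h2⟩, hδ⟩ :=
    (((hev.and hev2).filter_mono nhdsWithin_le_nhds).and
      (self_mem_nhdsWithin : {0}ᶜ ∈ nhdsWithin (0 : ℝ) {0}ᶜ)).exists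
  refine ⟨(1 + δ) • h0, h1.1, h1.2, lt_of_le_of_ne (Real.cos_le_one _) fun h3 => ?_⟩
  rw [real_inner_smul_left] at h3
  have e4 : 2 * Real.pi * ((1 + δ) * c) = 2 * Real.pi * (δ * c) + N * (2 * Real.pi) := by
    rw [hN]; ring
  change Real.cos (2 * Real.pi * ((1 + δ) * c)) = 1 at h3
  rw [e4, Real.cos_add_int_mul_two_pi, Real.cos_eq_one_iff_of_lt_of_lt h2.1 h2.2] at h3
  have hpi := Real.pi_ne_zero
  have hδ0 : δ ≠ 0 := hδ
  simp [hpi, hδ0, hc] at h3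

/-- The symbol of the blocks of positive index is a multiple of the symbol of the differences. -/
theorem IsLowPass.exists_mul_diffSymbol_eq (ha : ∀ i, 1 ≤ a i) {L : 𝓢(Space m, ℂ)}
    (hL : IsLowPass a L) (M : ℕ) :
    ∃ χ : 𝓢(Space m, ℂ), ∀ ξ, χ ξ * diffSymbol a M ξ = blockBase a L 1 ξ := by
  have ha0 : ∀ i, 0 < a i := fun i => one_pos.trans_le (ha i)
  set τ := blockBase a L 1 with hτ
  obtain ⟨c, hc, hc0⟩ := hL.vanishesNearZero_blockBase ha one_ne_zero
  have hτs : ContDiff ℝ ∞ τ := τ.smooth ⊤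
  have hsupp : HasCompactSupport τ := by
    have hK := (isCompact_anorm_le (m := m) ha0 (2 / 3)).image
      (f := fun ξ => (2 * Real.pi)⁻¹ • ξ) (by fun_prop)
    refine HasCompactSupport.of_support_subset_isCompact hK fun ξ hξ => ?_
    have hpi : (2 * Real.pi) ≠ 0 := by have := Real.pi_pos; positivity
    refine ⟨(2 * Real.pi) • ξ, ?_, by simp only [smul_smul, inv_mul_cancel₀ hpi, one_smul]⟩
    change anorm a ((2 * Real.pi) • ξ) ≤ 2 / 3
    by_contra hcon
    push Not at hcon
    refine hξ ?_
    simp only [hτ, blockBase, one_ne_zero, if_false, sub_apply, dilSymbol_apply]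
    rw [hL.eq_zero ξ hcon, hL.eq_zero, sub_zero]
    rw [anorm_smul_dil ha0, neg_neg, Real.rpow_one]
    linarith
  have hdsm := contDiff_diffSymbol (m := m) ha M
  -- The only zero of the denominator is the origin, near which `τ` vanishes identically.
  have hsm : ContDiff ℝ ∞ fun ξ => τ ξ * (diffSymbol a M ξ)⁻¹ := by
    refine contDiff_iff_contDiffAt.2 fun ξ => ?_
    rcases eq_or_ne ξ 0 with rfl | hξ
    · have hev : (fun ξ => τ ξ * (diffSymbol a M ξ)⁻¹) =ᶠ[nhds 0] fun _ => 0 := by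
        have h1 : ∀ᶠ ξ : Space m in nhds 0, anorm a ξ < c :=
          (continuous_anorm ha0).continuousAt.eventually (gt_mem_nhds (by
            rw [(anorm_eq_zero_iff ha0).2 rfl]; exact hc))
        filter_upwards [h1] with ξ hξ
        rw [hc0 ξ hξ, zero_mul]
      exact contDiffAt_const.congr_of_eventuallyEq hev
    · exact hτs.contDiffAt.mul (hdsm.contDiffAt.inv (diffSymbol_ne_zero ha0 M hξ))
  have hcs : HasCompactSupport fun ξ => τ ξ * (diffSymbol a M ξ)⁻¹ := hsupp.mul_right
  refine ⟨hcs.toSchwartzMap hsm, fun ξ => ?_⟩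
  change τ ξ * (diffSymbol a M ξ)⁻¹ * diffSymbol a M ξ = _
  rcases eq_or_ne ξ 0 with rfl | hξ
  · rw [hc0 0 (by rw [(anorm_eq_zero_iff ha0).2 rfl]; exact hc)]
    simp
  · rw [mul_assoc, inv_mul_cancel₀ (diffSymbol_ne_zero ha0 M hξ), mul_one]

/-- On the Fourier side each phase in `diffSymbol` translates `𝓕 χ`; Fubini exchanges the mean over
`h` with the frequency integral. -/
theorem fourier_eq_sum_integral_annulus (ha : ∀ i, 0 < a i) {χ τ : 𝓢(Space m, ℂ)} {M : ℕ}
    (hχ : ∀ ξ, χ ξ * diffSymbol a M ξ = τ ξ) (z : Space m) :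
    𝓕 τ z = ∑ l ∈ Finset.range (2 * M + 1), (diffCoeff M l : ℂ) *
      ∫ h in annulus a m 0, 𝓕 χ (z + ((l : ℝ) - M) • h) := by
  have hfin : IsFiniteMeasure (volume.restrict (annulus a m 0)) :=
    ⟨by rw [Measure.restrict_apply_univ]; exact volume_annulus_zero_lt_top ha⟩
  set F : ℕ → Space m → Space m → ℂ := fun l h ξ =>
    Complex.exp (((-2 * Real.pi * inner ℝ ξ z : ℝ) : ℂ) * Complex.I) *
    (χ ξ * Complex.exp (((-2 * Real.pi * (((l : ℝ) - M) * inner ℝ h ξ) : ℝ) : ℂ) * Complex.I))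
    with hF
  have hFi : ∀ l, Integrable (Function.uncurry (F l))
      ((volume.restrict (annulus a m 0)).prod volume) := fun l => by
    have h1 : Integrable (fun q : Space m × Space m => ‖χ q.2‖)
        ((volume.restrict (annulus a m 0)).prod volume) := χ.integrable.norm.comp_snd _
    refine h1.mono' ?_ (Filter.Eventually.of_forall fun q => ?_)
    · have := χ.continuous
      refine Continuous.aestronglyMeasurable ?_
      simp only [hF, Function.uncurry_def]
      fun_prop
    · simp only [hF, Function.uncurry_def, norm_mul, Complex.norm_exp_ofReal_mul_I, one_mul,
        mul_one, le_refl]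
  have e1 : ∀ (l : ℕ) (h : Space m), 𝓕 χ (z + ((l : ℝ) - M) • h) = ∫ ξ, F l h ξ := fun l h => by
    rw [fourier_coe, Real.fourier_eq']
    refine integral_congr_ae (Filter.Eventually.of_forall fun ξ => ?_)
    simp only [hF, smul_eq_mul]
    rw [mul_comm (χ ξ), ← mul_assoc, ← Complex.exp_add, inner_add_right, inner_smul_right,
      real_inner_comm h ξ]
    congr 2
    push_cast
    ring
  simp_rw [e1]
  have e2 : ∀ l, ∫ h in annulus a m 0, ∫ ξ, F l h ξ = ∫ ξ, ∫ h in annulus a m 0, F l h ξ :=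
    fun l => integral_integral_swap (hFi l)
  simp_rw [e2]
  rw [Finset.sum_congr rfl fun l _ => (integral_const_mul _ _).symm, ← integral_finsetSum]
  · rw [fourier_coe, Real.fourier_eq']
    refine integral_congr_ae (Filter.Eventually.of_forall fun ξ => ?_)
    simp only [hF, smul_eq_mul]
    rw [← hχ, diffSymbol, Finset.mul_sum, Finset.mul_sum]
    refine Finset.sum_congr rfl fun l _ => ?_
    simp_rw [integral_const_mul]
    ring
  · intro l _
    exact ((hFi l).integral_prod_right).const_mul _

theorem fourier_dilSymbol_eq_sum_integral_annulus (ha : ∀ i, 0 < a i) {χ τ : 𝓢(Space m, ℂ)}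
    {M : ℕ} (hχ : ∀ ξ, χ ξ * diffSymbol a M ξ = τ ξ) (k : ℕ) (z : Space m) :
    𝓕 (dilSymbol a k τ) z = ∑ l ∈ Finset.range (2 * M + 1), (diffCoeff M l : ℂ) *
      ∫ h in annulus a m 0, 𝓕 (dilSymbol a k χ) (z + ((l : ℝ) - M) • dil a (-(k : ℝ)) h) := by
  simp_rw [fourier_dilSymbol, map_add, map_smul, dil_dil, add_neg_cancel, dil_zero,
    integral_const_mul]
  rw [fourier_eq_sum_integral_annulus ha hχ, Finset.mul_sum]
  refine Finset.sum_congr rfl fun l _ => ?_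
  ring

end DifferenceSymbol

/-! ### The Besov norm is bounded by the difference norm. -/

section Lower

variable {n : ℕ} {m : Fin n → ℕ} {a : Fin n → ℝ}

/-- Supplies the majorant for Fubini in `conv_fourier_dilSymbol_eq`. Part of the decay moves the
weight to the fixed point `x`; the rest is bounded and integrable, so it pairs with `L^p`. -/
theorem IsWeight.exists_integrable_decay_mul {w : Space m → ℝ} (hw : IsWeight w) :
    ∃ r : ℕ, ∀ p : ℝ≥0∞, 1 ≤ p → ∀ g : Space m → ℂ, StronglyMeasurable g → wLpNorm w p g < ⊤ →
      ∀ x : Space m, Integrable (fun z => ((1 + ‖z‖) ^ r)⁻¹ * ‖g (x - z)‖) volume := by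
  obtain ⟨D, N, hD, hdec⟩ := hw.exists_mul_decay_le (a := fun _ => 1) fun i => zero_le_one
  set d := Module.finrank ℝ (Space m) + 1 with hd
  refine ⟨d + N, fun p hp g hgm hgp x => ?_⟩
  have hint : Integrable (fun y : Space m => ((1 + ‖x - y‖) ^ (d + N))⁻¹ * ‖g y‖) volume := by
    have hcont : ∀ r : ℕ, Continuous fun y : Space m => ((1 + ‖x - y‖) ^ r)⁻¹ := fun r =>
      Continuous.inv₀ (by fun_prop) fun y => by positivity
    refine ⟨(hcont _).aestronglyMeasurable.mul hgm.norm.aestronglyMeasurable, ?_⟩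
    have h0 := integrable_one_add_norm (E := Space m) (μ := volume)
      (r := (d : ℕ)) (by rw [hd]; push_cast; linarith)
    have h1 : Integrable (fun y : Space m => ((1 + ‖x - y‖) ^ d)⁻¹) volume := by
      refine (h0.comp_sub_left x).congr (Filter.Eventually.of_forall fun y => ?_)
      simp only
      rw [Real.rpow_neg (by positivity), Real.rpow_natCast]
    have hwm : Measurable fun y => ENNReal.ofReal (w y) :=
      hw.smooth.continuous.measurable.ennreal_ofReal
    rw [wLpNorm_eq hw.pos] at hgp
    have h2 := lintegral_mul_lt_top_of_eLpNorm_lt_top (μ := volume)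
      (f := fun y => ENNReal.ofReal ((1 + ‖x - y‖) ^ d)⁻¹) (hcont d).measurable.ennreal_ofReal
      (G := fun y => ENNReal.ofReal (w y) * ‖g y‖ₑ) (hwm.mul hgm.enorm)
      (h1.lintegral_lt_top) (B := 1) ENNReal.one_lt_top (fun y => by
        rw [← ENNReal.ofReal_one]
        refine ENNReal.ofReal_le_ofReal (inv_le_one_of_one_le₀ (one_le_pow₀ ?_))
        linarith [norm_nonneg (x - y)]) hp hgp
    have hwx := hw.pos x
    refine lt_of_le_of_lt (b := ENNReal.ofReal (D * (w x)⁻¹) * _) ?_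
      (ENNReal.mul_lt_top ENNReal.ofReal_lt_top h2)
    rw [← lintegral_const_mul' _ _ ENNReal.ofReal_ne_top]
    refine lintegral_mono fun y => ?_
    have hwy := (hw.pos y).le
    rw [← ofReal_norm, ← ofReal_norm, ← ENNReal.ofReal_mul hwy, ← ENNReal.ofReal_mul (by positivity),
      ← ENNReal.ofReal_mul (by positivity), norm_mul, norm_norm, Real.norm_of_nonneg (by positivity)]
    refine ENNReal.ofReal_le_ofReal ?_
    have h3 := hdec 0 d x y
    rw [Nat.cast_zero, dil_zero] at h3
    calc ((1 + ‖x - y‖) ^ (d + N))⁻¹ * ‖g y‖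
        = (w x)⁻¹ * (w x * ((1 + ‖x - y‖) ^ (d + N))⁻¹) * ‖g y‖ := by field_simp
      _ ≤ (w x)⁻¹ * (D * w y * ((1 + ‖x - y‖) ^ d)⁻¹) * ‖g y‖ := by gcongr
      _ = _ := by ring
  refine (hint.comp_sub_left x).congr (Filter.Eventually.of_forall fun z => ?_)
  simp

theorem norm_le_of_mem_annulus (ha : ∀ i, 1 ≤ a i) {j : ℕ} {h : Space m}
    (hh : h ∈ annulus a m j) : ‖h‖ ≤ n :=
  (norm_le_mul_anorm ha (anorm_le_one_of_mem_annulus hh)).trans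
    (mul_le_of_le_one_right n.cast_nonneg (anorm_le_one_of_mem_annulus hh))

theorem norm_dil_neg_le_of_mem_annulus (ha : ∀ i, 1 ≤ a i) (k : ℕ) {j : ℕ} {h : Space m}
    (hh : h ∈ annulus a m j) : ‖dil a (-(k : ℝ)) h‖ ≤ n :=
  (norm_dil_le (fun i => zero_le_one.trans (ha i)) (by simp) h).trans (norm_le_of_mem_annulus ha hh)

/-- The convolution with the kernel of a block of positive index is a mean of differences. -/
theorem conv_fourier_dilSymbol_eq (ha : ∀ i, 1 ≤ a i) {χ τ : 𝓢(Space m, ℂ)}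
    {M : ℕ} (hχ : ∀ ξ, χ ξ * diffSymbol a M ξ = τ ξ) {w : Space m → ℝ} (hw : IsWeight w)
    {p : ℝ≥0∞} (hp : 1 ≤ p) {g : Space m → ℂ} (hgm : StronglyMeasurable g)
    (hgp : wLpNorm w p g < ⊤) (k : ℕ) (x : Space m) :
    conv (𝓕 (dilSymbol a k τ)) g x = ∫ h in annulus a m 0,
      (fwdDiff (dil a (-(k : ℝ)) h))^[2 * M] (conv (𝓕 (dilSymbol a k χ)) g)
        (x + -((M : ℝ) • dil a (-(k : ℝ)) h)) := by
  have ha0 : ∀ i, 0 < a i := fun i => one_pos.trans_le (ha i)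
  have hfin : IsFiniteMeasure (volume.restrict (annulus a m 0)) :=
    ⟨by rw [Measure.restrict_apply_univ]; exact volume_annulus_zero_lt_top ha0⟩
  obtain ⟨r, hr⟩ := hw.exists_integrable_decay_mul
  set X := 𝓕 (dilSymbol a k χ) with hX
  set v : ℕ → Space m → Space m := fun l h => ((l : ℝ) - M) • dil a (-(k : ℝ)) h with hv
  have hvc : ∀ l, Continuous (v l) := fun l => by
    change Continuous fun h : Space m => ((l : ℝ) - M) • dil a (-(k : ℝ)) h
    fun_prop
  have hFi : ∀ l, Integrable (Function.uncurry fun h z => X (z + v l h) * g (x - z))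
      ((volume.restrict (annulus a m 0)).prod volume) := fun l => by
    set R : ℝ := |(l : ℝ) - M| * n
    have hR : 0 ≤ R := by positivity
    have h1 := ((hr p hp g hgm hgp x).const_mul
      (2 ^ r * schwartzNorm r X * (1 + R) ^ r)).comp_snd (volume.restrict (annulus a m 0))
    refine h1.mono' ?_ ?_
    · have hXc := X.continuous
      have := hvc l
      refine AEStronglyMeasurable.mul (Continuous.aestronglyMeasurable (by fun_prop)) ?_
      exact (hgm.comp_measurable (by fun_prop)).aestronglyMeasurable
    · have hae : ∀ᵐ q ∂((volume.restrict (annulus a m 0)).prod (volume : Measure (Space m))),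
          q.1 ∈ annulus a m 0 :=
        Measure.quasiMeasurePreserving_fst.ae (ae_restrict_mem (measurableSet_annulus ha0 0))
      filter_upwards [hae] with q hq
      have h2 := norm_apply_le_schwartzNorm r X (q.2 + v l q.1)
      have h3 : ‖v l q.1‖ ≤ R := by
        change ‖((l : ℝ) - M) • dil a (-(k : ℝ)) q.1‖ ≤ |(l : ℝ) - M| * n
        rw [norm_smul, Real.norm_eq_abs]
        gcongr
        exact norm_dil_neg_le_of_mem_annulus ha k hq
      -- The shifts have length at most `R`, so they change the decay of `X` only by the factor `(1
      -- + R)^r`.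
      have h4 : 1 + ‖q.2‖ ≤ (1 + R) * (1 + ‖q.2 + v l q.1‖) := by
        have h5 : ‖q.2‖ ≤ ‖q.2 + v l q.1‖ + ‖v l q.1‖ := by
          simpa using norm_sub_le (q.2 + v l q.1) (v l q.1)
        nlinarith [norm_nonneg (q.2 + v l q.1)]
      have h6 : ((1 + ‖q.2 + v l q.1‖) ^ r)⁻¹ ≤ (1 + R) ^ r * ((1 + ‖q.2‖) ^ r)⁻¹ := by
        rw [← div_eq_mul_inv, inv_eq_one_div, div_le_div_iff₀ (by positivity) (by positivity),
          one_mul, ← mul_pow]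
        exact pow_le_pow_left₀ (by positivity) h4 r
      have hS : 0 ≤ schwartzNorm r X := apply_nonneg _ _
      simp only [Function.uncurry_def, norm_mul]
      calc _ ≤ 2 ^ r * schwartzNorm r X * ((1 + R) ^ r * ((1 + ‖q.2‖) ^ r)⁻¹) * ‖g (x - q.2)‖ := by
            gcongr
            exact h2.trans (by gcongr)
        _ = _ := by ring
  have e1 : ∀ (l : ℕ) (h : Space m), ∫ z, X (z + v l h) * g (x - z) = conv X g (x + v l h) :=
    fun l h => by
      have h1 := integral_add_right_eq_self (μ := volume)
        (fun z => X z * g (x + v l h - z)) (v l h)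
      simp only [add_sub_add_right_eq_sub] at h1
      exact h1
  -- The translation by `-M` steps centres the forward difference, whence the shifts by `l - M`
  -- steps.
  have e2 : ∀ h : Space m, (fwdDiff (dil a (-(k : ℝ)) h))^[2 * M] (conv X g)
      (x + -((M : ℝ) • dil a (-(k : ℝ)) h)) =
      ∑ l ∈ Finset.range (2 * M + 1), (diffCoeff M l : ℂ) * ∫ z, X (z + v l h) * g (x - z) :=
    fun h => by
      rw [fwdDiff_iter_eq_sum_shift]
      refine Finset.sum_congr rfl fun l _ => ?_
      rw [e1, diffCoeff, zsmul_eq_mul]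
      congr 2
      change _ = x + ((l : ℝ) - M) • dil a (-(k : ℝ)) h
      rw [← Nat.cast_smul_eq_nsmul ℝ l, sub_smul]
      abel
  simp_rw [e2]
  have hl : ∀ l, Integrable (fun h => (diffCoeff M l : ℂ) * ∫ z, X (z + v l h) * g (x - z))
      (volume.restrict (annulus a m 0)) := fun l => ((hFi l).integral_prod_left).const_mul _
  have hr : ∀ l, Integrable (fun z => (diffCoeff M l : ℂ) *
      ∫ h in annulus a m 0, X (z + v l h) * g (x - z)) volume := fun l =>
    ((hFi l).integral_prod_right).const_mul _
  rw [integral_finsetSum _ fun l _ => hl l]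
  have e3 : ∀ z, 𝓕 (dilSymbol a k τ) z * g (x - z) =
      ∑ l ∈ Finset.range (2 * M + 1), (diffCoeff M l : ℂ) *
        ∫ h in annulus a m 0, X (z + v l h) * g (x - z) := fun z => by
    rw [fourier_dilSymbol_eq_sum_integral_annulus ha0 hχ, Finset.sum_mul]
    refine Finset.sum_congr rfl fun l _ => ?_
    rw [integral_mul_const, mul_assoc]
  rw [conv]
  simp_rw [e3]
  rw [integral_finsetSum _ fun l _ => hr l]
  refine Finset.sum_congr rfl fun l _ => ?_
  rw [integral_const_mul, integral_const_mul]
  congr 1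
  exact (integral_integral_swap (hFi l)).symm

theorem exists_norm_fourier_dilSymbol_le (σ : 𝓢(Space m, ℂ)) (r : ℕ) :
    ∃ A : ℝ≥0, ∀ (k : ℕ) (z : Space m), ‖𝓕 (dilSymbol a k σ) z‖ ≤
      A * (2 ^ (k * homDim a m) * ((1 + ‖dil a k z‖) ^ r)⁻¹) := by
  have hS : 0 ≤ schwartzNorm r (𝓕 σ) := apply_nonneg _ _
  refine ⟨⟨2 ^ r * schwartzNorm r (𝓕 σ), by positivity⟩, fun k z => ?_⟩
  rw [fourier_dilSymbol, norm_mul, Complex.norm_real, Real.norm_of_nonneg (by positivity)]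
  change _ ≤ (2 ^ r * schwartzNorm r (𝓕 σ)) * _
  calc _ ≤ (2 : ℝ) ^ (k * homDim a m) *
        (2 ^ r * schwartzNorm r (𝓕 σ) * ((1 + ‖dil a k z‖) ^ r)⁻¹) := by
        gcongr
        exact norm_apply_le_schwartzNorm r _ _
    _ = _ := by ring

theorem measurable_wLpNorm_fwdDiff_iter {w : Space m → ℝ} (hw : IsWeight w) {p : ℝ≥0∞}
    (hp : 1 ≤ p) {g : Space m → ℂ} (hg : StronglyMeasurable g) (M : ℕ) :
    Measurable fun h : Space m => wLpNorm w p ((fwdDiff h)^[M] g) := by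
  simp only [wLpNorm_eq hw.pos]
  have h1 := (stronglyMeasurable_fwdDiff_iter hg M).enorm
  have h2 : Measurable fun q : Space m × Space m => ENNReal.ofReal (w q.1) :=
    (hw.smooth.continuous.measurable.comp measurable_fst).ennreal_ofReal
  exact measurable_eLpNorm_section (μ := volume)
    (F := fun x h : Space m => ENNReal.ofReal (w x) * ‖(fwdDiff h)^[M] g x‖ₑ) (h2.mul h1) hp

theorem measurable_weight_mul_fwdDiff_iter {w : Space m → ℝ} (hw : IsWeight w) {u : Space m → ℂ}
    (hu : StronglyMeasurable u) (K : ℕ) {D : Space m → Space m} (hD : Continuous D) (c : ℝ) :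
    Measurable (Function.uncurry fun x h : Space m => ENNReal.ofReal (w x) *
      ‖(fwdDiff (D h))^[K] u (x + -(c • D h))‖ₑ) := by
  have h1 := (stronglyMeasurable_fwdDiff_iter hu K).enorm
  have h2 : Measurable fun q : Space m × Space m => ENNReal.ofReal (w q.1) :=
    (hw.smooth.continuous.measurable.comp measurable_fst).ennreal_ofReal
  have h3 : Measurable fun q : Space m × Space m => (q.1 + -(c • D q.2), D q.2) := by
    have := hD.measurable
    fun_prop
  have h4 := h1.comp h3
  simp only [Function.comp_def, Function.uncurry_apply_pair] at h4
  exact h2.mul h4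

/-- The blocks of positive index are controlled by the means of the differences. -/
theorem exists_wLpNorm_conv_le_lintegral_annulus (ha : ∀ i, 1 ≤ a i) {χ τ : 𝓢(Space m, ℂ)}
    {M : ℕ} (hχ : ∀ ξ, χ ξ * diffSymbol a M ξ = τ ξ) {w : Space m → ℝ} (hw : IsWeight w) :
    ∃ C : ℝ≥0, ∀ p : ℝ≥0∞, 1 ≤ p → ∀ (k : ℕ) (g : Space m → ℂ), StronglyMeasurable g →
      IsConvolvable g → wLpNorm w p g < ⊤ →
      wLpNorm w p (conv (𝓕 (dilSymbol a k τ)) g) ≤ C * (ENNReal.ofReal (2 ^ (k * homDim a m)) *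
        ∫⁻ h in annulus a m k, wLpNorm w p ((fwdDiff h)^[M] g)) := by
  have ha0 : ∀ i, 0 < a i := fun i => one_pos.trans_le (ha i)
  obtain ⟨C1, r, -, hC1⟩ := hw.exists_wLpNorm_conv_le (fun i => (ha0 i).le)
  obtain ⟨A, hA⟩ := exists_norm_fourier_dilSymbol_le (a := a) χ r
  obtain ⟨C2, -, hC2⟩ := hw.exists_wLpNorm_translate_le (M * n)
  obtain ⟨C3, -, hC3⟩ := hw.exists_wLpNorm_fwdDiff_iter_le n M
  refine ⟨C2 * (C1 * A * C3), fun p hp k g hgm hgc hgp => ?_⟩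
  set X := 𝓕 (dilSymbol a k χ) with hX
  set D : Space m → Space m := fun h => dil a (-(k : ℝ)) h with hD
  have hDc : Continuous D := (dil a (-(k : ℝ)) : Space m ≃L[ℝ] Space m).continuous
  have hum : StronglyMeasurable (conv X g) := stronglyMeasurable_conv X hgm
  have hjm : Measurable (Function.uncurry fun x h : Space m => ENNReal.ofReal (w x) *
      ‖(fwdDiff (D h))^[2 * M] (conv X g) (x + -((M : ℝ) • D h))‖ₑ) :=
    measurable_weight_mul_fwdDiff_iter hw hum (2 * M) hDc M
  rw [← lintegral_annulus_zero ha0 k fun h => wLpNorm w p ((fwdDiff h)^[M] g)]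
  calc wLpNorm w p (conv (𝓕 (dilSymbol a k τ)) g)
      ≤ eLpNorm (fun x => ∫⁻ h in annulus a m 0, ENNReal.ofReal (w x) *
          ‖(fwdDiff (D h))^[2 * M] (conv X g) (x + -((M : ℝ) • D h))‖ₑ) p volume := by
        rw [wLpNorm_eq hw.pos]
        refine eLpNorm_mono_enorm fun x => ?_
        simp only [enorm_eq_self]
        rw [lintegral_const_mul' _ _ ENNReal.ofReal_ne_top, conv_fourier_dilSymbol_eq ha hχ hw hp hgm
          hgp]
        gcongr
        exact enorm_integral_le_lintegral_enorm _
    _ ≤ ∫⁻ h in annulus a m 0, eLpNorm (fun x => ENNReal.ofReal (w x) *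
          ‖(fwdDiff (D h))^[2 * M] (conv X g) (x + -((M : ℝ) • D h))‖ₑ) p volume :=
        eLpNorm_lintegral_le hjm hp
    _ ≤ ∫⁻ h in annulus a m 0, (C2 * (C1 * A * C3) : ℝ≥0) * wLpNorm w p ((fwdDiff (D h))^[M] g) := by
        refine setLIntegral_mono' (measurableSet_annulus ha0 0) fun h hh => ?_
        have hDn : ‖D h‖ ≤ n := norm_dil_neg_le_of_mem_annulus ha k hh
        have h1 := stronglyMeasurable_fwdDiff_iter_right hum (2 * M) (D h)
        have h2 := hC2 (-((M : ℝ) • D h)) (by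
          rw [norm_neg, norm_smul, Real.norm_natCast]; gcongr) p _ h1.aestronglyMeasurable
        rw [wLpNorm_eq hw.pos] at h2
        refine h2.trans ?_
        rw [fwdDiff_iter_conv hgc]
        have h3 := hC1 k A X (hA k) p hp _
          (stronglyMeasurable_fwdDiff_iter_right hgm (2 * M) (D h))
        have h4 := (hC3 (D h) hDn p hp _
          (stronglyMeasurable_fwdDiff_iter_right hgm M (D h)).aestronglyMeasurable).2
        -- Of the `2M` differences, `M` are discarded at bounded cost and `M` remain on `g`.
        rw [← Function.iterate_add_apply, ← two_mul] at h4
        calc _ ≤ (C2 : ℝ≥0∞) * (C1 * A * (C3 * wLpNorm w p ((fwdDiff (D h))^[M] g))) := by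
              gcongr
              exact h3.trans (by gcongr)
          _ = _ := by push_cast; ring
    _ = _ := by rw [lintegral_const_mul' _ _ ENNReal.coe_ne_top]

theorem eLpNorm_ite_zero_le (q : ℝ≥0∞) (hq : 1 ≤ q) (c : ℝ≥0∞) :
    eLpNorm (fun k : ℕ => if k = 0 then c else 0) q Measure.count ≤ c := by
  rcases eq_or_ne q ⊤ with rfl | hqt
  · rw [eLpNorm_exponent_top, eLpNormEssSup_count]
    refine iSup_le fun k => ?_
    rw [enorm_eq_self]
    split_ifs <;> simp
  · have hq0 : q ≠ 0 := (one_pos.trans_le hq).ne'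
    have hr : 0 < q.toReal := ENNReal.toReal_pos hq0 hqt
    rw [eLpNorm_nat_eq_tsum hq0 hqt, tsum_eq_single 0]
    · simp only [if_true]
      rw [← ENNReal.rpow_mul, mul_one_div_cancel hr.ne', ENNReal.rpow_one]
    · intro k hk
      rw [if_neg hk, ENNReal.zero_rpow_of_pos hr]

/-- The Besov norm is controlled by the difference norm. -/
theorem exists_besovNorm_le (ha : ∀ i, 1 ≤ a i) {φ : Space m → ℝ} (hφ : IsCutoff a φ)
    {w : Space m → ℝ} (hw : IsWeight w) {s : ℝ} (hs : 0 < s) :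
    ∃ C : ℝ≥0, 1 ≤ C ∧ ∀ p q : ℝ≥0∞, 1 ≤ p → 1 ≤ q → ∀ (f : 𝓢'(Space m, ℂ)) (g : Space m → ℂ),
      Represents g f → besovNorm a φ s p q w f ≤ C * diffNorm a s p q w g := by
  have ha0 : ∀ i, 0 < a i := fun i => one_pos.trans_le (ha i)
  have hd := homDim_nonneg (m := m) fun i => (ha0 i).le
  obtain ⟨L, hL, hblock⟩ := hφ.exists_isLowPass ha0
  set M := ⌊s⌋₊ + 1 with hM
  obtain ⟨χ, hχ⟩ := hL.exists_mul_diffSymbol_eq ha M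
  obtain ⟨C1, hC1⟩ := exists_wLpNorm_conv_le_lintegral_annulus ha hχ hw
  obtain ⟨C2, r, -, hC2⟩ := hw.exists_wLpNorm_conv_le (fun i => (ha0 i).le)
  obtain ⟨A, hA⟩ := exists_norm_fourier_dilSymbol_le (a := a) L r
  obtain ⟨V, -, hV⟩ := exists_eLpNorm_lintegral_annulus_le (m := m) ha0
  -- `C2 * A` serves the low-pass block, `C1 * V` the others. The summand `1` keeps the constant
  -- nonzero, so the bound is trivial when the norm of `g` is infinite.
  refine ⟨1 + C2 * A + C1 * V, by rw [add_assoc]; simp, fun p q hp hq f g' hg' => ?_⟩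
  have hgm : StronglyMeasurable (hg'.1.mk g') := hg'.1.stronglyMeasurable_mk
  have hgr := hg'.congr hg'.1.ae_eq_mk
  rw [diffNorm_congr hg'.1.ae_eq_mk]
  set g := hg'.1.mk g'
  rcases eq_or_ne (wLpNorm w p g) ⊤ with htop | hgp
  · rw [diffNorm, htop, add_top, ENNReal.mul_top (by simp)]
    exact le_top
  replace hgp := lt_top_iff_ne_top.2 hgp
  set F : Space m → ℝ≥0∞ := fun h =>
    wLpNorm w p ((fwdDiff h)^[M] g) / ENNReal.ofReal (anorm a h ^ s) with hF
  have hFm : Measurable F := (measurable_wLpNorm_fwdDiff_iter hw hp hgm M).div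
    ((continuous_anorm ha0).measurable.pow_const _).ennreal_ofReal
  have hrep : ∀ k, distWLpNorm w p (block a φ k f) =
      wLpNorm w p (conv (𝓕 (blockSymbol a L k)) g) := fun k =>
    (hgr.conv hw hp (fun ξ => dilSymbol_even _ (hL.blockBase_even k) ξ) hgm hgp
      (hblock k f)).distWLpNorm_eq w p
  have hle : ∀ k : ℕ, ENNReal.ofReal ((2 : ℝ) ^ (s * ((k : ℝ) - 1))) *
      distWLpNorm w p (block a φ k f) ≤ (if k = 0 then (C2 * A : ℝ≥0) * wLpNorm w p g else 0) +
        C1 * ∫⁻ h in annulus a m k, F h ∂(incrementMeasure a m) := by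
    intro k
    rw [hrep]
    rcases eq_or_ne k 0 with rfl | hk
    · rw [if_pos rfl]
      refine le_trans ?_ le_self_add
      have h1 := hC2 0 A (𝓕 (blockSymbol a L 0)) (hA 0) p hp g hgm
      refine (mul_le_of_le_one_left zero_le ?_).trans (h1.trans_eq (by push_cast; rfl))
      rw [← ENNReal.ofReal_one]
      refine ENNReal.ofReal_le_ofReal (Real.rpow_le_one_of_one_le_of_nonpos one_le_two ?_)
      rw [Nat.cast_zero]
      linarith
    · rw [if_neg hk, zero_add]
      have e : blockSymbol a L k = dilSymbol a k (blockBase a L 1) := by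
        rw [blockSymbol]; congr 1; simp [blockBase, hk]
      rw [e]
      have h1 := hC1 p hp k g hgm hgr.isConvolvable hgp
      refine (mul_le_mul_right h1 _).trans ?_
      rw [mul_left_comm]
      gcongr
      rw [incrementMeasure_restrict_annulus ha0, lintegral_withDensity_eq_lintegral_mul _
        (measurable_density ha0) hFm, ← mul_assoc, ← ENNReal.ofReal_mul (by positivity),
        ← lintegral_const_mul' _ _ ENNReal.ofReal_ne_top]
      refine setLIntegral_mono' (measurableSet_annulus ha0 k) fun h hh => ?_
      have hpos := anorm_pos_of_mem_annulus hh
      rw [Pi.mul_apply]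
      simp only [hF]
      rw [ENNReal.div_eq_inv_mul,
        ← ENNReal.ofReal_inv_of_pos (Real.rpow_pos_of_pos hpos _), ← mul_assoc,
        ← ENNReal.ofReal_mul (Real.rpow_nonneg hpos.le _)]
      rw [mul_comm (anorm a h ^ _)]
      -- On the annulus of index `k`, `|h|_a ≤ 2^{-k}`. Used with `t = s` for the quotient and with
      -- `t = a · m` for the density.
      have h2 : ∀ t : ℝ, 0 ≤ t → (2 : ℝ) ^ ((k : ℝ) * t) ≤ (anorm a h ^ t)⁻¹ := fun t ht => by
        rw [le_inv_comm₀ (by positivity) (Real.rpow_pos_of_pos hpos _),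
          ← Real.rpow_neg (by norm_num), ← neg_mul, Real.rpow_mul (by norm_num)]
        exact Real.rpow_le_rpow hpos.le hh.2 ht
      rw [Real.rpow_neg hpos.le]
      gcongr ENNReal.ofReal (?_ * ?_) * _
      · refine le_trans ?_ (h2 s hs.le)
        refine Real.rpow_le_rpow_of_exponent_le one_le_two ?_
        linarith
      · exact h2 _ hd
  have hmain : besovNorm a φ s p q w f ≤ (C2 * A : ℝ≥0) * wLpNorm w p g +
      C1 * (V * eLpNorm F q (incrementMeasure a m)) := by
    refine (eLpNorm_mono_enorm fun k => ?_).trans ((eLpNorm_add_le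
      (f := fun k : ℕ => if k = 0 then (C2 * A : ℝ≥0) * wLpNorm w p g else 0)
      (g := fun k : ℕ => (C1 : ℝ≥0∞) * ∫⁻ h in annulus a m k, F h ∂(incrementMeasure a m))
      (Measurable.of_discrete.aestronglyMeasurable) (Measurable.of_discrete.aestronglyMeasurable)
      hq).trans (add_le_add (eLpNorm_ite_zero_le q hq _) ?_))
    · simp only [enorm_eq_self, Pi.add_apply]
      exact hle k
    · refine (eLpNorm_const_mul_ennreal _ _ _).trans ?_
      gcongr
      exact hV q hq F hFm
  refine hmain.trans ?_
  rw [diffNorm, mul_add, add_comm, ← mul_assoc, ← ENNReal.coe_mul]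
  gcongr
  · exact le_add_self
  · rw [add_comm 1 (C2 * A), add_assoc]
    exact le_self_add

end Lower

/-! ### Two-sided bounds and products of functions with the weight. -/

section Comparison

variable {n : ℕ} {m : Fin n → ℕ} {a : Fin n → ℝ}

theorem Comparable.of_le {C D E : ℝ≥0} (hE : 1 ≤ E) (hC : C ≤ E) (hD : D ≤ E) {A B : ℝ≥0∞}
    (h1 : A ≤ C * B) (h2 : B ≤ D * A) : Comparable E A B := by
  refine ⟨?_, h1.trans (by gcongr)⟩
  rw [ENNReal.inv_mul_le_iff (by simpa using (one_pos.trans_le hE).ne') ENNReal.coe_ne_top]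
  exact h2.trans (by gcongr)

theorem Represents.weightMul {ρ : Space m → ℝ} (hρ : IsWeight ρ) {g : Space m → ℂ}
    {f : 𝓢'(Space m, ℂ)} (h : Represents g f) :
    Represents (fun x => (ρ x : ℂ) * g x) (AnisoBesov.weightMul ρ f) := by
  refine ⟨hρ.aestronglyMeasurable_mul h.1, fun ψ => ?_⟩
  have e : ∀ x, smulLeftCLM ℂ (fun x => (ρ x : ℂ)) ψ x * g x = ψ x * ((ρ x : ℂ) * g x) := fun x => by
    rw [smulLeftCLM_apply_apply hρ.hasTemperateGrowth, smul_eq_mul]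
    ring
  have h1 := h.2 (smulLeftCLM ℂ (fun x => (ρ x : ℂ)) ψ)
  simp_rw [e] at h1
  exact h1

end Comparison

end AnisoBesov

end

/-! ### Assembly of the equivalences. -/

theorem theorem2p5 {n : ℕ} (hn : 1 ≤ n) {m : Fin n → ℕ} (hm : ∀ i, 1 ≤ m i)
    {a : Fin n → ℝ} (ha : ∀ i, 1 ≤ a i)
    {φ : AnisoBesov.Space m → ℝ} (hφ : AnisoBesov.IsCutoff a φ)
    {ρ : AnisoBesov.Space m → ℝ} (hρ : AnisoBesov.IsAdmissibleWeight a ρ)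
    {p q : ℝ≥0∞} (hp : 1 ≤ p) (hq : 1 ≤ q) :
    (∀ s : ℝ, 0 < s → ∃ C : ℝ≥0, 1 ≤ C ∧
      ∀ f ∈ AnisoBesov.besovSpace a φ s p q ρ,
        (∃ g : AnisoBesov.Space m → ℂ, AnisoBesov.Represents g f) ∧
        ∀ g : AnisoBesov.Space m → ℂ, AnisoBesov.Represents g f →
          AnisoBesov.Comparable C
            (AnisoBesov.besovNorm a φ s p q ρ f) (AnisoBesov.diffNorm a s p q ρ g) ∧
          AnisoBesov.Comparable C
            (AnisoBesov.diffNorm a s p q ρ g)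
            (AnisoBesov.diffNorm a s p q (fun _ => 1) (fun x => (ρ x : ℂ) * g x))) ∧
    (∀ s : ℝ, ∃ C : ℝ≥0, 1 ≤ C ∧
      ∀ f : 𝓢'(AnisoBesov.Space m, ℂ),
        AnisoBesov.Comparable C
          (AnisoBesov.besovNorm a φ s p q ρ f)
          (AnisoBesov.besovNorm a φ s p q (fun _ => 1) (AnisoBesov.weightMul ρ f))) := by
  have hw := hρ.isWeight ha
  refine ⟨fun s hs => ?_, fun s => ?_⟩
  · obtain ⟨C1, -, h1⟩ := AnisoBesov.exists_besovNorm_le ha hφ hw hs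
    obtain ⟨C2, h2⟩ := AnisoBesov.exists_diffNorm_le ha hφ hw hs
    obtain ⟨C3, -, h3⟩ := AnisoBesov.exists_comparable_besovNorm_weightMul ha hφ hw s
    obtain ⟨C4, h4⟩ := AnisoBesov.exists_diffNorm_le ha hφ AnisoBesov.IsWeight.one hs
    obtain ⟨C5, -, h5⟩ := AnisoBesov.exists_besovNorm_le ha hφ AnisoBesov.IsWeight.one hs
    -- The two products come from the chains difference norm, Besov norm, Besov norm of the other
    -- function, its difference norm: `C2 * C3 * C5` bounds `f` by `ρ f`, and `C4 * C3 * C1` bounds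
    -- `ρ f` by `f`.
    refine ⟨1 + C1 + C2 + C2 * C3 * C5 + C4 * C3 * C1, ?_, fun f hf => ?_⟩
    · simp only [add_assoc]
      exact le_self_add
    obtain ⟨hex, hle⟩ := h2 p q hp hq f hf
    refine ⟨hex, fun g hg => ?_⟩
    have hE : 1 ≤ 1 + C1 + C2 + C2 * C3 * C5 + C4 * C3 * C1 := by
      simp only [add_assoc]
      exact le_self_add
    have hb := h1 p q hp hq f g hg
    have hd := hle g hg
    obtain ⟨h3a, h3b⟩ := h3 p q hp hq f
    have hg' := hg.weightMul hw
    have hb' := h5 p q hp hq _ _ hg'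
    -- The bound for `ρ f` requires its unweighted Besov norm to be finite, which the second claim
    -- provides.
    have hd' := (h4 p q hp hq _ (h3b.trans_lt (ENNReal.mul_lt_top ENNReal.coe_lt_top hf))).2 _ hg'
    refine ⟨AnisoBesov.Comparable.of_le (C := C1) (D := C2) hE ?_ ?_ hb hd,
      AnisoBesov.Comparable.of_le (C := C2 * C3 * C5) (D := C4 * C3 * C1) hE ?_ le_add_self ?_ ?_⟩
    · calc C1 ≤ 1 + C1 := le_add_self
        _ ≤ _ := by simp only [add_assoc]; gcongr; exact le_self_add
    · calc C2 ≤ 1 + C1 + C2 := le_add_self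
        _ ≤ _ := by rw [add_assoc (1 + C1 + C2)]; exact le_self_add
    · exact le_add_self.trans le_self_add
    · calc _ ≤ (C2 : ℝ≥0∞) * (C3 * (C5 * _)) := by
            refine hd.trans ?_
            gcongr
            refine h3a.trans ?_
            gcongr
        _ = _ := by push_cast; ring
    · calc _ ≤ (C4 : ℝ≥0∞) * (C3 * (C1 * _)) := by
            refine hd'.trans ?_
            gcongr
            refine h3b.trans ?_
            gcongr
        _ = _ := by push_cast; ring
  · obtain ⟨C, hC, h⟩ := AnisoBesov.exists_comparable_besovNorm_weightMul ha hφ hw s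
    refine ⟨C, hC, fun f => ?_⟩
    obtain ⟨h1, h2⟩ := h p q hp hq f
    exact AnisoBesov.Comparable.of_le hC le_rfl le_rfl h1 h2
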